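/- There is a numerical constant $C_0>0$ such that the following holds. Let $\mathbb T=\mathbb R/\mathbb Z$ with the wrap-around distance, let $f_{\mathrm{lo}}\ge 1$ be an integer, and let $x=\sum_j a_j\delta_{t_j}$ be a finite superposition of Dirac measures on $\mathbb T$ with complex amplitudes, whose support $T=\{t_j\}$ satisfies the minimum-separation condition $\Delta(T)=\inf_{t,t'\in T,\ t\ne t'}|t-t'|\ge 2/f_{\mathrm{lo}}$ (with $\inf\emptyset=+\infty$). Let $\sigma\ge 0$, $\gamma>0$, and suppose that we observe $$\eta(k)=\int_{\mathbb T}e^{-i2\pi kt}\,x(dt)+\epsilon_k,\qquad k=-f_{\mathrm{lo}},\dots,f_{\mathrm{lo}},$$ where the $\epsilon_k$ are iid complex $\mathcal N(0,\sigma^2)$ variables, i.e. their real and imaginary parts are independent real $\mathcal N(0,\sigma^2)$ variables. Put $y(t)=\sum_{|k|\le f_{\mathrm{lo}}}\eta(k)e^{i2\pi kt}$, let $Q_{\mathrm{lo}}$ be convolution with the Dirichlet kernel $\sum_{|k|\le f_{\mathrm{lo}}}e^{i2\pi kt}$, and let $\delta=(1+\gamma)\,\sigma\sqrt{4f_{\mathrm{lo}}+2}$.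 Then with probability at least $1-e^{-2f_{\mathrm{lo}}\gamma^2}$ every solution $x_{\mathrm{est}}$ of the total-variation minimization problem $$\min_{\tilde x}\ \|\tilde x\|_{TV}\quad\text{subject to}\quad \|Q_{\mathrm{lo}}\tilde x-y\|_{L_2(\mathbb T)}\le\delta$$ over the complex measures $\tilde x$ on $\mathbb T$ satisfies, simultaneously for all integers $f_{\mathrm{hi}}>f_{\mathrm{lo}}$, $$\|K_{\mathrm{hi}}*(x_{\mathrm{est}}-x)\|_{L_1(\mathbb T)}\le C_0\,(1+\gamma)\,\sqrt{4f_{\mathrm{lo}}+2}\;\mathrm{SRF}^2\,\sigma,\qquad \mathrm{SRF}=\frac{f_{\mathrm{hi}}}{f_{\mathrm{lo}}},$$ where $K_{\mathrm{hi}}(t)=\frac1{f_{\mathrm{hi}}+1}\sum_{|k|\le f_{\mathrm{hi}}}(f_{\mathrm{hi}}+1-|k|)e^{i2\pi kt}$ is the Fejér kernel. -/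

import Mathlib

open MeasureTheory ProbabilityTheory
open scoped ENNReal NNReal

noncomputable section

namespace SuperRes

/-- The integral `∫ f dμ` of a complex-valued function against a complex measure on the circle
`𝕋 = ℝ / ℤ`. -/
def cintegral (μ : ComplexMeasure UnitAddCircle) (f : UnitAddCircle → ℂ) : ℂ :=
  μ.integral f (ContinuousLinearMap.mul ℝ ℂ)

/-- The total-variation norm `‖μ‖_TV = |μ|(𝕋)`. -/
def tvNorm (μ : ComplexMeasure UnitAddCircle) : ℝ≥0∞ :=
  μ.variation Set.univ

/-- The Fourier coefficient `∫ e^{-i 2π k t} μ(dt)`. -/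
def fourierCoeffMeasure (μ : ComplexMeasure UnitAddCircle) (k : ℤ) : ℂ :=
  cintegral μ (fun t => fourier (-k) t)

/-- The convolution `(K * μ)(t) = ∫ K(t - τ) μ(dτ)`. -/
def conv (K : UnitAddCircle → ℂ) (μ : ComplexMeasure UnitAddCircle) (t : UnitAddCircle) : ℂ :=
  cintegral μ (fun τ => K (t - τ))

/-- The periodic Dirichlet kernel `∑_{|k| ≤ f} e^{i 2π k t}`. -/
def dirichletKernel (f : ℕ) (t : UnitAddCircle) : ℂ :=
  ∑ k ∈ Finset.Icc (-(f : ℤ)) f, fourier k t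

/-- The Fejér kernel `(1 / (f + 1)) ∑_{|k| ≤ f} (f + 1 - |k|) e^{i 2π k t}`. -/
def fejerKernel (f : ℕ) (t : UnitAddCircle) : ℂ :=
  (1 / ((f : ℂ) + 1)) *
    ∑ k ∈ Finset.Icc (-(f : ℤ)) f, ((f : ℂ) + 1 - ((|k| : ℤ) : ℂ)) * fourier k t

/-- The low-pass operator `Q_lo`, i.e. convolution with the Dirichlet kernel. -/
def lowPass (flo : ℕ) (μ : ComplexMeasure UnitAddCircle) : UnitAddCircle → ℂ :=
  conv (dirichletKernel flo) μ

/-- The superposition of point sources `∑_j a_j δ_{t_j}`; the sources are given as a finitely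
supported function `a`, whose support is the set `T` of the points `t_j`. -/
def pointSources (a : UnitAddCircle →₀ ℂ) : ComplexMeasure UnitAddCircle :=
  ∑ t ∈ a.support, VectorMeasure.dirac t (a t)

/-- The set of the `2 f + 1` frequencies `-f, …, f`. -/
abbrev LowFreq (f : ℕ) : Type := {k : ℤ // k ∈ Finset.Icc (-(f : ℤ)) f}

/-- The noisy spectral samples `η_k = ∫ e^{-i 2π k t} x(dt) + ε_k`, `|k| ≤ f`. -/
def noisySpectrum {flo : ℕ} (x : ComplexMeasure UnitAddCircle) (ε : LowFreq flo → ℂ)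
    (k : LowFreq flo) : ℂ :=
  fourierCoeffMeasure x k + ε k

/-- The band-limited function `y(t) = ∑_{|k| ≤ f} η_k e^{i 2π k t}` with the spectrum `η`. -/
def synth {flo : ℕ} (η : LowFreq flo → ℂ) (t : UnitAddCircle) : ℂ :=
  ∑ k : LowFreq flo, η k * fourier (k : ℤ) t

/-- The data constraint `‖Q_lo μ - y‖_{L²(𝕋)} ≤ δ`. -/
def IsFeasible (flo : ℕ) (y : UnitAddCircle → ℂ) (δ : ℝ)
    (μ : ComplexMeasure UnitAddCircle) : Prop :=
  eLpNorm (fun t => lowPass flo μ t - y t) 2 volume ≤ ENNReal.ofReal δ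

/-- `μ` solves `min ‖x̃‖_TV` subject to `‖Q_lo x̃ - y‖_{L²(𝕋)} ≤ δ`, over all complex measures `x̃`
on `𝕋`. -/
def IsTVSolution (flo : ℕ) (y : UnitAddCircle → ℂ) (δ : ℝ)
    (μ : ComplexMeasure UnitAddCircle) : Prop :=
  IsFeasible flo y δ μ ∧ ∀ ν, IsFeasible flo y δ ν → tvNorm μ ≤ tvNorm ν

/-- `Z` is complex `N(0, σ²)`: its real and imaginary parts are independent real `N(0, σ²)`
variables. -/
def IsComplexGaussian {Ω : Type*} [MeasurableSpace Ω] (Z : Ω → ℂ) (σ : ℝ≥0) (P : Measure Ω) :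
    Prop :=
  HasLaw (fun ω => (Z ω).re) (gaussianReal 0 (σ ^ 2)) P ∧
    HasLaw (fun ω => (Z ω).im) (gaussianReal 0 (σ ^ 2)) P ∧
    IndepFun (fun ω => (Z ω).re) (fun ω => (Z ω).im) P

end SuperRes

end

noncomputable section

namespace SuperRes

/-! Let h be the difference between a solution and the true measure, and T the support of the
latter. Since the Fejér kernel has L¹ norm one, the L¹ norm of K_hi * h equals |∫ g dh| for some
trigonometric polynomial g of degree f_hi with |g| ≤ 1
(`exists_trigPoly_integral_norm_conv_fejerKernel_le`). Direct information on h exists only at degree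
f_lo: when both measures are feasible, Q_lo h has L¹ norm at most 2δ, so h pairs with a polynomial
of degree at most f_lo to at most 2δ times its sup norm.

Hence g is split as p + (g - p), where p has degree at most f_lo and matches the values and
derivatives of g on T. Its sup norm is O(SRF), so ∫ p dh is O(SRF δ). For the rest one uses a dual
certificate q, also of degree at most f_lo: it has modulus one on T with phases conjugate to those
of h, and |q| falls quadratically near T and stays below 0.95 away from T. Minimality of the total
variation bounds the mass of h off T by its mass on T, and pairing with q turns this into ∫ (1 -
|q|) d|h| ≤ 2δ (`integral_one_sub_norm_le`). Now g - p vanishes to second order on T, and by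
`bernstein` the second derivative of g is O(SRF²) at the scale 1/f_lo. So |g - p| ≤ C SRF² (1 - |q|)
everywhere (`IsTrigPoly.exists_low_degree`), and ∫ (g - p) dh is O(SRF² δ). This is
`eLpNorm_conv_fejerKernel_le`.

Both p and q are Hermite interpolants assembled from translates of sinc⁴ and x sinc⁴. On the line,
with nodes π apart, the interpolation system is a small perturbation of the identity, and the
numerical constants verify this together with the decay of q. Periodization at scale πM gives
trigonometric polynomials of degree 2M - 1 (`hasSum_periodization`); M = ⌊(f_lo + 1)/2⌋ makes this
at most f_lo, while separation 2/f_lo becomes at least π on the line.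

Randomness enters only through the event that the noise has L² norm at most δ, which makes the true
measure feasible. A Chernoff bound (`measure_sum_norm_sq_le`) gives its probability; everything
after that is deterministic, so one event serves all solutions and all f_hi. -/

/-! ### The kernel `sinc ^ 4` on the line -/

/-- Second-order Taylor estimate with the sharp constant. -/
lemma norm_taylor_one_le {E : Type*} [NormedAddCommGroup E] [NormedSpace ℝ E]
    {f f' f'' : ℝ → E} {C x₀ h : ℝ}
    (hf : ∀ x, |x - x₀| ≤ |h| → HasDerivAt f (f' x) x)
    (hf' : ∀ x, |x - x₀| ≤ |h| → HasDerivAt f' (f'' x) x)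
    (hC : ∀ x, |x - x₀| ≤ |h| → ‖f'' x‖ ≤ C) :
    ‖f (x₀ + h) - f x₀ - h • f' x₀‖ ≤ C * h ^ 2 / 2 := by
  have hmem : ∀ s ∈ Set.Icc (0 : ℝ) 1, |x₀ + s * h - x₀| ≤ |h| := by
    intro s hs
    rw [add_sub_cancel_left, abs_mul, abs_of_nonneg hs.1]
    exact mul_le_of_le_one_left (abs_nonneg h) hs.2
  have h1 : ∀ s ∈ Set.Icc (0 : ℝ) 1, ‖f' (x₀ + s * h) - f' x₀‖ ≤ C * (s * |h|) := by
    intro s hs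
    have := (convex_closedBall x₀ |h|).norm_image_sub_le_of_norm_hasDerivWithin_le
      (f := f') (f' := f'') (C := C) (x := x₀) (y := x₀ + s * h)
      (fun x hx => (hf' x (by simpa [Real.dist_eq] using hx)).hasDerivWithinAt)
      (fun x hx => hC x (by simpa [Real.dist_eq] using hx))
      (by simp) (by simpa [Real.dist_eq] using hmem s hs)
    refine this.trans_eq ?_
    rw [add_sub_cancel_left, Real.norm_eq_abs, abs_mul, abs_of_nonneg hs.1]
  have hline : ∀ s : ℝ, HasDerivAt (fun s : ℝ => x₀ + s * h) h s := fun s => by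
    simpa using ((hasDerivAt_id s).mul_const h).const_add x₀
  have hd : ∀ s ∈ Set.Icc (0 : ℝ) 1,
      HasDerivAt (fun s : ℝ => f (x₀ + s * h) - f x₀ - (s * h) • f' x₀)
        (h • (f' (x₀ + s * h) - f' x₀)) s := by
    intro s hs
    have e1 := (hf _ (hmem s hs)).scomp s (hline s)
    have e2 : HasDerivAt (fun s : ℝ => (s * h) • f' x₀) (h • f' x₀) s := by
      simpa using ((hasDerivAt_id s).mul_const h).smul_const (f' x₀)
    have := (e1.sub_const (f x₀)).sub e2
    rw [smul_sub]
    exact this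
  -- Comparison with the primitive `C * h ^ 2 * s ^ 2 / 2` keeps the factor 1/2 that two
  -- applications of the mean value inequality would lose.
  have key := image_norm_le_of_norm_deriv_right_le_deriv_boundary
    (f := fun s : ℝ => f (x₀ + s * h) - f x₀ - (s * h) • f' x₀)
    (f' := fun s => h • (f' (x₀ + s * h) - f' x₀))
    (a := 0) (b := 1) (B := fun s => C * h ^ 2 * s ^ 2 / 2) (B' := fun s => C * h ^ 2 * s)
    (fun s hs => (hd s hs).continuousAt.continuousWithinAt)
    (fun s hs => (hd s (Set.Ico_subset_Icc_self hs)).hasDerivWithinAt)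
    (by simp)
    (fun s => by
      have := ((hasDerivAt_pow 2 s).const_mul (C * h ^ 2)).div_const 2
      convert! this using 1
      simp; ring)
    (fun s hs => by
      rw [norm_smul, Real.norm_eq_abs]
      calc |h| * ‖f' (x₀ + s * h) - f' x₀‖ ≤ |h| * (C * (s * |h|)) :=
            mul_le_mul_of_nonneg_left (h1 s (Set.Ico_subset_Icc_self hs)) (abs_nonneg h)
        _ = C * |h| ^ 2 * s := by ring
        _ = C * h ^ 2 * s := by rw [sq_abs])
    (Set.right_mem_Icc.2 zero_le_one)
  simpa using key

/-- The kernel `sinc ^ 4`. -/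
def phi (x : ℝ) : ℝ := Real.sinc x ^ 4

/-- The odd companion `x * sinc x ^ 4` of `phi`. -/
def psi (x : ℝ) : ℝ := Real.sin x ^ 4 / x ^ 3

/-- The derivative of `phi` away from the origin. -/
def phi' (x : ℝ) : ℝ :=
  4 * Real.sin x ^ 3 * Real.cos x / x ^ 4 - 4 * Real.sin x ^ 4 / x ^ 5

/-- The derivative of `psi` away from the origin. -/
def psi' (x : ℝ) : ℝ :=
  4 * Real.sin x ^ 3 * Real.cos x / x ^ 3 - 3 * Real.sin x ^ 4 / x ^ 4

/-- The second derivative of `phi` away from the origin. -/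
def phi'' (x : ℝ) : ℝ :=
  (12 * Real.sin x ^ 2 * Real.cos x ^ 2 - 4 * Real.sin x ^ 4) / x ^ 4
    - 32 * Real.sin x ^ 3 * Real.cos x / x ^ 5 + 20 * Real.sin x ^ 4 / x ^ 6

/-- The second derivative of `psi` away from the origin. -/
def psi'' (x : ℝ) : ℝ :=
  (12 * Real.sin x ^ 2 * Real.cos x ^ 2 - 4 * Real.sin x ^ 4) / x ^ 3
    - 24 * Real.sin x ^ 3 * Real.cos x / x ^ 4 + 12 * Real.sin x ^ 4 / x ^ 5

lemma phi_of_ne_zero {x : ℝ} (hx : x ≠ 0) : phi x = Real.sin x ^ 4 / x ^ 4 := by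
  rw [phi, Real.sinc_of_ne_zero hx, div_pow]

lemma phi_zero : phi 0 = 1 := by simp [phi]

lemma psi_zero : psi 0 = 0 := by simp [psi]

lemma psi_eq (x : ℝ) : psi x = x * phi x := by
  rcases eq_or_ne x 0 with rfl | hx
  · simp [psi]
  · rw [phi_of_ne_zero hx, psi]; field_simp

lemma hasDerivAt_phi {x : ℝ} (hx : x ≠ 0) : HasDerivAt phi (phi' x) x := by
  have h : HasDerivAt (fun y : ℝ => Real.sin y ^ 4 / y ^ 4) (phi' x) x := by
    refine (((Real.hasDerivAt_sin x).pow 4).div (hasDerivAt_pow 4 x)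
      (pow_ne_zero 4 hx)).congr_deriv ?_
    simp only [phi', Pi.pow_apply]; field_simp; push_cast; ring
  refine h.congr_of_eventuallyEq ?_
  filter_upwards [isOpen_ne.mem_nhds hx] with y hy using phi_of_ne_zero hy

lemma hasDerivAt_psi {x : ℝ} (hx : x ≠ 0) : HasDerivAt psi (psi' x) x := by
  refine (((Real.hasDerivAt_sin x).pow 4).div (hasDerivAt_pow 3 x)
    (pow_ne_zero 3 hx)).congr_deriv ?_
  simp only [psi', Pi.pow_apply]; field_simp; push_cast; ring

lemma hasDerivAt_phi' {x : ℝ} (hx : x ≠ 0) : HasDerivAt phi' (phi'' x) x := by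
  have hs := Real.hasDerivAt_sin x
  have hc := Real.hasDerivAt_cos x
  refine (((((hs.pow 3).const_mul 4).mul hc).div (hasDerivAt_pow 4 x) (pow_ne_zero 4 hx)).sub
    (((hs.pow 4).const_mul 4).div (hasDerivAt_pow 5 x) (pow_ne_zero 5 hx))).congr_deriv ?_
  simp only [phi'', Pi.pow_apply, Pi.mul_apply]; field_simp; push_cast; ring

lemma hasDerivAt_psi' {x : ℝ} (hx : x ≠ 0) : HasDerivAt psi' (psi'' x) x := by
  have hs := Real.hasDerivAt_sin x
  have hc := Real.hasDerivAt_cos x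
  refine (((((hs.pow 3).const_mul 4).mul hc).div (hasDerivAt_pow 3 x) (pow_ne_zero 3 hx)).sub
    (((hs.pow 4).const_mul 3).div (hasDerivAt_pow 4 x) (pow_ne_zero 4 hx))).congr_deriv ?_
  simp only [psi'', Pi.pow_apply, Pi.mul_apply]; field_simp; push_cast; ring

lemma abs_sin_cube_mul_cos_le (x : ℝ) : |Real.sin x ^ 3 * Real.cos x| ≤ 13 / 40 := by
  refine abs_le_of_sq_le_sq ?_ (by norm_num)
  have h := Real.sin_sq_add_cos_sq x
  set u := Real.sin x ^ 2 with hu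
  have hu0 : 0 ≤ u := sq_nonneg _
  have e : (Real.sin x ^ 3 * Real.cos x) ^ 2 = u ^ 3 * (1 - u) := by
    rw [← h, hu]; ring
  rw [e]
  -- The maximum of `u ^ 3 * (1 - u)` is at `u = 3/4`, hence the double root; the square root of
  -- 27/256 is just below 13/40.
  have : 27 / 256 - u ^ 3 * (1 - u) = (u - 3 / 4) ^ 2 * (u ^ 2 + u / 2 + 3 / 16) := by ring
  nlinarith [mul_nonneg (sq_nonneg (u - 3 / 4)) (by positivity : 0 ≤ u ^ 2 + u / 2 + 3 / 16)]

lemma sin_pow_four_le (x : ℝ) : Real.sin x ^ 4 ≤ 1 := by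
  have h := Real.sin_sq_add_cos_sq x
  nlinarith [sq_nonneg (Real.sin x), sq_nonneg (Real.cos x)]

lemma abs_sin_four_second_le (x : ℝ) :
    |12 * Real.sin x ^ 2 * Real.cos x ^ 2 - 4 * Real.sin x ^ 4| ≤ 4 := by
  have h := Real.sin_sq_add_cos_sq x
  set u := Real.sin x ^ 2 with hu
  have hu0 : 0 ≤ u := sq_nonneg _
  have hv0 : 0 ≤ Real.cos x ^ 2 := sq_nonneg _
  have e : 12 * u * Real.cos x ^ 2 - 4 * Real.sin x ^ 4 = 12 * u - 16 * u ^ 2 := by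
    rw [show Real.cos x ^ 2 = 1 - u by linarith, hu]; ring
  -- On `[0, 1]` the polynomial `12 u - 16 u²` ranges from -4 at `u = 1` to 9/4 at `u = 3/8`.
  rw [e, abs_le]
  constructor <;> nlinarith [sq_nonneg (u - 3 / 8)]

lemma abs_phi_le {x : ℝ} (hx : 0 < |x|) : |phi x| ≤ 1 / |x| ^ 4 := by
  rw [phi_of_ne_zero (abs_pos.1 hx), abs_div, abs_pow x, abs_of_nonneg (by positivity)]
  exact div_le_div_of_nonneg_right (sin_pow_four_le x) (by positivity)

lemma abs_psi_le (x : ℝ) : |psi x| ≤ 1 / |x| ^ 3 := by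
  rw [psi, abs_div, abs_pow x, abs_of_nonneg (by positivity)]
  exact div_le_div_of_nonneg_right (sin_pow_four_le x) (by positivity)

lemma abs_phi'_le {x : ℝ} (hx : 0 < |x|) : |phi' x| ≤ (13 / 10 / |x| + 4 / |x| ^ 2) / |x| ^ 3 := by
  have h1 := abs_sin_cube_mul_cos_le x
  have h2 := sin_pow_four_le x
  calc |phi' x| ≤ |4 * Real.sin x ^ 3 * Real.cos x / x ^ 4| + |4 * Real.sin x ^ 4 / x ^ 5| :=
        abs_sub _ _
    _ = 4 * |Real.sin x ^ 3 * Real.cos x| / |x| ^ 4 + 4 * Real.sin x ^ 4 / |x| ^ 5 := by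
        rw [abs_div, abs_div, mul_assoc, abs_mul, abs_pow x, abs_pow x,
          abs_of_nonneg (by positivity : 0 ≤ 4 * Real.sin x ^ 4)]
        norm_num
    _ ≤ 4 * (13 / 40) / |x| ^ 4 + 4 * 1 / |x| ^ 5 := by gcongr
    _ = _ := by field_simp; ring

lemma abs_psi'_le {x : ℝ} (hx : 0 < |x|) : |psi' x| ≤ (13 / 10 + 3 / |x|) / |x| ^ 3 := by
  have h1 := abs_sin_cube_mul_cos_le x
  have h2 := sin_pow_four_le x
  calc |psi' x| ≤ |4 * Real.sin x ^ 3 * Real.cos x / x ^ 3| + |3 * Real.sin x ^ 4 / x ^ 4| :=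
        abs_sub _ _
    _ = 4 * |Real.sin x ^ 3 * Real.cos x| / |x| ^ 3 + 3 * Real.sin x ^ 4 / |x| ^ 4 := by
        rw [abs_div, abs_div, mul_assoc, abs_mul, abs_pow x, abs_pow x,
          abs_of_nonneg (by positivity : 0 ≤ 3 * Real.sin x ^ 4)]
        norm_num
    _ ≤ 4 * (13 / 40) / |x| ^ 3 + 3 * 1 / |x| ^ 4 := by gcongr
    _ = _ := by field_simp; ring

/-- The threshold 5/2 is below π - π/5, the least distance from a point within π/5 of one node to
any other node. The spare decay is spent on the constant so that `phi''` and `psi''` share the cubic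
weight. -/
lemma abs_phi''_le {x : ℝ} (hx : 5 / 2 ≤ |x|) : |phi'' x| ≤ 4.544 / |x| ^ 3 := by
  have hx0 : 0 < |x| := by linarith
  have h1 := abs_sin_cube_mul_cos_le x
  have h2 := sin_pow_four_le x
  have h3 := abs_sin_four_second_le x
  have hi : 1 / |x| ≤ 2 / 5 := by rw [div_le_div_iff₀ hx0 (by norm_num)]; linarith
  have hi0 : 0 < 1 / |x| := by positivity
  calc |phi'' x| ≤ |12 * Real.sin x ^ 2 * Real.cos x ^ 2 - 4 * Real.sin x ^ 4| / |x| ^ 4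
        + 32 * |Real.sin x ^ 3 * Real.cos x| / |x| ^ 5 + 20 * Real.sin x ^ 4 / |x| ^ 6 := by
        refine (abs_add_le _ _).trans (add_le_add ((abs_sub _ _).trans (add_le_add ?_ ?_)) ?_)
        · rw [abs_div, abs_pow]
        · rw [abs_div, mul_assoc, abs_mul, abs_pow]; norm_num
        · rw [abs_div, abs_of_nonneg (by positivity : 0 ≤ 20 * Real.sin x ^ 4), abs_pow]
    _ ≤ 4 / |x| ^ 4 + 32 * (13 / 40) / |x| ^ 5 + 20 * 1 / |x| ^ 6 := by gcongr
    _ = (4 * (1 / |x|) + 10.4 * (1 / |x|) ^ 2 + 20 * (1 / |x|) ^ 3) / |x| ^ 3 := by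
        field_simp; ring
    _ ≤ (4 * (2 / 5) + 10.4 * (2 / 5) ^ 2 + 20 * (2 / 5) ^ 3) / |x| ^ 3 := by gcongr
    _ = _ := by norm_num

lemma abs_psi''_le {x : ℝ} (hx : 5 / 2 ≤ |x|) : |psi'' x| ≤ 9.04 / |x| ^ 3 := by
  have hx0 : 0 < |x| := by linarith
  have h1 := abs_sin_cube_mul_cos_le x
  have h2 := sin_pow_four_le x
  have h3 := abs_sin_four_second_le x
  have hi : 1 / |x| ≤ 2 / 5 := by rw [div_le_div_iff₀ hx0 (by norm_num)]; linarith
  have hi0 : 0 < 1 / |x| := by positivity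
  calc |psi'' x| ≤ |12 * Real.sin x ^ 2 * Real.cos x ^ 2 - 4 * Real.sin x ^ 4| / |x| ^ 3
        + 24 * |Real.sin x ^ 3 * Real.cos x| / |x| ^ 4 + 12 * Real.sin x ^ 4 / |x| ^ 5 := by
        refine (abs_add_le _ _).trans (add_le_add ((abs_sub _ _).trans (add_le_add ?_ ?_)) ?_)
        · rw [abs_div, abs_pow]
        · rw [abs_div, mul_assoc, abs_mul, abs_pow]; norm_num
        · rw [abs_div, abs_of_nonneg (by positivity : 0 ≤ 12 * Real.sin x ^ 4), abs_pow]
    _ ≤ 4 / |x| ^ 3 + 24 * (13 / 40) / |x| ^ 4 + 12 * 1 / |x| ^ 5 := by gcongr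
    _ = (4 + 7.8 * (1 / |x|) + 12 * (1 / |x|) ^ 2) / |x| ^ 3 := by
        field_simp; ring
    _ ≤ (4 + 7.8 * (2 / 5) + 12 * (2 / 5) ^ 2) / |x| ^ 3 := by gcongr
    _ = _ := by norm_num

/-! ### Polynomial bounds for `sinc` and `phi` -/

lemma cos_le_quartic {x : ℝ} (hx : 0 ≤ x) : Real.cos x ≤ 1 - x ^ 2 / 2 + x ^ 4 / 24 := by
  have hd : ∀ y : ℝ, HasDerivAt (fun y : ℝ => 1 - y ^ 2 / 2 + y ^ 4 / 24 - Real.cos y)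
      (-y + y ^ 3 / 6 + Real.sin y) y := fun y => by
    refine (((((hasDerivAt_pow 2 y).div_const 2).const_sub 1).add
      ((hasDerivAt_pow 4 y).div_const 24)).sub (Real.hasDerivAt_cos y)).congr_deriv ?_
    push_cast; ring
  have hm : MonotoneOn (fun y : ℝ => 1 - y ^ 2 / 2 + y ^ 4 / 24 - Real.cos y) (Set.Ici 0) :=
    monotoneOn_of_deriv_nonneg (convex_Ici 0)
      (fun y _ => (hd y).continuousAt.continuousWithinAt)
      (fun y _ => (hd y).differentiableAt.differentiableWithinAt)
      (fun y hy => by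
        rw [(hd y).deriv]
        rw [interior_Ici] at hy
        linarith [Real.sin_ge_sub_cube (le_of_lt hy)])
  have := hm (Set.mem_Ici.2 le_rfl) hx hx
  simp at this
  linarith

lemma sin_le_quintic {x : ℝ} (hx : 0 ≤ x) : Real.sin x ≤ x - x ^ 3 / 6 + x ^ 5 / 120 := by
  have hd : ∀ y : ℝ, HasDerivAt (fun y : ℝ => y - y ^ 3 / 6 + y ^ 5 / 120 - Real.sin y)
      (1 - y ^ 2 / 2 + y ^ 4 / 24 - Real.cos y) y := fun y => by
    refine ((((hasDerivAt_id y).sub ((hasDerivAt_pow 3 y).div_const 6)).add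
      ((hasDerivAt_pow 5 y).div_const 120)).sub (Real.hasDerivAt_sin y)).congr_deriv ?_
    push_cast; ring
  have hm : MonotoneOn (fun y : ℝ => y - y ^ 3 / 6 + y ^ 5 / 120 - Real.sin y) (Set.Ici 0) :=
    monotoneOn_of_deriv_nonneg (convex_Ici 0)
      (fun y _ => (hd y).continuousAt.continuousWithinAt)
      (fun y _ => (hd y).differentiableAt.differentiableWithinAt)
      (fun y hy => by
        rw [(hd y).deriv]
        rw [interior_Ici] at hy
        linarith [cos_le_quartic (le_of_lt hy)])
  have := hm (Set.mem_Ici.2 le_rfl) hx hx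
  simp at this
  linarith

lemma sinc_abs (x : ℝ) : Real.sinc |x| = Real.sinc x := by
  rcases abs_choice x with h | h <;> rw [h]
  exact Real.sinc_neg x

lemma phi_nonneg (x : ℝ) : 0 ≤ phi x := by unfold phi; positivity

lemma phi_le_one (x : ℝ) : phi x ≤ 1 := by
  have := Real.abs_sinc_le_one x
  rw [phi, ← Even.pow_abs (by decide)]
  exact pow_le_one₀ (abs_nonneg _) this

lemma sinc_le_quartic (x : ℝ) : Real.sinc x ≤ 1 - x ^ 2 / 6 + x ^ 4 / 120 := by
  rw [← sinc_abs, ← sq_abs, ← Even.pow_abs (n := 4) (by decide) x]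
  rcases (abs_nonneg x).eq_or_lt with h | h
  · simp [← h]
  · rw [Real.sinc_of_ne_zero h.ne', div_le_iff₀ h]
    linarith [sin_le_quintic h.le]

lemma one_sub_sq_le_sinc (x : ℝ) : 1 - x ^ 2 / 6 ≤ Real.sinc x := by
  rw [← sinc_abs, ← sq_abs]
  rcases (abs_nonneg x).eq_or_lt with h | h
  · simp [← h]
  · rw [Real.sinc_of_ne_zero h.ne', le_div_iff₀ h]
    linarith [Real.sin_ge_sub_cube h.le]

lemma one_sub_phi_le (x : ℝ) : 1 - phi x ≤ 2 / 3 * x ^ 2 := by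
  have h := one_sub_sq_le_sinc x
  rw [phi]
  nlinarith [sq_nonneg (Real.sinc x ^ 2 - 1), sq_nonneg (Real.sinc x - 1)]

/-- The quadratic drop of the kernel at its own node is what makes the dual certificate decay. The
radius 0.63 exceeds π/5, the radius of the near region. -/
lemma le_one_sub_phi {x : ℝ} (hx : |x| ≤ 0.63) : 0.58 * x ^ 2 ≤ 1 - phi x := by
  have hx2 : x ^ 2 ≤ 0.3969 := by
    rw [← sq_abs]
    calc |x| ^ 2 ≤ 0.63 ^ 2 := by gcongr
      _ = 0.3969 := by norm_num
  have h0 : 0 ≤ Real.sinc x := by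
    have := one_sub_sq_le_sinc x
    linarith
  have h1 := sinc_le_quartic x
  set z := x ^ 2 with hz
  have hz0 : 0 ≤ z := sq_nonneg x
  have h1' : Real.sinc x ≤ 1 - 0.163 * z := by
    have : x ^ 4 = z ^ 2 := by rw [hz]; ring
    rw [this] at h1
    nlinarith
  have h2 : phi x ≤ (1 - 0.163 * z) ^ 4 := by
    rw [phi]; gcongr
  have h3 : (1 - 0.163 * z) ^ 4 ≤ 1 - 4 * (0.163 * z) + 6 * (0.163 * z) ^ 2 := by
    have hy : 0 ≤ 0.163 * z := by positivity
    have hy1 : 0.163 * z ≤ 1 := by linarith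
    nlinarith [pow_nonneg hy 3, mul_nonneg (pow_nonneg hy 3) (sub_nonneg.2 hy1)]
  nlinarith

/-- `sinc` is not monotone on the whole half-line, so two regimes are used: up to 3 it lies below
its quartic Taylor polynomial, which decreases there; beyond 3 the bound 1/3 suffices, and `r ^ 2 ≤
2` keeps the polynomial at `r` above 1/3. -/
lemma phi_le_of_le {r x : ℝ} (hr : 0 ≤ r) (hr2 : r ^ 2 ≤ 2) (hx : r ≤ |x|) :
    phi x ≤ (1 - r ^ 2 / 6 + r ^ 4 / 120) ^ 4 := by
  rw [phi, ← Even.pow_abs (by decide)]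
  refine pow_le_pow_left₀ (abs_nonneg _) ?_ 4
  have hP : 1 / 3 ≤ 1 - r ^ 2 / 6 + r ^ 4 / 120 := by nlinarith [sq_nonneg (r ^ 2)]
  rcases le_total |x| 3 with h3 | h3
  · have hs0 : 0 ≤ Real.sinc |x| := by
      rcases (abs_nonneg x).eq_or_lt with h | h
      · simp [← h]
      · rw [Real.sinc_of_ne_zero h.ne']
        exact div_nonneg (Real.sin_nonneg_of_nonneg_of_le_pi h.le
          (by linarith [Real.pi_gt_three])) h.le
    rw [sinc_abs] at hs0
    rw [abs_of_nonneg hs0]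
    refine (sinc_le_quartic x).trans ?_
    have h1 : r ^ 2 ≤ x ^ 2 := by rw [← sq_abs x]; gcongr
    have h2 : x ^ 2 ≤ 9 := by
      rw [← sq_abs x]; nlinarith [abs_nonneg x]
    nlinarith [mul_nonneg (sub_nonneg.2 h1) (by linarith : 0 ≤ 20 - x ^ 2 - r ^ 2)]
  · have : |Real.sinc x| ≤ 1 / 3 := by
      rw [Real.sinc_of_ne_zero (by rintro rfl; norm_num at h3), abs_div]
      exact div_le_div₀ zero_le_one (Real.abs_sin_le_one x) (by norm_num) h3
    linarith

/-! ### Sums over separated points -/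

/-- An upper bound for `∑ 1 / (e + k π) ^ 3`. -/
def cubeBound (e : ℝ) : ℝ := 1 / e ^ 3 + 1 / (2 * Real.pi * (e + Real.pi / 2) ^ 2)

/-- Midpoint rule: by convexity each term after the first is at most the mean of `1 / x ^ 3` over an
interval of length π centred at its point. These integrals telescope, and the subtracted term is the
unused tail. -/
lemma sum_range_inv_cube_le {e : ℝ} (he : 0 < e) (n : ℕ) :
    ∑ k ∈ Finset.range (n + 1), 1 / (e + k * Real.pi) ^ 3 ≤
      cubeBound e - 1 / (2 * Real.pi * (e + n * Real.pi + Real.pi / 2) ^ 2) := by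
  have hpi := Real.pi_pos
  induction n with
  | zero => simp [cubeBound]
  | succ n ih =>
    rw [Finset.sum_range_succ]
    have hy : Real.pi < e + ((n + 1 : ℕ) : ℝ) * Real.pi := by
      have : (0 : ℝ) ≤ n * Real.pi := by positivity
      push_cast; linarith
    have e1 : e + (n : ℝ) * Real.pi + Real.pi / 2
        = (e + ((n + 1 : ℕ) : ℝ) * Real.pi) - Real.pi / 2 := by push_cast; ring
    rw [e1] at ih
    set y := e + ((n + 1 : ℕ) : ℝ) * Real.pi
    have hy0 : 0 < y := hpi.trans hy
    have hm : 0 < y - Real.pi / 2 := by linarith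
    have hp : 0 < y + Real.pi / 2 := by linarith
    have key : 1 / y ^ 3 ≤ 1 / (2 * Real.pi * (y - Real.pi / 2) ^ 2)
        - 1 / (2 * Real.pi * (y + Real.pi / 2) ^ 2) := by
      have e2 : 1 / (2 * Real.pi * (y - Real.pi / 2) ^ 2)
        - 1 / (2 * Real.pi * (y + Real.pi / 2) ^ 2)
          = y / ((y - Real.pi / 2) * (y + Real.pi / 2)) ^ 2 := by
        rw [div_sub_div _ _ (by positivity) (by positivity),
          div_eq_div_iff (by positivity) (by positivity)]
        ring
      rw [e2, div_le_div_iff₀ (by positivity) (by positivity)]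
      have h3 : (y - Real.pi / 2) * (y + Real.pi / 2) ≤ y ^ 2 := by
        nlinarith [sq_nonneg Real.pi]
      have h4 : ((y - Real.pi / 2) * (y + Real.pi / 2)) ^ 2 ≤ (y ^ 2) ^ 2 :=
        pow_le_pow_left₀ (by positivity) h3 2
      calc 1 * ((y - Real.pi / 2) * (y + Real.pi / 2)) ^ 2 ≤ (y ^ 2) ^ 2 := by linarith
        _ = y * y ^ 3 := by ring
    linarith

/-- Each cell of length π starting at `e` contains at most one of the separated points, and moving a
point to the left end of its cell only increases its term. -/
lemma sum_inv_cube_le {ι : Type*} (s : Finset ι) (f : ι → ℝ) {e : ℝ} (he : 0 < e)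
    (hf : ∀ i ∈ s, e ≤ f i) (hsep : ∀ i ∈ s, ∀ j ∈ s, i ≠ j → Real.pi ≤ |f i - f j|) :
    ∑ i ∈ s, 1 / f i ^ 3 ≤ cubeBound e := by
  classical
  have hpi := Real.pi_pos
  set k : ι → ℕ := fun i => ⌊(f i - e) / Real.pi⌋₊ with hk
  have hk1 : ∀ i ∈ s, e + k i * Real.pi ≤ f i := fun i hi => by
    have := Nat.floor_le (div_nonneg (sub_nonneg.2 (hf i hi)) hpi.le)
    rw [le_div_iff₀ hpi] at this
    simp only [hk]; linarith
  have hk2 : ∀ i ∈ s, f i < e + k i * Real.pi + Real.pi := fun i hi => by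
    have := Nat.lt_floor_add_one ((f i - e) / Real.pi)
    rw [div_lt_iff₀ hpi] at this
    simp only [hk]; linarith
  have hinj : Set.InjOn k s := by
    intro i hi j hj hij
    by_contra hne
    have h1 := hsep i hi j hj hne
    have h2 := hk1 i hi
    have h3 := hk2 i hi
    have h4 := hk1 j hj
    have h5 := hk2 j hj
    rw [hij] at h2 h3
    have : |f i - f j| < Real.pi := abs_lt.2 ⟨by linarith, by linarith⟩
    linarith
  calc ∑ i ∈ s, 1 / f i ^ 3 ≤ ∑ i ∈ s, 1 / (e + k i * Real.pi) ^ 3 := by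
        refine Finset.sum_le_sum fun i hi => ?_
        have : 0 < e + k i * Real.pi := by positivity
        exact one_div_le_one_div_of_le (by positivity) (pow_le_pow_left₀ this.le (hk1 i hi) 3)
    _ = ∑ n ∈ s.image k, 1 / (e + n * Real.pi) ^ 3 := by
        rw [Finset.sum_image hinj]
    _ ≤ ∑ n ∈ Finset.range ((s.image k).sup id + 1), 1 / (e + n * Real.pi) ^ 3 := by
        refine Finset.sum_le_sum_of_subset_of_nonneg (fun n hn => ?_) fun n _ _ => by positivity
        exact Finset.mem_range_succ_iff.2 (Finset.le_sup (f := id) hn)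
    _ ≤ cubeBound e := by
        refine (sum_range_inv_cube_le he _).trans (sub_le_self _ (by positivity))

/-! ### Interpolation on a separated family of nodes -/

lemma cubeBound_pi_mul (t : ℝ) :
    cubeBound (t * Real.pi) = 1 / Real.pi ^ 3 * (1 / t ^ 3 + 1 / (2 * (t + 1 / 2) ^ 2)) := by
  have hpi := Real.pi_pos.ne'
  have e : 2 * Real.pi * (t * Real.pi + Real.pi / 2) ^ 2
      = Real.pi ^ 3 * (2 * (t + 1 / 2) ^ 2) := by ring
  rw [cubeBound, e, mul_pow, mul_add, div_mul_div_comm, div_mul_div_comm, mul_comm (t ^ 3)]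
  simp

lemma cubeBound_nonneg {e : ℝ} (he : 0 < e) : 0 ≤ cubeBound e := by
  have := Real.pi_pos
  unfold cubeBound; positivity

lemma one_div_pi_cube_le : 1 / Real.pi ^ 3 ≤ 0.03231 := by
  have h : (3.14 : ℝ) ^ 3 ≤ Real.pi ^ 3 := pow_le_pow_left₀ (by norm_num) Real.pi_gt_d2.le 3
  calc 1 / Real.pi ^ 3 ≤ 1 / (3.14 : ℝ) ^ 3 := one_div_le_one_div_of_le (by norm_num) h
    _ ≤ _ := by norm_num

lemma cubeBound_pi_mul_le {t B : ℝ} (ht : 0 < t)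
    (h : 0.03231 * (1 / t ^ 3 + 1 / (2 * (t + 1 / 2) ^ 2)) ≤ B) :
    cubeBound (t * Real.pi) ≤ B := by
  rw [cubeBound_pi_mul]
  exact (mul_le_mul_of_nonneg_right one_div_pi_cube_le (by positivity)).trans h

lemma summable_and_norm_tsum_le {ι : Type*} {g : ι → ℂ} {w : ι → ℝ} {C B : ℝ}
    (hg : ∀ i, ‖g i‖ ≤ C * w i) (hC : 0 ≤ C) (hw : ∀ i, 0 ≤ w i)
    (hB : ∀ s : Finset ι, ∑ i ∈ s, w i ≤ B) :
    Summable g ∧ ‖∑' i, g i‖ ≤ C * B := by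
  have h1 : Summable w := summable_of_sum_le hw hB
  have h2 : ∑' i, w i ≤ B := Real.tsum_le_of_sum_le hw hB
  refine ⟨Summable.of_norm_bounded (h1.mul_left C) hg, ?_⟩
  refine (tsum_of_norm_bounded (h1.mul_left C).hasSum hg).trans ?_
  rw [tsum_mul_left]
  gcongr

/-- A `π`-separated family of nodes on the line, partitioned into finitely many classes with a
distinguished representative in each class. -/
structure NodeFamily (T ι : Type*) where
  /-- the position of a node -/
  pos : ι → ℝ
  /-- the class of a node -/
  cls : ι → T
  /-- the distinguished node of a class -/
  rep : T → ι
  cls_rep : ∀ j, cls (rep j) = j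
  sep : ∀ i j, i ≠ j → Real.pi ≤ |pos i - pos j|

namespace NodeFamily

variable {T ι : Type*} (N : NodeFamily T ι)

open Classical in
/-- Inverse cubes of the distances (reduced by `a`) to the other nodes. -/
def weight (a : ℝ) (i₀ i : ι) : ℝ :=
  if i = i₀ then 0 else 1 / (|N.pos i - N.pos i₀| - a) ^ 3

lemma weight_nonneg {a : ℝ} (ha : a < Real.pi) (i₀ i : ι) : 0 ≤ N.weight a i₀ i := by
  unfold weight
  split_ifs with h
  · exact le_rfl
  · have := N.sep i i₀ h
    have : 0 < |N.pos i - N.pos i₀| - a := by linarith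
    positivity

/-- The factor two counts the two sides of the node; on each side the reduced distances are still
π-separated and start at π - a. -/
lemma sum_weight_le {a : ℝ} (ha : a < Real.pi) (i₀ : ι) (s : Finset ι) :
    ∑ i ∈ s, N.weight a i₀ i ≤ 2 * cubeBound (Real.pi - a) := by
  classical
  have hpos : 0 < Real.pi - a := by linarith
  have h1 : ∑ i ∈ s, N.weight a i₀ i
      = ∑ i ∈ s.filter (· ≠ i₀), 1 / (|N.pos i - N.pos i₀| - a) ^ 3 := by
    rw [Finset.sum_filter]
    refine Finset.sum_congr rfl fun i _ => ?_
    unfold weight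
    split_ifs <;> simp_all
  rw [h1, ← Finset.sum_filter_add_sum_filter_not _ (fun i => N.pos i₀ ≤ N.pos i), two_mul]
  refine add_le_add (sum_inv_cube_le _ _ hpos ?_ ?_) (sum_inv_cube_le _ _ hpos ?_ ?_)
  · intro i hi
    have := N.sep i i₀ (by simp at hi; exact hi.1.2)
    linarith
  · intro i hi j hj hij
    have h1 : N.pos i₀ ≤ N.pos i := by simp at hi; exact hi.2
    have h2 : N.pos i₀ ≤ N.pos j := by simp at hj; exact hj.2
    rw [abs_of_nonneg (sub_nonneg.2 h1), abs_of_nonneg (sub_nonneg.2 h2)]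
    refine (N.sep i j hij).trans_eq ?_
    congr 1; ring
  · intro i hi
    have := N.sep i i₀ (by simp at hi; exact hi.1.2)
    linarith
  · intro i hi j hj hij
    have h1 : N.pos i < N.pos i₀ := by simp at hi; exact hi.2
    have h2 : N.pos j < N.pos i₀ := by simp at hj; exact hj.2
    rw [abs_of_neg (sub_neg.2 h1), abs_of_neg (sub_neg.2 h2)]
    refine (N.sep i j hij).trans_eq ?_
    rw [← abs_neg]
    congr 1; ring

lemma sum_weight_zero_le (i₀ : ι) (s : Finset ι) : ∑ i ∈ s, N.weight 0 i₀ i ≤ 0.079 := by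
  refine (N.sum_weight_le Real.pi_pos i₀ s).trans ?_
  have := cubeBound_pi_mul_le (t := 1) (B := 0.0395) one_pos (by norm_num)
  rw [one_mul] at this
  rw [sub_zero]; linarith

lemma sum_weight_fifth_le (i₀ : ι) (s : Finset ι) :
    ∑ i ∈ s, N.weight (Real.pi / 5) i₀ i ≤ 0.1454 := by
  refine (N.sum_weight_le (by linarith [Real.pi_pos]) i₀ s).trans ?_
  have := cubeBound_pi_mul_le (t := 4 / 5) (B := 0.0727) (by norm_num) (by norm_num)
  rw [show Real.pi - Real.pi / 5 = 4 / 5 * Real.pi by ring]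
  linarith

/-- Inverse powers of the distances from a point `x` with nearest node `i₀` to the other nodes. -/
lemma sum_far_le {A B x e e' : ℝ} (hA : 0 ≤ A) (hB : 0 ≤ B) (i₀ : ι)
    (hmin : ∀ i, |x - N.pos i₀| ≤ |x - N.pos i|) (he : 0 < e) (he' : 0 < e')
    (h1 : e ≤ max |x - N.pos i₀| (Real.pi - |x - N.pos i₀|))
    (h2 : e' ≤ |x - N.pos i₀| + Real.pi) (s : Finset ι) (hs : i₀ ∉ s) :
    ∑ i ∈ s, (A / |x - N.pos i| ^ 4 + B / |x - N.pos i| ^ 3) ≤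
      (A / e + B) * cubeBound e + (A / e' + B) * cubeBound e' := by
  classical
  have hpi := Real.pi_pos
  -- Reflecting if necessary, the nearest node is placed on the nonnegative side of `x`.
  obtain ⟨σ, hσ, hd⟩ : ∃ σ : ℝ, (σ = 1 ∨ σ = -1) ∧ |x - N.pos i₀| = σ * (N.pos i₀ - x) := by
    rcases le_total x (N.pos i₀) with h | h
    · exact ⟨1, Or.inl rfl, by rw [abs_of_nonpos (by linarith)]; ring⟩
    · exact ⟨-1, Or.inr rfl, by rw [abs_of_nonneg (by linarith)]; ring⟩
  set d := |x - N.pos i₀| with hdd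
  have hd0 : 0 ≤ d := abs_nonneg _
  have habs : ∀ i, |x - N.pos i| = |σ * (N.pos i - x)| := fun i => by
    rcases hσ with rfl | rfl
    · rw [one_mul, abs_sub_comm]
    · congr 1; ring
  have hsep : ∀ i j, i ≠ j → Real.pi ≤ |σ * (N.pos i - x) - σ * (N.pos j - x)| := by
    intro i j hij
    refine (N.sep i j hij).trans_eq ?_
    rcases hσ with rfl | rfl
    · congr 1; ring
    · rw [← abs_neg]; congr 1; ring
  have hne : ∀ i ∈ s, i ≠ i₀ := fun i hi h => hs (h ▸ hi)
  have termle : ∀ (f c : ℝ), 0 < c → c ≤ f →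
      A / f ^ 4 + B / f ^ 3 ≤ (A / c + B) * (1 / f ^ 3) := fun f c hc hcf => by
    have hf : 0 < f := hc.trans_le hcf
    have : A / f ^ 4 = A / f * (1 / f ^ 3) := by field_simp
    rw [this, add_mul, ← div_eq_mul_one_div B]
    gcongr
  rw [← Finset.sum_filter_add_sum_filter_not s (fun i => σ * (N.pos i - x) < 0)]
  refine add_le_add ?_ ?_
  · have hlow : ∀ i ∈ s.filter (fun i => σ * (N.pos i - x) < 0), e ≤ -(σ * (N.pos i - x)) := by
      intro i hi
      rw [Finset.mem_filter] at hi
      have a1 := hmin i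
      rw [habs i, abs_of_neg hi.2] at a1
      have a2 := hsep i i₀ (hne i hi.1)
      rw [← hd, abs_of_nonpos (by linarith [hi.2])] at a2
      -- A node across `x` from `i₀` is at distance at least `d` because `i₀` is nearest, and at
      -- least `π - d` because it is separated from `i₀`.
      rcases le_max_iff.1 h1 with h | h <;> linarith
    calc _ ≤ ∑ i ∈ s.filter (fun i => σ * (N.pos i - x) < 0),
          (A / e + B) * (1 / (-(σ * (N.pos i - x))) ^ 3) := by
          refine Finset.sum_le_sum fun i hi => ?_
          have hi' := (Finset.mem_filter.1 hi).2
          rw [habs i, abs_of_neg hi']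
          exact termle _ _ he (hlow i hi)
      _ ≤ _ := by
          rw [← Finset.mul_sum]
          refine mul_le_mul_of_nonneg_left (sum_inv_cube_le _ _ he hlow ?_) (by positivity)
          intro i hi j hj hij
          refine (hsep i j hij).trans_eq ?_
          rw [← abs_neg]; congr 1; ring
  · have hlow : ∀ i ∈ s.filter (fun i => ¬ σ * (N.pos i - x) < 0), e' ≤ σ * (N.pos i - x) := by
      intro i hi
      rw [Finset.mem_filter, not_lt] at hi
      have a1 := hmin i
      rw [habs i, abs_of_nonneg hi.2] at a1
      have a2 := hsep i i₀ (hne i hi.1)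
      rw [← hd, abs_of_nonneg (by linarith [hi.2])] at a2
      linarith
    calc _ ≤ ∑ i ∈ s.filter (fun i => ¬ σ * (N.pos i - x) < 0),
          (A / e' + B) * (1 / (σ * (N.pos i - x)) ^ 3) := by
          refine Finset.sum_le_sum fun i hi => ?_
          have hi' := hlow i hi
          rw [habs i, abs_of_nonneg (by linarith)]
          exact termle _ _ he' hi'
      _ ≤ _ := by
          rw [← Finset.mul_sum]
          exact mul_le_mul_of_nonneg_left (sum_inv_cube_le _ _ he' hlow
            fun i _ j _ hij => hsep i j hij) (by positivity)

variable (α β : T → ℂ)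

/-- The contribution of the node `i` to the interpolant with coefficients `α`, `β`. -/
def atom (i : ι) (x : ℝ) : ℂ :=
  α (N.cls i) * phi (x - N.pos i) + β (N.cls i) * psi (x - N.pos i)

/-- The derivative of `atom` away from the node. -/
def datom (i : ι) (x : ℝ) : ℂ :=
  α (N.cls i) * phi' (x - N.pos i) + β (N.cls i) * psi' (x - N.pos i)

open Classical in
/-- The value at the node `i₀` of the contributions of the other nodes. -/
def offValue (i₀ : ι) : ℂ := ∑' i, if i = i₀ then 0 else N.atom α β i (N.pos i₀)

open Classical in
/-- The derivative at the node `i₀` of the contributions of the other nodes. -/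
def offDeriv (i₀ : ι) : ℂ := ∑' i, if i = i₀ then 0 else N.datom α β i (N.pos i₀)

/-- The function with coefficients `α`, `β`. -/
def interp (x : ℝ) : ℂ := ∑' i, N.atom α β i x

variable {α β} [Fintype T]

lemma norm_comb_le {A B : ℝ} (j : T) (hA : ‖α‖ ≤ A) (hB : ‖β‖ ≤ B) (p q : ℝ) :
    ‖α j * (p : ℂ) + β j * (q : ℂ)‖ ≤ A * |p| + B * |q| := by
  refine (norm_add_le _ _).trans ?_
  rw [norm_mul, norm_mul, Complex.norm_real, Complex.norm_real, Real.norm_eq_abs, Real.norm_eq_abs]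
  have h1 := (norm_le_pi_norm α j).trans hA
  have h2 := (norm_le_pi_norm β j).trans hB
  gcongr

variable (α β)

-- The system is close to the identity because `phi` and `psi` have values 1, 0 and derivatives 0, 1
-- at the origin, while all other nodes together contribute only this much. Here 0.3185 bounds
-- 1/3.14, as one power of the distance is given up.
open Classical in
lemma offValue_bound (i₀ : ι) :
    Summable (fun i => if i = i₀ then 0 else N.atom α β i (N.pos i₀)) ∧
      ‖N.offValue α β i₀‖ ≤ (0.3185 * ‖α‖ + ‖β‖) * 0.079 := by
  refine summable_and_norm_tsum_le (w := N.weight 0 i₀) (fun i => ?_) (by positivity)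
    (N.weight_nonneg Real.pi_pos i₀) (N.sum_weight_zero_le i₀)
  unfold weight
  split_ifs with h
  · simp
  have hd := N.sep i i₀ h
  have hd' : 3.14 ≤ |N.pos i₀ - N.pos i| := by
    rw [abs_sub_comm]; linarith [Real.pi_gt_d2]
  rw [sub_zero, abs_sub_comm]
  set x := N.pos i₀ - N.pos i
  have hx : 0 < |x| := by linarith
  refine (norm_comb_le _ le_rfl le_rfl _ _).trans ?_
  have h1 : |phi x| ≤ 0.3185 * (1 / |x| ^ 3) := by
    refine (abs_phi_le hx).trans ?_
    rw [show 1 / |x| ^ 4 = 1 / |x| * (1 / |x| ^ 3) by field_simp]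
    refine mul_le_mul_of_nonneg_right ?_ (by positivity)
    rw [div_le_iff₀ hx]; linarith
  have h2 := abs_psi_le x
  calc ‖α‖ * |phi x| + ‖β‖ * |psi x| ≤ ‖α‖ * (0.3185 * (1 / |x| ^ 3)) + ‖β‖ * (1 / |x| ^ 3) := by
        gcongr
    _ = _ := by ring

open Classical in
lemma offDeriv_bound (i₀ : ι) :
    Summable (fun i => if i = i₀ then 0 else N.datom α β i (N.pos i₀)) ∧
      ‖N.offDeriv α β i₀‖ ≤ (0.82 * ‖α‖ + 2.2555 * ‖β‖) * 0.079 := by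
  refine summable_and_norm_tsum_le (w := N.weight 0 i₀) (fun i => ?_) (by positivity)
    (N.weight_nonneg Real.pi_pos i₀) (N.sum_weight_zero_le i₀)
  unfold weight
  split_ifs with h
  · simp
  have hd := N.sep i i₀ h
  have hd' : 3.14 ≤ |N.pos i₀ - N.pos i| := by
    rw [abs_sub_comm]; linarith [Real.pi_gt_d2]
  rw [sub_zero, abs_sub_comm]
  set x := N.pos i₀ - N.pos i
  have hx : 0 < |x| := by linarith
  refine (norm_comb_le _ le_rfl le_rfl _ _).trans ?_
  have hi : 1 / |x| ≤ 1 / 3.14 := one_div_le_one_div_of_le (by norm_num) hd'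
  have h1 : |phi' x| ≤ 0.82 * (1 / |x| ^ 3) := by
    refine (abs_phi'_le hx).trans ?_
    rw [div_eq_mul_one_div]
    refine mul_le_mul_of_nonneg_right ?_ (by positivity)
    calc 13 / 10 / |x| + 4 / |x| ^ 2 = 13 / 10 * (1 / |x|) + 4 * (1 / |x|) ^ 2 := by
          field_simp
      _ ≤ 13 / 10 * (1 / 3.14) + 4 * (1 / 3.14) ^ 2 := by gcongr
      _ ≤ 0.82 := by norm_num
  have h2 : |psi' x| ≤ 2.2555 * (1 / |x| ^ 3) := by
    refine (abs_psi'_le hx).trans ?_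
    rw [div_eq_mul_one_div]
    refine mul_le_mul_of_nonneg_right ?_ (by positivity)
    calc 13 / 10 + 3 / |x| = 13 / 10 + 3 * (1 / |x|) := by field_simp
      _ ≤ 13 / 10 + 3 * (1 / 3.14) := by gcongr
      _ ≤ 2.2555 := by norm_num
  calc ‖α‖ * |phi' x| + ‖β‖ * |psi' x|
      ≤ ‖α‖ * (0.82 * (1 / |x| ^ 3)) + ‖β‖ * (2.2555 * (1 / |x| ^ 3)) := by
        gcongr
    _ = _ := by ring

/-- The linear map from the coefficients to the Hermite data at the distinguished nodes. -/
def hermiteMap : (T → ℂ) × (T → ℂ) →ₗ[ℂ] (T → ℂ) × (T → ℂ) where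
  toFun p := (fun j => p.1 j + N.offValue p.1 p.2 (N.rep j),
    fun j => p.2 j + N.offDeriv p.1 p.2 (N.rep j))
  map_add' p q := by
    classical
    refine Prod.ext (funext fun j => ?_) (funext fun j => ?_)
    · have e : N.offValue (p + q).1 (p + q).2 (N.rep j)
          = N.offValue p.1 p.2 (N.rep j) + N.offValue q.1 q.2 (N.rep j) := by
        rw [offValue, offValue, offValue,
          ← (N.offValue_bound p.1 p.2 _).1.tsum_add (N.offValue_bound q.1 q.2 _).1]
        refine tsum_congr fun i => ?_
        split_ifs
        · simp
        · simp only [atom, Prod.fst_add, Prod.snd_add, Pi.add_apply]; ring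
      refine (congrArg ((p + q).1 j + ·) e).trans ?_
      simp only [Prod.fst_add, Pi.add_apply]; ring
    · have e : N.offDeriv (p + q).1 (p + q).2 (N.rep j)
          = N.offDeriv p.1 p.2 (N.rep j) + N.offDeriv q.1 q.2 (N.rep j) := by
        rw [offDeriv, offDeriv, offDeriv,
          ← (N.offDeriv_bound p.1 p.2 _).1.tsum_add (N.offDeriv_bound q.1 q.2 _).1]
        refine tsum_congr fun i => ?_
        split_ifs
        · simp
        · simp only [datom, Prod.fst_add, Prod.snd_add, Pi.add_apply]; ring
      refine (congrArg ((p + q).2 j + ·) e).trans ?_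
      simp only [Prod.snd_add, Pi.add_apply]; ring
  map_smul' z p := by
    classical
    refine Prod.ext (funext fun j => ?_) (funext fun j => ?_)
    · have e : N.offValue (z • p).1 (z • p).2 (N.rep j) = z * N.offValue p.1 p.2 (N.rep j) := by
        rw [offValue, offValue, ← tsum_mul_left]
        refine tsum_congr fun i => ?_
        split_ifs
        · simp
        · simp only [atom, Prod.smul_fst, Prod.smul_snd, Pi.smul_apply, smul_eq_mul]; ring
      refine (congrArg ((z • p).1 j + ·) e).trans ?_
      simp only [Prod.smul_fst, Pi.smul_apply, smul_eq_mul, RingHom.id_apply]; ring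
    · have e : N.offDeriv (z • p).1 (z • p).2 (N.rep j) = z * N.offDeriv p.1 p.2 (N.rep j) := by
        rw [offDeriv, offDeriv, ← tsum_mul_left]
        refine tsum_congr fun i => ?_
        split_ifs
        · simp
        · simp only [datom, Prod.smul_fst, Prod.smul_snd, Pi.smul_apply, smul_eq_mul]; ring
      refine (congrArg ((z • p).2 j + ·) e).trans ?_
      simp only [Prod.smul_snd, Pi.smul_apply, smul_eq_mul, RingHom.id_apply]; ring

variable {α β}

/-- The coefficients `α`, `β` solve the Hermite interpolation problem with the values `v` and the
derivatives `w`. -/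
def Solves (α β v w : T → ℂ) : Prop :=
  (∀ j, α j + N.offValue α β (N.rep j) = v j) ∧ ∀ j, β j + N.offDeriv α β (N.rep j) = w j

lemma Solves.sub_le {v w : T → ℂ} (h : N.Solves α β v w) :
    ‖α - v‖ ≤ (0.3185 * ‖α‖ + ‖β‖) * 0.079 := by
  refine (pi_norm_le_iff_of_nonneg (by positivity)).2 fun j => ?_
  rw [Pi.sub_apply, ← h.1 j, sub_add_cancel_left, norm_neg]
  exact (N.offValue_bound α β _).2

/-- The bounds are circular on purpose: the coefficients on the right are small enough to solve for
the two norms. This yields both injectivity of the system and the later numerical bounds. -/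
lemma Solves.norm_le {v w : T → ℂ} (h : N.Solves α β v w) :
    ‖α‖ ≤ ‖v‖ + (0.3185 * ‖α‖ + ‖β‖) * 0.079 ∧
      ‖β‖ ≤ ‖w‖ + (0.82 * ‖α‖ + 2.2555 * ‖β‖) * 0.079 := by
  constructor
  · have h1 := h.sub_le
    have h2 := norm_add_le v (α - v)
    rw [add_sub_cancel] at h2
    linarith
  · have h1 : ‖β - w‖ ≤ (0.82 * ‖α‖ + 2.2555 * ‖β‖) * 0.079 := by
      refine (pi_norm_le_iff_of_nonneg (by positivity)).2 fun j => ?_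
      rw [Pi.sub_apply, ← h.2 j, sub_add_cancel_left, norm_neg]
      exact (N.offDeriv_bound α β _).2
    have h2 := norm_add_le w (β - w)
    rw [add_sub_cancel] at h2
    linarith

/-- The a priori bounds with zero data force zero coefficients, and an injective endomorphism of a
finite-dimensional space is onto. Finite dimension comes from letting coefficients depend only on
the class of a node. -/
lemma exists_solves (v w : T → ℂ) : ∃ α β, N.Solves α β v w := by
  have hinj : Function.Injective N.hermiteMap := by
    rw [← LinearMap.ker_eq_bot, LinearMap.ker_eq_bot']
    rintro ⟨a, b⟩ hab
    have hs : N.Solves a b 0 0 :=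
      ⟨fun j => congrFun (congrArg Prod.fst hab) j, fun j => congrFun (congrArg Prod.snd hab) j⟩
    obtain ⟨h1, h2⟩ := hs.norm_le
    simp only [norm_zero, zero_add] at h1 h2
    have h3 := norm_nonneg a
    have h4 := norm_nonneg b
    have ha : ‖a‖ = 0 := by linarith
    have hb : ‖b‖ = 0 := by linarith
    rw [norm_eq_zero.1 ha, norm_eq_zero.1 hb]
    rfl
  obtain ⟨⟨a, b⟩, hab⟩ := LinearMap.injective_iff_surjective.1 hinj (v, w)
  exact ⟨a, b, fun j => congrFun (congrArg Prod.fst hab) j,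
    fun j => congrFun (congrArg Prod.snd hab) j⟩

-- Near a node the contributions of the others are smooth, since their kernels are evaluated at
-- distance at least 5/2. Their second-order Taylor remainders are summed with the weight reduced by
-- π/5, the largest displacement allowed.
open Classical in
lemma offValue_taylor (i₀ : ι) {x : ℝ} (hx : |x| ≤ Real.pi / 5) :
    Summable (fun i => if i = i₀ then 0 else N.atom α β i (N.pos i₀ + x)) ∧
    ‖(∑' i, if i = i₀ then 0 else N.atom α β i (N.pos i₀ + x)) - N.offValue α β i₀
      - x * N.offDeriv α β i₀‖ ≤ (4.544 * ‖α‖ + 9.04 * ‖β‖) * x ^ 2 / 2 * 0.1454 := by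
  have hpi := Real.pi_gt_d2
  set g : ι → ℂ := fun i => if i = i₀ then 0 else
    N.atom α β i (N.pos i₀ + x) - N.atom α β i (N.pos i₀) - x * N.datom α β i (N.pos i₀) with hg
  have key := summable_and_norm_tsum_le (g := g) (w := N.weight (Real.pi / 5) i₀)
    (C := (4.544 * ‖α‖ + 9.04 * ‖β‖) * x ^ 2 / 2) (B := 0.1454) (fun i => ?_) (by positivity)
    (N.weight_nonneg (by linarith) i₀) (N.sum_weight_fifth_le i₀)
  · obtain ⟨s1, -⟩ := N.offValue_bound α β i₀
    obtain ⟨s2, -⟩ := N.offDeriv_bound α β i₀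
    have e : (fun i => if i = i₀ then 0 else N.atom α β i (N.pos i₀ + x)) = fun i =>
        g i + (if i = i₀ then 0 else N.atom α β i (N.pos i₀))
          + x * (if i = i₀ then 0 else N.datom α β i (N.pos i₀)) := by
      funext i
      simp only [hg]
      split_ifs <;> ring
    have s3 := (key.1.add s1).add (s2.mul_left (x : ℂ))
    refine ⟨e ▸ s3, ?_⟩
    rw [e, (key.1.add s1).tsum_add (s2.mul_left (x : ℂ)), key.1.tsum_add s1, tsum_mul_left]
    convert key.2 using 2
    simp only [offValue, offDeriv]
    ring
  · simp only [hg]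
    unfold weight
    split_ifs with h
    · simp
    have hd := N.sep i i₀ h
    rw [abs_sub_comm] at hd ⊢
    set y := N.pos i₀ - N.pos i with hy
    have hfar : ∀ z, |z - y| ≤ |x| → |y| - Real.pi / 5 ≤ |z| := fun z hz => by
      have := abs_sub_abs_le_abs_sub y z
      rw [abs_sub_comm z y] at hz
      linarith
    have hm : 0 < |y| - Real.pi / 5 := by linarith
    have hz52 : ∀ z, |z - y| ≤ |x| → 5 / 2 ≤ |z| := fun z hz => by
      have := hfar z hz
      linarith
    have hz0 : ∀ z, |z - y| ≤ |x| → z ≠ 0 := fun z hz => by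
      have := hz52 z hz
      rintro rfl
      norm_num at this
    have hcube : ∀ z C, 0 ≤ C → |z - y| ≤ |x| → C / |z| ^ 3 ≤ C / (|y| - Real.pi / 5) ^ 3 :=
      fun z C hC hz => div_le_div_of_nonneg_left hC (by positivity)
        (pow_le_pow_left₀ hm.le (hfar z hz) 3)
    have t1 := norm_taylor_one_le (f := phi) (f' := phi') (f'' := phi'') (x₀ := y) (h := x)
      (fun z hz => hasDerivAt_phi (hz0 z hz)) (fun z hz => hasDerivAt_phi' (hz0 z hz))
      (fun z hz => (abs_phi''_le (hz52 z hz)).trans (hcube z _ (by norm_num) hz))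
    have t2 := norm_taylor_one_le (f := psi) (f' := psi') (f'' := psi'') (x₀ := y) (h := x)
      (fun z hz => hasDerivAt_psi (hz0 z hz)) (fun z hz => hasDerivAt_psi' (hz0 z hz))
      (fun z hz => (abs_psi''_le (hz52 z hz)).trans (hcube z _ (by norm_num) hz))
    have e : N.atom α β i (N.pos i₀ + x) - N.atom α β i (N.pos i₀)
        - x * N.datom α β i (N.pos i₀)
        = α (N.cls i) * ((phi (y + x) - phi y - x • phi' y : ℝ) : ℂ)
          + β (N.cls i) * ((psi (y + x) - psi y - x • psi' y : ℝ) : ℂ) := by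
      simp only [atom, datom, ← hy, show N.pos i₀ + x - N.pos i = y + x by rw [hy]; ring,
        smul_eq_mul]
      push_cast; ring
    rw [e]
    refine (norm_comb_le _ le_rfl le_rfl _ _).trans ?_
    rw [Real.norm_eq_abs] at t1 t2
    calc _ ≤ ‖α‖ * (4.544 / (|y| - Real.pi / 5) ^ 3 * x ^ 2 / 2)
          + ‖β‖ * (9.04 / (|y| - Real.pi / 5) ^ 3 * x ^ 2 / 2) := by gcongr
      _ = _ := by ring

/-- Taylor expansion of the interpolant at a distinguished node. -/
lemma Solves.taylor {v w : T → ℂ} (h : N.Solves α β v w) (j : T) {x : ℝ}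
    (hx : |x| ≤ Real.pi / 5) :
    ∃ R : ℂ, ‖R‖ ≤ (4.544 * ‖α‖ + 9.04 * ‖β‖) * x ^ 2 / 2 * 0.1454 ∧
      N.interp α β (N.pos (N.rep j) + x) =
        v j + w j * x + α j * (phi x - 1) + β j * (psi x - x) + R := by
  classical
  obtain ⟨s, hR⟩ := N.offValue_taylor (α := α) (β := β) (N.rep j) hx
  refine ⟨_, hR, ?_⟩
  have hsum : Summable (fun i => N.atom α β i (N.pos (N.rep j) + x)) := by
    refine (s.add (summable_of_ne_finset_zero (s := {N.rep j})
      (f := fun i => if i = N.rep j then N.atom α β i (N.pos (N.rep j) + x) else 0)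
      fun i hi => if_neg (by simpa using hi))).congr fun i => ?_
    split_ifs <;> simp
  rw [interp, hsum.tsum_eq_add_tsum_ite (N.rep j), ← h.1 j, ← h.2 j]
  simp only [atom, N.cls_rep, add_sub_cancel_left]
  ring

/-! ### Numerical estimates for the interpolant -/

lemma abs_le_of_le_pi_div_five {x : ℝ} (hx : |x| ≤ Real.pi / 5) : |x| ≤ 0.63 := by
  linarith [Real.pi_lt_d2]

lemma abs_psi_sub_le {x : ℝ} (hx : |x| ≤ Real.pi / 5) : |psi x - x| ≤ 0.42 * x ^ 2 := by
  have h1 := abs_le_of_le_pi_div_five hx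
  have h2 := one_sub_phi_le x
  have h3 := phi_le_one x
  rw [psi_eq, show x * phi x - x = -(x * (1 - phi x)) by ring, abs_neg, abs_mul,
    abs_of_nonneg (by linarith : 0 ≤ 1 - phi x)]
  calc |x| * (1 - phi x) ≤ 0.63 * (2 / 3 * x ^ 2) := by gcongr
    _ = _ := by ring

lemma Solves.norm_le_of_le {v w : T → ℂ} (h : N.Solves α β v w) {R : ℝ} (hv : ‖v‖ ≤ R)
    (hw : ‖w‖ ≤ R) : ‖α‖ ≤ 1.14 * R ∧ ‖β‖ ≤ 1.32 * R := by
  obtain ⟨h1, h2⟩ := h.norm_le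
  have h3 := norm_nonneg α
  have h4 := norm_nonneg β
  constructor <;> linarith

lemma Solves.norm_le_one {v : T → ℂ} (h : N.Solves α β v 0) (hv : ‖v‖ ≤ 1) :
    ‖α‖ ≤ 1.0325 ∧ ‖β‖ ≤ 0.0815 ∧ ‖α - v‖ ≤ 0.0325 := by
  obtain ⟨h1, h2⟩ := h.norm_le
  have h5 := h.sub_le
  have h3 := norm_nonneg α
  have h4 := norm_nonneg β
  rw [norm_zero] at h2
  refine ⟨?_, ?_, ?_⟩ <;> linarith

/-- The interpolant is close to its linearization near a distinguished node. -/
lemma Solves.near {v w : T → ℂ} (h : N.Solves α β v w) {R : ℝ} (hv : ‖v‖ ≤ R) (hw : ‖w‖ ≤ R)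
    (j : T) {x : ℝ} (hx : |x| ≤ Real.pi / 5) :
    ‖N.interp α β (N.pos (N.rep j) + x) - v j - w j * x‖ ≤ 3 * R * x ^ 2 := by
  obtain ⟨E, hE, he⟩ := h.taylor N j hx
  obtain ⟨hA, hB⟩ := h.norm_le_of_le N hv hw
  have h1 : |phi x - 1| ≤ 2 / 3 * x ^ 2 := by
    rw [abs_sub_comm, abs_of_nonneg (by linarith [phi_le_one x])]
    exact one_sub_phi_le x
  have h2 := abs_psi_sub_le hx
  have h3 := norm_comb_le j hA hB (phi x - 1) (psi x - x)
  have hR : 0 ≤ R := (norm_nonneg v).trans hv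
  have e : N.interp α β (N.pos (N.rep j) + x) - v j - w j * x
      = (α j * ((phi x - 1 : ℝ) : ℂ) + β j * ((psi x - x : ℝ) : ℂ)) + E := by
    rw [he]; push_cast; ring
  rw [e]
  refine (norm_add_le _ _).trans ((add_le_add h3 hE).trans ?_)
  calc _ ≤ 1.14 * R * (2 / 3 * x ^ 2) + 1.32 * R * (0.42 * x ^ 2)
        + (4.544 * (1.14 * R) + 9.04 * (1.32 * R)) * x ^ 2 / 2 * 0.1454 := by gcongr
    _ = (1.14 * (2 / 3) + 1.32 * 0.42 + (4.544 * 1.14 + 9.04 * 1.32) / 2 * 0.1454)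
        * (R * x ^ 2) := by ring
    _ ≤ 3 * (R * x ^ 2) := by
        refine mul_le_mul_of_nonneg_right (by norm_num) (by positivity)
    _ = _ := by ring

/-- The interpolant with zero derivatives decays quadratically near a distinguished node. -/
lemma Solves.near_sharp {v : T → ℂ} (h : N.Solves α β v 0) (hv : ‖v‖ ≤ 1)
    (j : T) {x : ℝ} (hx : |x| ≤ Real.pi / 5) :
    ‖N.interp α β (N.pos (N.rep j) + x)‖ ≤ 1 - 0.1 * x ^ 2 := by
  obtain ⟨E, hE, he⟩ := h.taylor N j hx
  obtain ⟨hA, hB, hD⟩ := h.norm_le_one N hv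
  have hk := le_one_sub_phi (abs_le_of_le_pi_div_five hx)
  have hk1 := phi_le_one x
  have hk0 := phi_nonneg x
  have h2 := abs_psi_sub_le hx
  have h3 := norm_comb_le (α := α - v) j hD hB (phi x - 1) (psi x - x)
  have hvj := (norm_le_pi_norm v j).trans hv
  -- The main term `v j * phi x` drops by at least `0.58 x²`, while the three perturbations cost
  -- less than `0.46 x²` together.
  have e : N.interp α β (N.pos (N.rep j) + x)
      = v j * phi x + ((α - v) j * ((phi x - 1 : ℝ) : ℂ) + β j * ((psi x - x : ℝ) : ℂ)) + E := by
    rw [he]; simp only [Pi.sub_apply, Pi.zero_apply]; push_cast; ring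
  rw [e]
  have h4 : ‖v j * (phi x : ℂ)‖ ≤ phi x := by
    rw [norm_mul, Complex.norm_real, Real.norm_of_nonneg hk0]
    exact mul_le_of_le_one_left hk0 hvj
  rw [abs_of_nonpos (by linarith : phi x - 1 ≤ 0)] at h3
  have h5 : (4.544 * ‖α‖ + 9.04 * ‖β‖) * x ^ 2 / 2 * 0.1454
      ≤ (4.544 * 1.0325 + 9.04 * 0.0815) * x ^ 2 / 2 * 0.1454 := by gcongr
  have h6 : 0.0815 * |psi x - x| ≤ 0.0815 * (0.42 * x ^ 2) := by gcongr
  have := norm_add₃_le (a := v j * (phi x : ℂ))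
    (b := (α - v) j * ((phi x - 1 : ℝ) : ℂ) + β j * ((psi x - x : ℝ) : ℂ)) (c := E)
  nlinarith [sq_nonneg x]

/-- The nearest node is kept explicit because it dominates; the remaining nodes are estimated
through the decay of the kernels. -/
lemma norm_interp_far_le {A B x e e' : ℝ} (hA : ‖α‖ ≤ A) (hB : ‖β‖ ≤ B) (i₀ : ι)
    (hmin : ∀ i, |x - N.pos i₀| ≤ |x - N.pos i|) (h0 : 0 < |x - N.pos i₀|)
    (he : 0 < e) (he' : 0 < e')
    (h1 : e ≤ max |x - N.pos i₀| (Real.pi - |x - N.pos i₀|))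
    (h2 : e' ≤ |x - N.pos i₀| + Real.pi) :
    ‖N.interp α β x‖ ≤ A * phi (x - N.pos i₀) + B * |psi (x - N.pos i₀)| +
      ((A / e + B) * cubeBound e + (A / e' + B) * cubeBound e') := by
  classical
  have hA0 : 0 ≤ A := (norm_nonneg _).trans hA
  have hB0 : 0 ≤ B := (norm_nonneg _).trans hB
  obtain ⟨s, hs⟩ := summable_and_norm_tsum_le
    (g := fun i => if i = i₀ then 0 else N.atom α β i x)
    (w := fun i => if i = i₀ then 0 else A / |x - N.pos i| ^ 4 + B / |x - N.pos i| ^ 3)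
    (C := 1) (B := (A / e + B) * cubeBound e + (A / e' + B) * cubeBound e')
    (fun i => by
      rw [one_mul]
      split_ifs with h
      · simp
      · have hi : 0 < |x - N.pos i| := h0.trans_le (hmin i)
        refine (norm_comb_le _ hA hB _ _).trans ?_
        have p1 := abs_phi_le hi
        have p2 := abs_psi_le (x - N.pos i)
        calc _ ≤ A * (1 / |x - N.pos i| ^ 4) + B * (1 / |x - N.pos i| ^ 3) := by gcongr
          _ = _ := by ring)
    zero_le_one (fun i => by split_ifs <;> positivity)
    (fun s => by
      refine le_trans (le_of_eq ?_) (N.sum_far_le hA0 hB0 i₀ hmin he he' h1 h2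
        (s.filter (· ≠ i₀)) (by simp))
      rw [Finset.sum_filter]
      exact Finset.sum_congr rfl fun i _ => by split_ifs <;> simp_all)
  have hsum : Summable (fun i => N.atom α β i x) := by
    refine (s.add (summable_of_ne_finset_zero (s := {i₀})
      (f := fun i => if i = i₀ then N.atom α β i x else 0)
      fun i hi => if_neg (by simpa using hi))).congr fun i => ?_
    split_ifs <;> simp
  rw [interp, hsum.tsum_eq_add_tsum_ite i₀]
  refine (norm_add_le _ _).trans (add_le_add ?_ (by simpa using hs))
  refine (norm_comb_le _ hA hB _ _).trans_eq ?_
  rw [abs_of_nonneg (phi_nonneg _)]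

lemma Solves.far {v w : T → ℂ} (h : N.Solves α β v w) {R : ℝ} (hv : ‖v‖ ≤ R) (hw : ‖w‖ ≤ R)
    (i₀ : ι) {x : ℝ} (hmin : ∀ i, |x - N.pos i₀| ≤ |x - N.pos i|)
    (hx : Real.pi / 5 ≤ |x - N.pos i₀|) : ‖N.interp α β x‖ ≤ 10 * R := by
  have hpi := Real.pi_gt_d2
  obtain ⟨hA, hB⟩ := h.norm_le_of_le N hv hw
  have hR : 0 ≤ R := (norm_nonneg v).trans hv
  have hd0 : 0.628 ≤ |x - N.pos i₀| := by linarith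
  -- The larger of `d` and `π - d` is at least π/2, and `d ≥ π/5` gives `d + π ≥ 6π/5`.
  have key := N.norm_interp_far_le hA hB i₀ hmin (by linarith) (e := 1 / 2 * Real.pi)
    (e' := 6 / 5 * Real.pi) (by linarith) (by linarith)
    (by rw [le_max_iff]; by_contra! hh; linarith [hh.1, hh.2]) (by linarith)
  have c1 := cubeBound_pi_mul_le (t := 1 / 2) (B := 0.2747) (by norm_num) (by norm_num)
  have n1 := cubeBound_nonneg (e := 1 / 2 * Real.pi) (by linarith)
  have n2 := cubeBound_nonneg (e := 6 / 5 * Real.pi) (by linarith)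
  have n3 := cubeBound_nonneg (e := 7 / 10 * Real.pi) (by linarith)
  have c2 := cubeBound_pi_mul_le (t := 6 / 5) (B := 0.0244) (by norm_num) (by norm_num)
  have p1 := phi_le_one (x - N.pos i₀)
  have p2 : |psi (x - N.pos i₀)| ≤ 1 / 0.628 ^ 3 := (abs_psi_le _).trans (by gcongr)
  refine key.trans ?_
  calc _ ≤ 1.14 * R * 1 + 1.32 * R * (1 / 0.628 ^ 3) +
        ((1.14 * R / (1 / 2 * 3.14) + 1.32 * R) * 0.2747
          + (1.14 * R / (6 / 5 * 3.14) + 1.32 * R) * 0.0244) := by gcongr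
    _ = (1.14 + 1.32 * (1 / 0.628 ^ 3) + ((1.14 / (1 / 2 * 3.14) + 1.32) * 0.2747
          + (1.14 / (6 / 5 * 3.14) + 1.32) * 0.0244)) * R := by ring
    _ ≤ 10 * R := by
        refine mul_le_mul_of_nonneg_right (by norm_num) hR

lemma Solves.far_sharp {v : T → ℂ} (h : N.Solves α β v 0) (hv : ‖v‖ ≤ 1)
    (i₀ : ι) {x : ℝ} (hmin : ∀ i, |x - N.pos i₀| ≤ |x - N.pos i|)
    (hx : Real.pi / 5 ≤ |x - N.pos i₀|) : ‖N.interp α β x‖ ≤ 0.95 := by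
  have hpi := Real.pi_gt_d2
  have hpi' := Real.pi_lt_d2
  obtain ⟨hA, hB, -⟩ := h.norm_le_one N hv
  have n1 := cubeBound_nonneg (e := 1 / 2 * Real.pi) (by linarith)
  have n2 := cubeBound_nonneg (e := 6 / 5 * Real.pi) (by linarith)
  have n3 := cubeBound_nonneg (e := 7 / 10 * Real.pi) (by linarith)
  have c2 := cubeBound_pi_mul_le (t := 6 / 5) (B := 0.0244) (by norm_num) (by norm_num)
  -- A single choice of `e` is too lossy. For `d ≤ 3π/10` the nearest kernel is large, but nodes
  -- across `x` are at least 7π/10 away; for larger `d` those may be as near as π/2, but the nearest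
  -- kernel is at most 0.544.
  rcases le_total |x - N.pos i₀| (3 / 10 * Real.pi) with hd | hd
  · have hd0 : 0.628 ≤ |x - N.pos i₀| := by linarith
    have key := N.norm_interp_far_le hA hB i₀ hmin (by linarith) (e := 7 / 10 * Real.pi)
      (e' := 6 / 5 * Real.pi) (by linarith) (by linarith)
      (by rw [le_max_iff]; right; linarith) (by linarith)
    have c1 := cubeBound_pi_mul_le (t := 7 / 10) (B := 0.1055) (by norm_num) (by norm_num)
    have p1 : phi (x - N.pos i₀) ≤ 0.7663 :=
      (phi_le_of_le (by norm_num) (by norm_num) hd0).trans (by norm_num)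
    have p2 : |psi (x - N.pos i₀)| ≤ 0.945 * 0.7663 := by
      rw [psi_eq, abs_mul, abs_of_nonneg (phi_nonneg _)]
      have : |x - N.pos i₀| ≤ 0.945 := by linarith
      exact mul_le_mul this p1 (phi_nonneg _) (by norm_num)
    refine key.trans ?_
    calc _ ≤ (1.0325 : ℝ) * 0.7663 + 0.0815 * (0.945 * 0.7663) +
        ((1.0325 / (7 / 10 * 3.14) + 0.0815) * 0.1055
          + (1.0325 / (6 / 5 * 3.14) + 0.0815) * 0.0244) := by gcongr
      _ ≤ 0.95 := by norm_num
  · have hd0 : 0.942 ≤ |x - N.pos i₀| := by linarith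
    have key := N.norm_interp_far_le hA hB i₀ hmin (by linarith) (e := 1 / 2 * Real.pi)
      (e' := 6 / 5 * Real.pi) (by linarith) (by linarith)
      (by rw [le_max_iff]; by_contra! hh; linarith [hh.1, hh.2]) (by linarith)
    have c1 := cubeBound_pi_mul_le (t := 1 / 2) (B := 0.2747) (by norm_num) (by norm_num)
    have p1 : phi (x - N.pos i₀) ≤ 0.544 :=
      (phi_le_of_le (by norm_num) (by norm_num) hd0).trans (by norm_num)
    have p2 : |psi (x - N.pos i₀)| ≤ 1 / 0.942 ^ 3 := (abs_psi_le _).trans (by gcongr)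
    refine key.trans ?_
    calc _ ≤ (1.0325 : ℝ) * 0.544 + 0.0815 * (1 / 0.942 ^ 3) +
        ((1.0325 / (1 / 2 * 3.14) + 0.0815) * 0.2747
          + (1.0325 / (6 / 5 * 3.14) + 0.0815) * 0.0244) := by gcongr
      _ ≤ 0.95 := by norm_num

end NodeFamily

/-! ### Partial fractions -/

open UpperHalfPlane in
lemma eqOn_iteratedDerivWithin_succ {f g g' : ℂ → ℂ} {k : ℕ}
    (h : Set.EqOn (iteratedDerivWithin k f upperHalfPlaneSet) g upperHalfPlaneSet)
    (hg : ∀ z ∈ upperHalfPlaneSet, HasDerivAt g (g' z) z) :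
    Set.EqOn (iteratedDerivWithin (k + 1) f upperHalfPlaneSet) g' upperHalfPlaneSet := by
  intro z hz
  rw [iteratedDerivWithin_succ, derivWithin_congr h (h hz),
    derivWithin_of_isOpen isOpen_upperHalfPlaneSet hz, (hg z hz).deriv]

lemma sin_pi_mul_ne_zero_of_im_pos {z : ℂ} (hz : 0 < z.im) : Complex.sin (Real.pi * z) ≠ 0 := by
  apply sin_pi_mul_ne_zero
  rintro ⟨n, rfl⟩
  simp at hz

-- The second and third derivatives of the partial fraction expansion of `π cot (π z)`, with the
-- signed factorials 2 and -6 divided out.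
open UpperHalfPlane in
lemma tsum_one_div_cube_and_four {z : ℂ} (hz : 0 < z.im) :
    ∑' n : ℤ, 1 / (z + n) ^ 3 =
        Real.pi ^ 3 * Complex.cos (Real.pi * z) / Complex.sin (Real.pi * z) ^ 3 ∧
      ∑' n : ℤ, 1 / (z + n) ^ 4 =
        Real.pi ^ 4 * (1 / Complex.sin (Real.pi * z) ^ 4
          - 2 / 3 / Complex.sin (Real.pi * z) ^ 2) := by
  set p : ℂ := (Real.pi : ℂ) with hp
  have hs : ∀ w : ℂ, HasDerivAt (fun w => Complex.sin (p * w)) (p * Complex.cos (p * w)) w :=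
    fun w => by
      have := ((hasDerivAt_id w).const_mul p).csin
      simpa [mul_comm] using this
  have hc : ∀ w : ℂ, HasDerivAt (fun w => Complex.cos (p * w)) (-(p * Complex.sin (p * w))) w :=
    fun w => by
      have := ((hasDerivAt_id w).const_mul p).ccos
      simpa [mul_comm] using this
  have hsq : ∀ w : ℂ, Complex.cos (p * w) ^ 2 = 1 - Complex.sin (p * w) ^ 2 := fun w => by
    rw [← Complex.sin_sq_add_cos_sq (p * w)]; ring
  have h1 : Set.EqOn (iteratedDerivWithin 1 (fun x : ℂ => p * (p * x).cot) upperHalfPlaneSet)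
      (fun w => -p ^ 2 / Complex.sin (p * w) ^ 2) upperHalfPlaneSet := by
    refine eqOn_iteratedDerivWithin_succ (k := 0)
      (g := fun w => p * (Complex.cos (p * w) / Complex.sin (p * w))) ?_ ?_
    · intro w _
      simp [Complex.cot]
    · intro w hw
      have h0 := sin_pi_mul_ne_zero_of_im_pos hw
      rw [← hp] at h0
      refine (((hc w).div (hs w) h0).const_mul p).congr_deriv ?_
      field_simp
      linear_combination (-p ^ 2) * hsq w
  have h2 : Set.EqOn (iteratedDerivWithin 2 (fun x : ℂ => p * (p * x).cot) upperHalfPlaneSet)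
      (fun w => 2 * p ^ 3 * Complex.cos (p * w) / Complex.sin (p * w) ^ 3)
      upperHalfPlaneSet := by
    refine eqOn_iteratedDerivWithin_succ h1 ?_
    intro w hw
    have h0 := sin_pi_mul_ne_zero_of_im_pos hw
    rw [← hp] at h0
    refine ((hasDerivAt_const w (-p ^ 2)).div ((hs w).pow 2) (pow_ne_zero 2 h0)).congr_deriv ?_
    simp only [Pi.pow_apply]
    field_simp
    push_cast; ring
  have h3 : Set.EqOn (iteratedDerivWithin 3 (fun x : ℂ => p * (p * x).cot) upperHalfPlaneSet)
      (fun w => -6 * (p ^ 4 * (1 / Complex.sin (p * w) ^ 4 - 2 / 3 / Complex.sin (p * w) ^ 2)))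
      upperHalfPlaneSet := by
    refine eqOn_iteratedDerivWithin_succ h2 ?_
    intro w hw
    have h0 := sin_pi_mul_ne_zero_of_im_pos hw
    rw [← hp] at h0
    refine (((hc w).const_mul (2 * p ^ 3)).div ((hs w).pow 3) (pow_ne_zero 3 h0)).congr_deriv ?_
    simp only [Pi.pow_apply]
    field_simp
    push_cast
    linear_combination (-18 * p ^ 4 * Complex.sin (p * w) ^ 2) * hsq w
  have e2 := iteratedDerivWithin_cot_pi_mul_eq_mul_tsum_div_pow (k := 2) (by norm_num) (z := z) hz
  have e3 := iteratedDerivWithin_cot_pi_mul_eq_mul_tsum_div_pow (k := 3) (by norm_num) (z := z) hz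
  rw [← hp, h2 hz] at e2
  rw [← hp, h3 hz] at e3
  norm_num [Nat.factorial] at e2 e3
  constructor
  · simp only [one_div]
    linear_combination (-1 / 2 : ℂ) * e2
  · simp only [one_div]
    linear_combination -e3

lemma summable_one_div_add_int_pow (x : ℝ) {k : ℕ} (hk : 1 < k) :
    Summable fun n : ℤ => ‖1 / ((x : ℂ) + n) ^ k‖ := by
  have h := (Real.summable_one_div_int_add_rpow x k).2 (by exact_mod_cast hk)
  refine h.congr fun n => ?_
  rw [Real.rpow_natCast, norm_div, norm_pow, norm_one, add_comm]
  congr 2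
  rw [← Complex.ofReal_intCast, ← Complex.ofReal_add, Complex.norm_real, Real.norm_eq_abs]

/-- The cotangent expansion is used only in the upper half plane, so real points are reached as
limits from above. Adding an imaginary part only increases `|x + n|`, so the series at `x`
dominates. -/
lemma tendsto_tsum_one_div_add_int_pow {x : ℝ} (hx : ∀ n : ℤ, x + n ≠ 0) {k : ℕ} (hk : 1 < k) :
    Filter.Tendsto (fun ε : ℝ => ∑' n : ℤ, 1 / ((x : ℂ) + ε * Complex.I + n) ^ k)
      (nhdsWithin 0 (Set.Ioi 0)) (nhds (∑' n : ℤ, 1 / ((x : ℂ) + n) ^ k)) := by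
  have hx' : ∀ n : ℤ, (x : ℂ) + n ≠ 0 := fun n h => hx n (by exact_mod_cast h)
  refine tendsto_tsum_of_dominated_convergence (summable_one_div_add_int_pow x hk) ?_ ?_
  · intro n
    have : ContinuousAt (fun ε : ℝ => 1 / ((x : ℂ) + ε * Complex.I + n) ^ k) 0 := by
      refine ContinuousAt.div (by fun_prop) (by fun_prop) ?_
      simpa using pow_ne_zero k (hx' n)
    have h2 := this.tendsto.mono_left (nhdsWithin_le_nhds (s := Set.Ioi 0))
    simpa using h2
  · refine Filter.Eventually.of_forall fun ε n => ?_
    rw [norm_div, norm_div, norm_pow, norm_pow]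
    refine div_le_div_of_nonneg_left (by simp) (pow_pos (norm_pos_iff.2 (hx' n)) k)
      (pow_le_pow_left₀ (norm_nonneg _) ?_ k)
    have h1 : (x : ℂ) + n = ((x + n : ℝ) : ℂ) := by push_cast; ring
    have h2 : ((x : ℂ) + ε * Complex.I + n).re = x + n := by simp
    rw [h1, Complex.norm_real, Real.norm_eq_abs, ← h2]
    exact Complex.abs_re_le_norm _

lemma sin_pi_mul_ne_zero_of_real {x : ℝ} (hx : ∀ n : ℤ, x + n ≠ 0) :
    Real.sin (Real.pi * x) ≠ 0 := by
  intro h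
  obtain ⟨n, hn⟩ := Real.sin_eq_zero_iff.1 h
  have : x = n := by
    have := Real.pi_pos.ne'
    apply mul_left_cancel₀ this; linarith
  exact hx (-n) (by rw [this]; push_cast; ring)

lemma tsum_one_div_real {x : ℝ} (hx : ∀ n : ℤ, x + n ≠ 0) :
    ∑' n : ℤ, 1 / ((x : ℂ) + n) ^ 3 =
        ((Real.pi ^ 3 * Real.cos (Real.pi * x) / Real.sin (Real.pi * x) ^ 3 : ℝ) : ℂ) ∧
      ∑' n : ℤ, 1 / ((x : ℂ) + n) ^ 4 =
        ((Real.pi ^ 4 * (1 / Real.sin (Real.pi * x) ^ 4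
          - 2 / 3 / Real.sin (Real.pi * x) ^ 2) : ℝ) : ℂ) := by
  have hs : Complex.sin (Real.pi * ((x : ℂ) + (0 : ℝ) * Complex.I)) ≠ 0 := by
    have := sin_pi_mul_ne_zero_of_real hx
    rw [Complex.ofReal_zero, zero_mul, add_zero]
    exact_mod_cast this
  have him : ∀ ε : ℝ, 0 < ε → 0 < ((x : ℂ) + ε * Complex.I).im := fun ε h => by simpa using h
  constructor
  · refine tendsto_nhds_unique (tendsto_tsum_one_div_add_int_pow hx (by norm_num)) ?_
    have hc : ContinuousAt (fun ε : ℝ =>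
        Real.pi ^ 3 * Complex.cos (Real.pi * ((x : ℂ) + ε * Complex.I))
          / Complex.sin (Real.pi * ((x : ℂ) + ε * Complex.I)) ^ 3) 0 :=
      ContinuousAt.div (by fun_prop) (by fun_prop) (pow_ne_zero 3 hs)
    have h2 := hc.tendsto.mono_left (nhdsWithin_le_nhds (s := Set.Ioi 0))
    have h3 := h2.congr' (by
      filter_upwards [self_mem_nhdsWithin] with ε hε
      exact (tsum_one_div_cube_and_four (him ε hε)).1.symm)
    convert h3 using 2
    push_cast; simp
  · refine tendsto_nhds_unique (tendsto_tsum_one_div_add_int_pow hx (by norm_num)) ?_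
    have hc : ContinuousAt (fun ε : ℝ =>
        Real.pi ^ 4 * (1 / Complex.sin (Real.pi * ((x : ℂ) + ε * Complex.I)) ^ 4
          - 2 / 3 / Complex.sin (Real.pi * ((x : ℂ) + ε * Complex.I)) ^ 2)) 0 := by
      refine ContinuousAt.mul (by fun_prop) (ContinuousAt.sub ?_ ?_)
      · exact ContinuousAt.div (by fun_prop) (by fun_prop) (pow_ne_zero 4 hs)
      · exact ContinuousAt.div (by fun_prop) (by fun_prop) (pow_ne_zero 2 hs)
    have h2 := hc.tendsto.mono_left (nhdsWithin_le_nhds (s := Set.Ioi 0))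
    have h3 := h2.congr' (by
      filter_upwards [self_mem_nhdsWithin] with ε hε
      exact (tsum_one_div_cube_and_four (him ε hε)).2.symm)
    convert h3 using 2
    push_cast; simp

/-! ### Trigonometric polynomials -/

/-- Trigonometric polynomials of degree at most `d`. -/
def IsTrigPoly (d : ℕ) (f : UnitAddCircle → ℂ) : Prop :=
  ∃ c : ℤ → ℂ, ∀ t, f t = ∑ k ∈ Finset.Icc (-(d : ℤ)) d, c k * fourier k t

namespace IsTrigPoly

variable {d e : ℕ} {f g : UnitAddCircle → ℂ}

lemma congr (hf : IsTrigPoly d f) (h : ∀ t, g t = f t) : IsTrigPoly d g := by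
  rwa [show g = f from funext h]

lemma zero : IsTrigPoly d (fun _ => 0) := ⟨0, by simp⟩

lemma monomial {k : ℤ} (hk : |k| ≤ d) (a : ℂ) : IsTrigPoly d (fun t => a * fourier k t) := by
  refine ⟨Pi.single k a, fun t => ?_⟩
  rw [Finset.sum_eq_single k]
  · simp
  · intro j _ hj
    simp [Pi.single_eq_of_ne hj]
  · intro h
    exact absurd (Finset.mem_Icc.2 (abs_le.1 hk)) h

lemma add (hf : IsTrigPoly d f) (hg : IsTrigPoly d g) : IsTrigPoly d (fun t => f t + g t) := by
  obtain ⟨c, hc⟩ := hf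
  obtain ⟨c', hc'⟩ := hg
  refine ⟨c + c', fun t => ?_⟩
  beta_reduce
  rw [hc, hc', ← Finset.sum_add_distrib]
  exact Finset.sum_congr rfl fun k _ => by rw [Pi.add_apply]; ring

lemma const_mul (a : ℂ) (hf : IsTrigPoly d f) : IsTrigPoly d (fun t => a * f t) := by
  obtain ⟨c, hc⟩ := hf
  refine ⟨fun k => a * c k, fun t => ?_⟩
  beta_reduce
  rw [hc, Finset.mul_sum]
  exact Finset.sum_congr rfl fun k _ => by ring

lemma sum {ι : Type*} (s : Finset ι) {f : ι → UnitAddCircle → ℂ}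
    (hf : ∀ i ∈ s, IsTrigPoly d (f i)) : IsTrigPoly d (fun t => ∑ i ∈ s, f i t) := by
  classical
  induction s using Finset.induction_on with
  | empty => simpa using zero
  | insert a s ha ih =>
    refine (((hf a (Finset.mem_insert_self a s)).add
      (ih fun i hi => hf i (Finset.mem_insert_of_mem hi))).congr fun t => ?_)
    rw [Finset.sum_insert ha]

lemma mul (hf : IsTrigPoly d f) (hg : IsTrigPoly e g) :
    IsTrigPoly (d + e) (fun t => f t * g t) := by
  obtain ⟨c, hc⟩ := hf
  obtain ⟨c', hc'⟩ := hg
  have h := sum (d := d + e) (Finset.Icc (-(d : ℤ)) d) (f := fun k t =>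
    ∑ m ∈ Finset.Icc (-(e : ℤ)) e, (c k * c' m) * fourier (k + m) t) fun k hk =>
      sum _ fun m hm => monomial (by
        rw [Finset.mem_Icc] at hk hm
        rw [abs_le]; push_cast; constructor <;> linarith [hk.1, hk.2, hm.1, hm.2]) _
  refine h.congr fun t => ?_
  rw [hc, hc', Finset.sum_mul_sum]
  refine Finset.sum_congr rfl fun k _ => Finset.sum_congr rfl fun m _ => ?_
  rw [fourier_add]; ring

lemma mono (h : d ≤ e) (hf : IsTrigPoly d f) : IsTrigPoly e f := by
  obtain ⟨c, hc⟩ := hf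
  refine (sum (Finset.Icc (-(d : ℤ)) d) (f := fun k t => c k * fourier k t) fun k hk =>
    monomial ?_ _).congr hc
  rw [Finset.mem_Icc] at hk
  rw [abs_le]; constructor <;> linarith [hk.1, hk.2, (Nat.cast_le (α := ℤ)).2 h]

lemma translate (s : UnitAddCircle) (hf : IsTrigPoly d f) : IsTrigPoly d (fun t => f (t - s)) := by
  obtain ⟨c, hc⟩ := hf
  refine ⟨fun k => c k * fourier k (-s), fun t => ?_⟩
  beta_reduce
  rw [hc]
  refine Finset.sum_congr rfl fun k _ => ?_
  rw [fourier_apply, fourier_apply, fourier_apply, sub_eq_add_neg, smul_add, AddCircle.toCircle_add,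
    Circle.coe_mul]
  ring

lemma continuous (hf : IsTrigPoly d f) : Continuous f := by
  obtain ⟨c, hc⟩ := hf
  rw [show f = _ from funext hc]
  fun_prop

end IsTrigPoly

/-- The geometric sum `∑_{k < M} e^{2 π i k t}`. -/
def geomKernel (M : ℕ) (t : UnitAddCircle) : ℂ := ∑ k ∈ Finset.range M, fourier (k : ℤ) t

/-- The unnormalized Fejér kernel `|∑_{k < M} e^{2 π i k t}|²`. -/
def squareKernel (M : ℕ) (t : UnitAddCircle) : ℝ := ‖geomKernel M t‖ ^ 2

lemma squareKernel_eq_sum (M : ℕ) (t : UnitAddCircle) :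
    (squareKernel M t : ℂ) =
      ∑ k ∈ Finset.range M, ∑ l ∈ Finset.range M, fourier ((k : ℤ) - l) t := by
  rw [squareKernel, Complex.ofReal_pow, ← Complex.mul_conj', geomKernel, map_sum,
    Finset.sum_mul_sum]
  refine Finset.sum_congr rfl fun k _ => Finset.sum_congr rfl fun l _ => ?_
  rw [sub_eq_add_neg, fourier_add, fourier_neg]

lemma isTrigPoly_squareKernel (M : ℕ) : IsTrigPoly (M - 1) (fun t => (squareKernel M t : ℂ)) := by
  refine (IsTrigPoly.sum (Finset.range M) (f := fun k t => ∑ l ∈ Finset.range M,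
    1 * fourier ((k : ℤ) - l) t) fun k hk => IsTrigPoly.sum _ fun l hl =>
      IsTrigPoly.monomial ?_ 1).congr fun t => ?_
  · rw [Finset.mem_range] at hk hl
    rw [abs_le]; omega
  · simp only [one_mul]; exact squareKernel_eq_sum M t

lemma fourier_coe_eq (k : ℤ) (x : ℝ) :
    fourier k (x : UnitAddCircle) = Complex.exp (Complex.I * ((2 * Real.pi * k * x : ℝ) : ℂ)) := by
  rw [fourier_coe_apply]
  congr 1; push_cast; rw [div_one]; ring

lemma norm_exp_sub_one_sq (y : ℝ) :
    ‖Complex.exp (Complex.I * ((2 * y : ℝ) : ℂ)) - 1‖ ^ 2 = 4 * Real.sin y ^ 2 := by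
  rw [Complex.norm_exp_I_mul_ofReal_sub_one, mul_div_cancel_left₀ _ two_ne_zero, norm_mul, mul_pow,
    Real.norm_eq_abs, Real.norm_eq_abs, sq_abs, sq_abs]
  norm_num

lemma squareKernel_coe (M : ℕ) {x : ℝ} (hx : Real.sin (Real.pi * x) ≠ 0) :
    squareKernel M (x : UnitAddCircle) =
      Real.sin (Real.pi * M * x) ^ 2 / Real.sin (Real.pi * x) ^ 2 := by
  set z := Complex.exp (Complex.I * ((2 * (Real.pi * x) : ℝ) : ℂ)) with hz
  have h1 : geomKernel M (x : UnitAddCircle) = ∑ k ∈ Finset.range M, z ^ k := by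
    refine Finset.sum_congr rfl fun k _ => ?_
    rw [fourier_coe_eq, hz, ← Complex.exp_nat_mul]
    congr 1; push_cast; ring
  have h2 : ‖z - 1‖ ^ 2 = 4 * Real.sin (Real.pi * x) ^ 2 := norm_exp_sub_one_sq _
  have h3 : ‖z ^ M - 1‖ ^ 2 = 4 * Real.sin (Real.pi * M * x) ^ 2 := by
    rw [← norm_exp_sub_one_sq, hz, ← Complex.exp_nat_mul]
    congr 4; push_cast; ring
  have h4 := congrArg (fun w => ‖w‖ ^ 2) (geom_sum_mul z M)
  simp only [norm_mul, mul_pow, h2, h3, ← h1] at h4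
  rw [squareKernel, eq_div_iff (pow_ne_zero 2 hx)]
  linarith

/-! ### Periodization of the kernel -/

/-- The periodization of `phi`. -/
def phiCircle (M : ℕ) (t : UnitAddCircle) : ℂ :=
  (squareKernel M t : ℂ) * squareKernel M t *
    (1 / (M : ℂ) ^ 4 * (2 / 3 * fourier 0 t + 1 / 6 * fourier 1 t + 1 / 6 * fourier (-1) t))

/-- The periodization of `psi`. -/
def psiCircle (M : ℕ) (t : UnitAddCircle) : ℂ :=
  (squareKernel M t : ℂ) * squareKernel M t *
    (1 / (M : ℂ) ^ 3 * (1 / (4 * Complex.I) * fourier 1 t + -1 / (4 * Complex.I) * fourier (-1) t))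

/-- Two factors of degree `M - 1` and one of degree 1 give `2 * (M - 1) + 1`. -/
lemma isTrigPoly_phiCircle {M : ℕ} (hM : 1 ≤ M) : IsTrigPoly (2 * M - 1) (phiCircle M) := by
  have h : IsTrigPoly 1 (fun t : UnitAddCircle => 1 / (M : ℂ) ^ 4 *
      (2 / 3 * fourier 0 t + 1 / 6 * fourier 1 t + 1 / 6 * fourier (-1) t)) :=
    (((IsTrigPoly.monomial (by simp) _).add (IsTrigPoly.monomial (by simp) _)).add
      (IsTrigPoly.monomial (by simp) _)).const_mul _
  have := ((isTrigPoly_squareKernel M).mul (isTrigPoly_squareKernel M)).mul h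
  exact this.mono (by omega)

lemma isTrigPoly_psiCircle {M : ℕ} (hM : 1 ≤ M) : IsTrigPoly (2 * M - 1) (psiCircle M) := by
  have h : IsTrigPoly 1 (fun t : UnitAddCircle => 1 / (M : ℂ) ^ 3 *
      (1 / (4 * Complex.I) * fourier 1 t + -1 / (4 * Complex.I) * fourier (-1) t)) :=
    ((IsTrigPoly.monomial (by simp) _).add (IsTrigPoly.monomial (by simp) _)).const_mul _
  have := ((isTrigPoly_squareKernel M).mul (isTrigPoly_squareKernel M)).mul h
  exact this.mono (by omega)

/-- Shifting by an integer changes the sine by a sign at most, and the even power removes it. The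
numerator thus factors out of the periodization. -/
lemma sin_pow_four_sub_int (M : ℕ) (x : ℝ) (n : ℤ) :
    Real.sin (Real.pi * M * (x - n)) ^ 4 = Real.sin (Real.pi * M * x) ^ 4 := by
  have : Real.pi * M * (x - n) = Real.pi * M * x - ((M * n : ℤ) : ℝ) * Real.pi := by
    push_cast; ring
  rw [this, Real.sin_sub_int_mul_pi, mul_pow, ← zpow_natCast, ← zpow_mul]
  have : (-1 : ℝ) ^ ((M * n : ℤ) * ((4 : ℕ) : ℤ)) = 1 := Even.neg_one_zpow (by
    refine Even.mul_left ?_ _; decide)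
  rw [this, one_mul]

lemma exp_add_exp_eq (x : ℝ) :
    fourier 1 (x : UnitAddCircle) = Real.cos (2 * Real.pi * x) + Real.sin (2 * Real.pi * x) * Complex.I
    ∧ fourier (-1) (x : UnitAddCircle)
      = Real.cos (2 * Real.pi * x) - Real.sin (2 * Real.pi * x) * Complex.I := by
  constructor
  · rw [fourier_coe_eq, mul_comm, Complex.exp_mul_I]
    push_cast; simp
  · rw [fourier_coe_eq, mul_comm, Complex.exp_mul_I]
    push_cast
    simp only [mul_neg, mul_one, neg_mul, Complex.cos_neg, Complex.sin_neg]
    ring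

lemma sinc_pi_mul_nat_mul_int (M : ℕ) (hM : M ≠ 0) {n : ℤ} (hn : n ≠ 0) :
    Real.sinc (Real.pi * M * n) = 0 := by
  have h : Real.pi * M * n ≠ 0 :=
    mul_ne_zero (mul_ne_zero Real.pi_pos.ne' (by exact_mod_cast hM)) (by exact_mod_cast hn)
  rw [Real.sinc_of_ne_zero h, show Real.pi * M * n = ((M * n : ℤ) : ℝ) * Real.pi by
    push_cast; ring, Real.sin_int_mul_pi, zero_div]

lemma _root_.HasSum.congr_fun_eq {ι : Type*} {f g : ι → ℂ} {a b : ℂ} (hf : HasSum f a)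
    (hfg : g = f) (hab : b = a) : HasSum g b := by
  rwa [hfg, hab]

/-- The periodizations of `phi` and `psi` are trigonometric polynomials. -/
lemma hasSum_periodization {M : ℕ} (hM : 1 ≤ M) (x : ℝ) :
    HasSum (fun n : ℤ => (phi (Real.pi * M * (x - n)) : ℂ)) (phiCircle M x) ∧
      HasSum (fun n : ℤ => (psi (Real.pi * M * (x - n)) : ℂ)) (psiCircle M x) := by
  have hM0 : (M : ℂ) ≠ 0 := by exact_mod_cast (by omega : M ≠ 0)
  by_cases hx : ∀ n : ℤ, x + n ≠ 0
  · have hs := sin_pi_mul_ne_zero_of_real hx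
    have hp : (Real.pi : ℂ) ≠ 0 := by exact_mod_cast Real.pi_pos.ne'
    have hsC : (Real.sin (Real.pi * x) : ℂ) ≠ 0 := by exact_mod_cast hs
    have hpt : (Real.cos (Real.pi * x) : ℂ) ^ 2 = 1 - (Real.sin (Real.pi * x) : ℂ) ^ 2 := by
      have := Real.sin_sq_add_cos_sq (Real.pi * x)
      exact_mod_cast eq_sub_of_add_eq' this
    have hc2 : ((Real.cos (2 * Real.pi * x) : ℝ) : ℂ) = 1 - 2 * (Real.sin (Real.pi * x) : ℂ) ^ 2 := by
      have : Real.cos (2 * Real.pi * x) = 1 - 2 * Real.sin (Real.pi * x) ^ 2 := by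
        rw [mul_assoc, Real.cos_two_mul, Real.cos_sq']; ring
      rw [this]; push_cast; ring
    have hs2 : ((Real.sin (2 * Real.pi * x) : ℝ) : ℂ)
        = 2 * (Real.sin (Real.pi * x) : ℂ) * Real.cos (Real.pi * x) := by
      rw [mul_assoc, Real.sin_two_mul]; push_cast; ring
    obtain ⟨t3, t4⟩ := tsum_one_div_real hx
    have H3 : HasSum (fun n : ℤ => 1 / ((x : ℂ) + n) ^ 3) _ :=
      (summable_one_div_add_int_pow x (by norm_num)).of_norm.hasSum
    have H4 : HasSum (fun n : ℤ => 1 / ((x : ℂ) + n) ^ 4) _ :=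
      (summable_one_div_add_int_pow x (by norm_num)).of_norm.hasSum
    rw [t3] at H3
    rw [t4] at H4
    rw [← (Equiv.neg ℤ).hasSum_iff] at H3 H4
    have hne : ∀ n : ℤ, Real.pi * M * (x - n) ≠ 0 := fun n =>
      mul_ne_zero (mul_ne_zero Real.pi_pos.ne' (by exact_mod_cast (by omega : M ≠ 0)))
        (by have := hx (-n); push_cast at this; rwa [sub_eq_add_neg])
    have hneC : ∀ n : ℤ, (x : ℂ) - n ≠ 0 := fun n h => hne n (by
      rw [show x - n = 0 by exact_mod_cast h, mul_zero])
    constructor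
    -- Pulling out the common numerator leaves the sum of `1 / (x - n) ^ 4`. Its value contributes
    -- `1 / sin⁴` times `1 - (2/3) sin²`, and the latter equals `2/3 + (1/3) cos (2πx)`, the extra
    -- factor in `phiCircle`.
    · refine (H4.mul_left ((Real.sin (Real.pi * M * x) : ℂ) ^ 4 / (Real.pi * M) ^ 4)).congr_fun_eq
        (funext fun n => ?_) ?_
      · rw [phi_of_ne_zero (hne n), sin_pow_four_sub_int]
        have := hneC n
        simp only [Function.comp, Equiv.neg_apply]
        push_cast
        rw [← sub_eq_add_neg]
        field_simp
      · rw [phiCircle, squareKernel_coe M hs, (exp_add_exp_eq x).1, (exp_add_exp_eq x).2, hc2]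
        simp only [fourier_zero]
        push_cast [-Complex.ofReal_sin, -Complex.ofReal_cos]
        field_simp
        ring
    -- Likewise `cos / sin³` is `1 / sin⁴` times `sin cos = (1/2) sin (2πx)`.
    · refine (H3.mul_left ((Real.sin (Real.pi * M * x) : ℂ) ^ 4 / (Real.pi * M) ^ 3)).congr_fun_eq
        (funext fun n => ?_) ?_
      · rw [psi, sin_pow_four_sub_int]
        have := hneC n
        simp only [Function.comp, Equiv.neg_apply]
        push_cast
        rw [← sub_eq_add_neg]
        field_simp
      · rw [psiCircle, squareKernel_coe M hs, (exp_add_exp_eq x).1, (exp_add_exp_eq x).2, hs2]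
        push_cast [-Complex.ofReal_sin, -Complex.ofReal_cos]
        field_simp
        ring
  -- At an integer the closed forms have poles, but only one summand is nonzero because `sinc`
  -- vanishes at the nonzero integer multiples of πM.
  · push Not at hx
    obtain ⟨m, hm⟩ := hx
    have hxm : x = ((-m : ℤ) : ℝ) := by push_cast; linarith
    have hcirc : (x : UnitAddCircle) = 0 := by
      rw [hxm, AddCircle.coe_eq_zero_iff]
      exact ⟨-m, by simp⟩
    have hsq : squareKernel M (0 : UnitAddCircle) = (M : ℝ) ^ 2 := by
      simp [squareKernel, geomKernel]
    have hz : ∀ n : ℤ, n ≠ -m → phi (Real.pi * M * (x - n)) = 0 := fun n hn => by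
      rw [phi, hxm, show (((-m : ℤ) : ℝ) - n) = ((-m - n : ℤ) : ℝ) by push_cast; ring,
        sinc_pi_mul_nat_mul_int M (by omega) (by omega)]
      norm_num
    constructor
    · refine (hasSum_single (-m) (f := fun n : ℤ => (phi (Real.pi * M * (x - n)) : ℂ))
        (fun n hn => by rw [hz n hn]; simp)).congr_fun_eq rfl ?_
      rw [← hxm, sub_self, mul_zero, phi_zero, hcirc, phiCircle, hsq]
      simp only [fourier_eval_zero]
      push_cast; field_simp; norm_num
    · refine (hasSum_single (-m) (f := fun n : ℤ => (psi (Real.pi * M * (x - n)) : ℂ))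
        (fun n hn => by rw [psi_eq, hz n hn]; simp)).congr_fun_eq rfl ?_
      rw [← hxm, sub_self, mul_zero, psi_zero, hcirc, psiCircle, hsq]
      simp only [fourier_eval_zero]
      push_cast; field_simp; norm_num

/-! ### Interpolation on the circle -/

lemma norm_coe_unitAddCircle_le (x : ℝ) : ‖(x : UnitAddCircle)‖ ≤ |x| := by
  rw [UnitAddCircle.norm_eq]
  simpa using round_le x 0

lemma exists_real_rep (t : UnitAddCircle) : ∃ x : ℝ, (x : UnitAddCircle) = t ∧ |x| = ‖t‖ := by
  obtain ⟨y, rfl⟩ := QuotientAddGroup.mk_surjective t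
  refine ⟨y - round y, ?_, UnitAddCircle.norm_eq.symm⟩
  have : ((round y : ℝ) : UnitAddCircle) = 0 := by
    rw [AddCircle.coe_eq_zero_iff]
    exact ⟨round y, by simp⟩
  rw [AddCircle.coe_sub, this, sub_zero]

lemma coe_add_int (x : ℝ) (n : ℤ) : ((x + n : ℝ) : UnitAddCircle) = x := by
  have : ((n : ℝ) : UnitAddCircle) = 0 := by
    rw [AddCircle.coe_eq_zero_iff]
    exact ⟨n, by simp⟩
  rw [AddCircle.coe_add, this, add_zero]

/-- A real representative of a point of the circle. -/
def realRep (t : UnitAddCircle) : ℝ := (exists_real_rep t).choose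

lemma coe_realRep (t : UnitAddCircle) : (realRep t : UnitAddCircle) = t :=
  (exists_real_rep t).choose_spec.1

/-- The rescaled lift to the line of a separated subset of the circle. -/
def circleNodes {M : ℕ} (hM : 1 ≤ M) (T : Finset UnitAddCircle)
    (hT : ∀ s ∈ T, ∀ t ∈ T, s ≠ t → 1 ≤ M * ‖s - t‖) : NodeFamily T (T × ℤ) where
  pos p := Real.pi * M * (realRep p.1 + p.2)
  cls p := p.1
  rep j := (j, 0)
  cls_rep _ := rfl
  sep := by
    rintro ⟨j, n⟩ ⟨k, m⟩ hne
    have hM' : (1 : ℝ) ≤ M := by exact_mod_cast hM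
    rw [← mul_sub, abs_mul, abs_of_nonneg (by positivity), mul_assoc]
    refine le_mul_of_one_le_right Real.pi_pos.le ?_
    dsimp only
    by_cases hjk : j = k
    · subst hjk
      have hnm : n ≠ m := fun h => hne (by rw [h])
      have h1 : (1 : ℝ) ≤ |((n - m : ℤ) : ℝ)| := by
        rw [← Int.cast_abs]
        exact_mod_cast Int.one_le_abs (sub_ne_zero.2 hnm)
      rw [show realRep j + n - (realRep j + m) = ((n - m : ℤ) : ℝ) by push_cast; ring]
      nlinarith
    · refine (hT j j.2 k k.2 (fun h => hjk (Subtype.ext h))).trans ?_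
      refine mul_le_mul_of_nonneg_left ?_ (by positivity)
      refine le_trans (le_of_eq ?_) (norm_coe_unitAddCircle_le _)
      rw [AddCircle.coe_sub, coe_add_int, coe_add_int, coe_realRep, coe_realRep]

/-- The trigonometric polynomial with the coefficients `α`, `β`. -/
def circleInterp (M : ℕ) (T : Finset UnitAddCircle) (α β : T → ℂ) (t : UnitAddCircle) : ℂ :=
  ∑ j : T, (α j * phiCircle M (t - j) + β j * psiCircle M (t - j))

lemma isTrigPoly_circleInterp {M : ℕ} (hM : 1 ≤ M) (T : Finset UnitAddCircle) (α β : T → ℂ) :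
    IsTrigPoly (2 * M - 1) (circleInterp M T α β) :=
  IsTrigPoly.sum _ fun j _ => (((isTrigPoly_phiCircle hM).translate j).const_mul (α j)).add
    (((isTrigPoly_psiCircle hM).translate j).const_mul (β j))

/-- Coefficients are constant along each fibre over `T`, so the sum over `T × ℤ` groups into
periodized kernels. This transfers every estimate on the line to the circle. -/
lemma interp_circleNodes {M : ℕ} (hM : 1 ≤ M) (T : Finset UnitAddCircle)
    (hT : ∀ s ∈ T, ∀ t ∈ T, s ≠ t → 1 ≤ M * ‖s - t‖) (α β : T → ℂ) (y : ℝ) :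
    (circleNodes hM T hT).interp α β (Real.pi * M * y) = circleInterp M T α β y := by
  have hfib : ∀ j : T, HasSum (fun n : ℤ =>
      (circleNodes hM T hT).atom α β (j, n) (Real.pi * M * y))
      (α j * phiCircle M (y - j) + β j * psiCircle M (y - j)) := fun j => by
    obtain ⟨h1, h2⟩ := hasSum_periodization hM (y - realRep j)
    rw [AddCircle.coe_sub, coe_realRep] at h1 h2
    refine ((h1.mul_left (α j)).add (h2.mul_left (β j))).congr_fun_eq (funext fun n => ?_) rfl
    have : Real.pi * M * y - (circleNodes hM T hT).pos (j, n)
        = Real.pi * M * (y - realRep j - n) := by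
      simp only [circleNodes]; ring
    rw [NodeFamily.atom, this]
    rfl
  have hs : Summable fun p : T × ℤ => (circleNodes hM T hT).atom α β p (Real.pi * M * y) := by
    refine Summable.of_norm ((summable_prod_of_nonneg fun _ => norm_nonneg _).2 ⟨fun j => ?_, ?_⟩)
    · exact (hfib j).summable.norm
    · exact (hasSum_fintype _).summable
  rw [NodeFamily.interp, hs.tsum_prod, tsum_fintype]
  exact Finset.sum_congr rfl fun j _ => (hfib j).tsum_eq

section

variable {M : ℕ} (hM : 1 ≤ M) {T : Finset UnitAddCircle}
    (hT : ∀ s ∈ T, ∀ t ∈ T, s ≠ t → 1 ≤ M * ‖s - t‖) {α β : T → ℂ}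

lemma circleInterp_near (j : T) (x : ℝ) :
    circleInterp M T α β (j + (x / (Real.pi * M) : ℝ)) =
      (circleNodes hM T hT).interp α β
        ((circleNodes hM T hT).pos ((circleNodes hM T hT).rep j) + x) := by
  have hM0 : (M : ℝ) ≠ 0 := by exact_mod_cast (by omega : M ≠ 0)
  have hpi := Real.pi_pos.ne'
  have : (circleNodes hM T hT).pos ((circleNodes hM T hT).rep j) + x
      = Real.pi * M * (realRep j + x / (Real.pi * M)) := by
    simp only [circleNodes]; push_cast; field_simp; ring
  rw [this, interp_circleNodes, AddCircle.coe_add, coe_realRep]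

lemma circleInterp_far (hne : T.Nonempty) (t : UnitAddCircle)
    (ht : ∀ j ∈ T, 1 / 5 ≤ M * ‖t - j‖) :
    ∃ (x : ℝ) (i₀ : T × ℤ), (∀ i, |x - (circleNodes hM T hT).pos i₀|
        ≤ |x - (circleNodes hM T hT).pos i|) ∧
      Real.pi / 5 ≤ |x - (circleNodes hM T hT).pos i₀| ∧
      circleInterp M T α β t = (circleNodes hM T hT).interp α β x := by
  obtain ⟨j, hj, hmin⟩ := T.exists_min_image (fun j => ‖t - j‖) hne
  obtain ⟨d, hd, hd'⟩ := exists_real_rep (t - j)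
  have hy : ((realRep j + d : ℝ) : UnitAddCircle) = t := by
    rw [AddCircle.coe_add, coe_realRep, hd]; abel
  have hpM : 0 ≤ Real.pi * M := by positivity
  have hpos : ∀ i : T × ℤ, |Real.pi * M * (realRep j + d) - (circleNodes hM T hT).pos i|
      = Real.pi * M * |realRep j + d - (realRep i.1 + i.2)| := fun i => by
    simp only [circleNodes]
    rw [← mul_sub, abs_mul, abs_of_nonneg hpM]
  have h0 : |Real.pi * M * (realRep j + d) - (circleNodes hM T hT).pos (⟨j, hj⟩, 0)|
      = Real.pi * M * ‖t - j‖ := by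
    rw [hpos, ← hd']
    congr 2
    simp
  refine ⟨Real.pi * M * (realRep j + d), (⟨j, hj⟩, 0), fun i => ?_, ?_, ?_⟩
  · rw [h0, hpos]
    refine mul_le_mul_of_nonneg_left ?_ hpM
    refine (hmin i.1 i.1.2).trans (le_trans (le_of_eq ?_) (norm_coe_unitAddCircle_le _))
    rw [AddCircle.coe_sub, hy, coe_add_int, coe_realRep]
  · rw [h0]
    have := mul_le_mul_of_nonneg_left (ht j hj) Real.pi_pos.le
    linarith
  · rw [interp_circleNodes, hy]

end

/-- Hermite interpolation on a separated set by trigonometric polynomials of low degree. -/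
theorem exists_hermite {M : ℕ} (hM : 1 ≤ M) {T : Finset UnitAddCircle}
    (hT : ∀ s ∈ T, ∀ t ∈ T, s ≠ t → 1 ≤ M * ‖s - t‖) (v w : T → ℂ) {R : ℝ}
    (hv : ‖v‖ ≤ R) (hw : ‖w‖ ≤ R) :
    ∃ p, IsTrigPoly (2 * M - 1) p ∧
      (∀ (j : T) (x : ℝ), |x| ≤ Real.pi / 5 →
        ‖p (j + (x / (Real.pi * M) : ℝ)) - v j - w j * x‖ ≤ 3 * R * x ^ 2) ∧
      ∀ t, (∀ j ∈ T, 1 / 5 ≤ M * ‖t - j‖) → ‖p t‖ ≤ 10 * R := by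
  obtain ⟨α, β, h⟩ := (circleNodes hM T hT).exists_solves v w
  refine ⟨circleInterp M T α β, isTrigPoly_circleInterp hM T α β, fun j x hx => ?_, fun t ht => ?_⟩
  · rw [circleInterp_near hM hT]
    exact h.near _ hv hw j hx
  · rcases T.eq_empty_or_nonempty with rfl | hne
    · have : 0 ≤ R := (norm_nonneg v).trans hv
      simp only [circleInterp, Finset.univ_eq_empty, Finset.sum_empty, norm_zero]
      positivity
    · obtain ⟨x, i₀, h1, h2, h3⟩ := circleInterp_far hM hT (α := α) (β := β) hne t ht
      rw [h3]
      exact h.far _ hv hw i₀ h1 h2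

/-- The dual certificate: a trigonometric polynomial of low degree that interpolates given phases
on a separated set and is quantitatively smaller than one elsewhere. -/
theorem exists_dual_certificate {M : ℕ} (hM : 1 ≤ M) {T : Finset UnitAddCircle}
    (hT : ∀ s ∈ T, ∀ t ∈ T, s ≠ t → 1 ≤ M * ‖s - t‖) (v : T → ℂ) (hv : ‖v‖ ≤ 1) :
    ∃ q, IsTrigPoly (2 * M - 1) q ∧ (∀ j : T, q j = v j) ∧
      (∀ (j : T) (x : ℝ), |x| ≤ Real.pi / 5 →
        ‖q (j + (x / (Real.pi * M) : ℝ))‖ ≤ 1 - 0.1 * x ^ 2) ∧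
      ∀ t, (∀ j ∈ T, 1 / 5 ≤ M * ‖t - j‖) → ‖q t‖ ≤ 0.95 := by
  obtain ⟨α, β, h⟩ := (circleNodes hM T hT).exists_solves v 0
  refine ⟨circleInterp M T α β, isTrigPoly_circleInterp hM T α β, fun j => ?_, fun j x hx => ?_,
    fun t ht => ?_⟩
  · have h0 := circleInterp_near hM hT (α := α) (β := β) j 0
    -- At `x = 0` the quadratic error bound becomes exact interpolation.
    have h1 := h.near _ hv (by simp) j (x := 0) (by rw [abs_zero]; have := Real.pi_pos; positivity)
    rw [← h0] at h1
    simp at h1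
    exact sub_eq_zero.1 h1
  · rw [circleInterp_near hM hT]
    exact h.near_sharp _ hv j hx
  · rcases T.eq_empty_or_nonempty with rfl | hne
    · simp only [circleInterp, Finset.univ_eq_empty, Finset.sum_empty, norm_zero]
      norm_num
    · obtain ⟨x, i₀, h1, h2, h3⟩ := circleInterp_far hM hT (α := α) (β := β) hne t ht
      rw [h3]
      exact h.far_sharp _ hv i₀ h1 h2

/-- Every point is either far from a finite set or of the form required by the local estimates. -/
lemma near_or_far {M : ℕ} (hM : 1 ≤ M) (T : Finset UnitAddCircle) (t : UnitAddCircle) :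
    (∃ (j : T) (x : ℝ), |x| ≤ Real.pi / 5 ∧ t = j + (x / (Real.pi * M) : ℝ)) ∨
      ∀ j ∈ T, 1 / 5 ≤ M * ‖t - j‖ := by
  by_cases h : ∀ j ∈ T, 1 / 5 ≤ M * ‖t - j‖
  · exact Or.inr h
  · push Not at h
    obtain ⟨j, hj, hlt⟩ := h
    obtain ⟨d, hd, hd'⟩ := exists_real_rep (t - j)
    have hM0 : (M : ℝ) ≠ 0 := by exact_mod_cast (by omega : M ≠ 0)
    have hpi := Real.pi_pos
    refine Or.inl ⟨⟨j, hj⟩, Real.pi * M * d, ?_, ?_⟩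
    · rw [abs_mul, abs_of_nonneg (by positivity), hd', mul_assoc]
      nlinarith
    · rw [mul_div_cancel_left₀ _ (by positivity), hd]
      abel

/-- A smooth function and its low-degree Hermite interpolant differ by at most a multiple of the
slack of any dual certificate. -/
theorem exists_interpolant_close {M : ℕ} (hM : 1 ≤ M) {T : Finset UnitAddCircle}
    (hT : ∀ s ∈ T, ∀ t ∈ T, s ≠ t → 1 ≤ M * ‖s - t‖) (f : UnitAddCircle → ℂ) (w : T → ℂ) {R : ℝ}
    (hR : 1 ≤ R) (hf : ∀ t, ‖f t‖ ≤ 1) (hw : ‖w‖ ≤ R)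
    (hfw : ∀ (j : T) (x : ℝ), |x| ≤ Real.pi / 5 →
      ‖f (j + (x / (Real.pi * M) : ℝ)) - f j - w j * x‖ ≤ R ^ 2 * x ^ 2) :
    ∃ p, IsTrigPoly (2 * M - 1) p ∧ (∀ t, ‖p t‖ ≤ 10 * R) ∧
      ∀ (q : UnitAddCircle → ℂ),
        (∀ (j : T) (x : ℝ), |x| ≤ Real.pi / 5 →
          ‖q (j + (x / (Real.pi * M) : ℝ))‖ ≤ 1 - 0.1 * x ^ 2) →
        (∀ t, (∀ j ∈ T, 1 / 5 ≤ M * ‖t - j‖) → ‖q t‖ ≤ 0.95) →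
        ∀ t, ‖f t - p t‖ ≤ 220 * R ^ 2 * (1 - ‖q t‖) := by
  have hv : ‖fun j : T => f j‖ ≤ R :=
    (pi_norm_le_iff_of_nonneg (by linarith)).2 fun j => (hf j).trans hR
  obtain ⟨p, hp, hnear, hfar⟩ := exists_hermite hM hT (fun j => f j) w hv hw
  refine ⟨p, hp, fun t => ?_, fun q hq1 hq2 t => ?_⟩
  · rcases near_or_far hM T t with ⟨j, x, hx, rfl⟩ | h
    · have h1 := hnear j x hx
      have hx' := NodeFamily.abs_le_of_le_pi_div_five hx
      have h2 : ‖f j + w j * x‖ ≤ R + R * 0.63 := by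
        refine (norm_add_le _ _).trans (add_le_add ((hf j).trans hR) ?_)
        rw [norm_mul, Complex.norm_real, Real.norm_eq_abs]
        exact mul_le_mul ((norm_le_pi_norm w j).trans hw) hx' (abs_nonneg _) (by linarith)
      have h3 : x ^ 2 ≤ 0.63 ^ 2 := by
        rw [← sq_abs]; gcongr
      have h4 := norm_add_le (p (j + (x / (Real.pi * M) : ℝ)) - f j - w j * x) (f j + w j * x)
      rw [show p (j + (x / (Real.pi * M) : ℝ)) - f j - w j * x + (f j + w j * x)
        = p (j + (x / (Real.pi * M) : ℝ)) by ring] at h4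
      nlinarith
    · exact hfar t h
  · have hRR : R ≤ R ^ 2 := by nlinarith
    rcases near_or_far hM T t with ⟨j, x, hx, rfl⟩ | h
    · have h1 := hnear j x hx
      have h2 := hfw j x hx
      have h3 := hq1 j x hx
      have h4 := norm_sub_le (f (j + (x / (Real.pi * M) : ℝ)) - f j - w j * x)
        (p (j + (x / (Real.pi * M) : ℝ)) - f j - w j * x)
      rw [sub_sub_sub_cancel_right, sub_sub_sub_cancel_right] at h4
      have h5 : ‖f (j + (x / (Real.pi * M) : ℝ)) - p (j + (x / (Real.pi * M) : ℝ))‖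
          ≤ 4 * R ^ 2 * x ^ 2 := by nlinarith [sq_nonneg x]
      have h6 : 0.1 * x ^ 2 ≤ 1 - ‖q (j + (x / (Real.pi * M) : ℝ))‖ := by linarith
      have h7 : 220 * R ^ 2 * (0.1 * x ^ 2) ≤
          220 * R ^ 2 * (1 - ‖q (j + (x / (Real.pi * M) : ℝ))‖) := by gcongr
      nlinarith [mul_nonneg (sq_nonneg R) (sq_nonneg x)]
    · have h1 := hfar t h
      have h2 := hq2 t h
      have h4 := norm_sub_le (f t) (p t)
      have h5 := hf t
      -- The constant 220 is set here: away from `T` the difference is at most `1 + 10 R ≤ 11 R²`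
      -- and the slack is at least 0.05. Near `T` only `40 R²` would be needed.
      have h7 : 220 * R ^ 2 * 0.05 ≤ 220 * R ^ 2 * (1 - ‖q t‖) := by gcongr; linarith
      nlinarith

/-! ### The Fejér kernel and Bernstein's inequality -/

lemma integral_fourier (k : ℤ) : ∫ t : UnitAddCircle, fourier k t = if k = 0 then 1 else 0 := by
  have h := congrFun (fourierCoeff_fourier (T := 1) k) 0
  rw [fourierCoeff] at h
  simp only [neg_zero, fourier_zero, one_smul] at h
  rw [AddCircle.volume_eq_smul_haarAddCircle, ENNReal.ofReal_one, one_smul, h, Pi.single_apply]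
  simp [eq_comm]

lemma fourier_sub_eq (k : ℤ) (s t : UnitAddCircle) :
    fourier k (t - s) = fourier k t * fourier (-k) s := by
  rw [fourier_apply, fourier_apply, fourier_apply, sub_eq_add_neg, smul_add, AddCircle.toCircle_add,
    Circle.coe_mul, smul_neg, neg_smul]

lemma norm_fourier_apply (k : ℤ) (t : UnitAddCircle) : ‖fourier k t‖ = 1 := by
  rw [fourier_apply]
  exact Circle.norm_coe _

lemma integrable_of_continuous {f : UnitAddCircle → ℂ} (hf : Continuous f) : Integrable f := by
  have := hf.continuousOn.integrableOn_compact (μ := (volume : Measure UnitAddCircle)) isCompact_univ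
  rwa [integrableOn_univ] at this

lemma Icc_neg_succ (n : ℕ) : Finset.Icc (-((n + 1 : ℕ) : ℤ)) ((n + 1 : ℕ) : ℤ) =
    insert ((n : ℤ) + 1) (insert (-((n : ℤ) + 1)) (Finset.Icc (-(n : ℤ)) n)) := by
  ext k
  simp only [Finset.mem_Icc, Finset.mem_insert]
  push_cast
  omega

lemma sum_Icc_neg_succ (n : ℕ) (g : ℤ → ℂ) :
    ∑ k ∈ Finset.Icc (-((n + 1 : ℕ) : ℤ)) ((n + 1 : ℕ) : ℤ), g k =
      g (n + 1) + (g (-(n + 1)) + ∑ k ∈ Finset.Icc (-(n : ℤ)) n, g k) := by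
  rw [Icc_neg_succ, Finset.sum_insert, Finset.sum_insert]
  · simp only [Finset.mem_Icc]; omega
  · simp only [Finset.mem_Icc, Finset.mem_insert]; omega

lemma sum_Icc_neg_eq (n : ℕ) (g : ℤ → ℂ) :
    ∑ k ∈ Finset.Icc (-(n : ℤ)) n, g k =
      ∑ k ∈ Finset.range (n + 1), g k + ∑ k ∈ Finset.range n, g (-(k + 1)) := by
  induction n with
  | zero => simp
  | succ n ih =>
    rw [sum_Icc_neg_succ, ih, Finset.sum_range_succ (fun k : ℕ => g k) (n + 1),
      Finset.sum_range_succ (fun k : ℕ => g (-(k + 1))) n]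
    push_cast
    ring

/-- The difference `m` arises from `n + 1 - |m|` pairs. In the induction, enlarging the square adds
each frequency of modulus at most `n + 1` exactly once. -/
lemma sum_range_sub_eq (n : ℕ) (e : ℤ → ℂ) :
    ∑ k ∈ Finset.range (n + 1), ∑ l ∈ Finset.range (n + 1), e ((k : ℤ) - l) =
      ∑ k ∈ Finset.Icc (-(n : ℤ)) n, ((n : ℂ) + 1 - ((|k| : ℤ) : ℂ)) * e k := by
  induction n with
  | zero => simp
  | succ n ih =>
    have h1 : ∑ k ∈ Finset.Icc (-((n + 1 : ℕ) : ℤ)) ((n + 1 : ℕ) : ℤ),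
        (((n + 1 : ℕ) : ℂ) + 1 - ((|k| : ℤ) : ℂ)) * e k
        = ∑ k ∈ Finset.Icc (-((n + 1 : ℕ) : ℤ)) ((n + 1 : ℕ) : ℤ), e k
          + ∑ k ∈ Finset.Icc (-(n : ℤ)) n, ((n : ℂ) + 1 - ((|k| : ℤ) : ℂ)) * e k := by
      have h2 : ∑ k ∈ Finset.Icc (-(n : ℤ)) n, ((n : ℂ) + 1 - ((|k| : ℤ) : ℂ)) * e k
          = ∑ k ∈ Finset.Icc (-((n + 1 : ℕ) : ℤ)) ((n + 1 : ℕ) : ℤ),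
            ((n : ℂ) + 1 - ((|k| : ℤ) : ℂ)) * e k := by
        rw [sum_Icc_neg_succ, abs_neg, abs_of_nonneg (by positivity)]
        push_cast; ring
      rw [h2, ← Finset.sum_add_distrib]
      exact Finset.sum_congr rfl fun k _ => by push_cast; ring
    rw [h1, ← ih, sum_Icc_neg_eq (n + 1), Finset.sum_range_succ]
    simp_rw [Finset.sum_range_succ (fun l => e (((_ : ℕ) : ℤ) - l)) (n + 1)]
    rw [Finset.sum_add_distrib]
    have h3 : ∑ x ∈ Finset.range (n + 1), e ((x : ℤ) - ((n + 1 : ℕ) : ℤ))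
        = ∑ k ∈ Finset.range (n + 1), e (-(k + 1)) := by
      rw [← Finset.sum_range_reflect]
      refine Finset.sum_congr rfl fun k hk => ?_
      rw [Finset.mem_range] at hk
      congr 1; omega
    have h4 : ∑ l ∈ Finset.range (n + 1), e (((n + 1 : ℕ) : ℤ) - l) + e (((n + 1 : ℕ) : ℤ) - ((n + 1 : ℕ) : ℤ))
        = ∑ k ∈ Finset.range (n + 1 + 1), e k := by
      rw [← Finset.sum_range_succ (fun l : ℕ => e (((n + 1 : ℕ) : ℤ) - l)),
        ← Finset.sum_range_reflect]
      refine Finset.sum_congr rfl fun k hk => ?_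
      rw [Finset.mem_range] at hk
      congr 1; omega
    rw [h3, h4]
    ring

lemma fejerKernel_eq (f : ℕ) (t : UnitAddCircle) :
    fejerKernel f t = ((1 / (f + 1) * squareKernel (f + 1) t : ℝ) : ℂ) := by
  rw [Complex.ofReal_mul, squareKernel_eq_sum, sum_range_sub_eq f (fun k => fourier k t),
    fejerKernel]
  push_cast; rfl

lemma continuous_fejerKernel (f : ℕ) : Continuous (fejerKernel f) := by
  unfold fejerKernel; fun_prop

/-- The kernel is nonnegative, being a normalized square, so its L¹ norm is its zeroth Fourier
coefficient. -/
lemma integral_norm_fejerKernel (f : ℕ) : ∫ t, ‖fejerKernel f t‖ = 1 := by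
  have h1 : ∀ t, ((‖fejerKernel f t‖ : ℝ) : ℂ) = fejerKernel f t := fun t => by
    rw [fejerKernel_eq, Complex.norm_real, Real.norm_of_nonneg]
    unfold squareKernel; positivity
  have h2 : ∫ t, fejerKernel f t = 1 := by
    have hf0 : (f : ℂ) + 1 ≠ 0 := by exact_mod_cast Nat.succ_ne_zero f
    simp only [fejerKernel]
    rw [integral_const_mul, integral_finsetSum _ fun k _ => integrable_of_continuous (by fun_prop)]
    simp_rw [integral_const_mul, integral_fourier]
    rw [Finset.sum_eq_single 0]
    · simp [hf0]
    · intro k _ hk; simp [hk]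
    · intro h; simp at h
  have h3 : ((∫ t, ‖fejerKernel f t‖ : ℝ) : ℂ) = 1 := by
    rw [← integral_complex_ofReal, ← h2]
    exact integral_congr_ae (Filter.Eventually.of_forall h1)
  exact_mod_cast h3

/-- The kernel reproducing the derivatives of trigonometric polynomials of degree at most `f`. -/
def derivKernel (f : ℕ) (t : UnitAddCircle) : ℂ :=
  2 * Real.pi * Complex.I * (f + 1) *
    (fejerKernel f t * (fourier (f + 1) t - fourier (-(f + 1)) t))

lemma continuous_derivKernel (f : ℕ) : Continuous (derivKernel f) := by
  have := continuous_fejerKernel f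
  unfold derivKernel; fun_prop

lemma norm_derivKernel_le (f : ℕ) (t : UnitAddCircle) :
    ‖derivKernel f t‖ ≤ 4 * Real.pi * (f + 1) * ‖fejerKernel f t‖ := by
  have h1 : ‖(2 * Real.pi * Complex.I * (f + 1) : ℂ)‖ = 2 * Real.pi * (f + 1) := by
    have : ‖(f : ℂ) + 1‖ = f + 1 := by
      exact_mod_cast Complex.norm_natCast (f + 1)
    simp [this, abs_of_pos Real.pi_pos]
  have h2 : ‖fourier ((f : ℤ) + 1) t - fourier (-((f : ℤ) + 1)) t‖ ≤ 2 := by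
    refine (norm_sub_le _ _).trans_eq ?_
    rw [norm_fourier_apply, norm_fourier_apply]
    norm_num
  rw [derivKernel, norm_mul (2 * Real.pi * Complex.I * (f + 1) : ℂ), h1, norm_mul]
  have := mul_le_mul_of_nonneg_left h2 (norm_nonneg (fejerKernel f t))
  have h3 : 0 ≤ 2 * Real.pi * ((f : ℝ) + 1) := by have := Real.pi_pos; positivity
  nlinarith

lemma integral_fourier_mul_sub (k j : ℤ) (t : UnitAddCircle) :
    ∫ s, fourier k s * fourier j (t - s) = if k = j then fourier k t else 0 := by
  have : ∀ s, fourier k s * fourier j (t - s) = fourier j t * fourier (k - j) s := fun s => by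
    rw [fourier_sub_eq, sub_eq_add_neg k, fourier_add]; ring
  simp_rw [this, integral_const_mul, integral_fourier, sub_eq_zero]
  split_ifs with h <;> simp [h]

lemma derivKernel_eq_sum (f : ℕ) (t : UnitAddCircle) :
    derivKernel f t = 2 * Real.pi * Complex.I * ∑ m ∈ Finset.Icc (-(f : ℤ)) f,
      ((f : ℂ) + 1 - ((|m| : ℤ) : ℂ)) * (fourier (m + (f + 1)) t - fourier (m + -(f + 1)) t) := by
  have hf0 : (f : ℂ) + 1 ≠ 0 := by exact_mod_cast Nat.succ_ne_zero f
  rw [derivKernel, fejerKernel, Finset.mul_sum, Finset.sum_mul, Finset.mul_sum, Finset.mul_sum]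
  refine Finset.sum_congr rfl fun m _ => ?_
  rw [fourier_add (m := m) (n := f + 1), fourier_add (m := m) (n := -(f + 1))]
  field_simp

/-- Shifting the triangular Fejér coefficients by `±(f + 1)` and subtracting gives coefficients
exactly `k` for `|k| ≤ f`: one ramp of each triangle survives in this range. The kernel therefore
differentiates, with L¹ norm at most `4π(f + 1)`. -/
lemma integral_fourier_mul_derivKernel {f : ℕ} {k : ℤ} (hk : k ∈ Finset.Icc (-(f : ℤ)) f)
    (t : UnitAddCircle) :
    ∫ s, fourier k s * derivKernel f (t - s) = 2 * Real.pi * Complex.I * k * fourier k t := by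
  have e : ∀ s, fourier k s * derivKernel f (t - s) = 2 * Real.pi * Complex.I *
      ∑ m ∈ Finset.Icc (-(f : ℤ)) f, ((f : ℂ) + 1 - ((|m| : ℤ) : ℂ)) *
        (fourier k s * fourier (m + (f + 1)) (t - s)
          - fourier k s * fourier (m + -(f + 1)) (t - s)) := fun s => by
    rw [derivKernel_eq_sum, mul_left_comm, Finset.mul_sum]
    congr 1
    exact Finset.sum_congr rfl fun m _ => by ring
  have hi : ∀ j : ℤ, Integrable fun s => fourier k s * fourier j (t - s) := fun j =>
    integrable_of_continuous (by fun_prop)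
  have hd : ∀ m : ℤ, Integrable fun s => fourier k s * fourier (m + (f + 1)) (t - s)
      - fourier k s * fourier (m + -(f + 1)) (t - s) := fun m => (hi _).sub (hi _)
  simp_rw [e]
  rw [integral_const_mul, integral_finsetSum _ fun m _ => (hd m).const_mul _]
  simp_rw [integral_const_mul]
  rw [mul_assoc (2 * (Real.pi : ℂ) * Complex.I)]
  congr 1
  have e2 : ∀ m : ℤ, ∫ s, (fourier k s * fourier (m + (f + 1)) (t - s)
      - fourier k s * fourier (m + -(f + 1)) (t - s))
      = (if k = m + (f + 1) then fourier k t else 0)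
        - (if k = m + -(f + 1) then fourier k t else 0) := fun m => by
    rw [integral_sub (hi _) (hi _), integral_fourier_mul_sub, integral_fourier_mul_sub]
  simp_rw [e2]
  rw [Finset.mem_Icc] at hk
  rcases lt_trichotomy k 0 with h | h | h
  · rw [Finset.sum_eq_single (k + (f + 1))]
    · rw [if_neg (by omega), if_pos (by omega), abs_of_nonneg (by omega)]
      push_cast; ring
    · intro m hm hne
      rw [Finset.mem_Icc] at hm
      rw [if_neg (by omega), if_neg (by omega)]; ring
    · intro hm
      rw [Finset.mem_Icc] at hm; omega
  · subst h
    rw [Finset.sum_eq_zero]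
    · simp
    · intro m hm
      rw [Finset.mem_Icc] at hm
      rw [if_neg (by omega), if_neg (by omega)]; ring
  · rw [Finset.sum_eq_single (k - (f + 1))]
    · rw [if_pos (by omega), if_neg (by omega), abs_of_nonpos (by omega)]
      push_cast; ring
    · intro m hm hne
      rw [Finset.mem_Icc] at hm
      rw [if_neg (by omega), if_neg (by omega)]; ring
    · intro hm
      rw [Finset.mem_Icc] at hm; omega

/-- **Bernstein's inequality** (with a non-optimal constant). -/
lemma bernstein {f : ℕ} (c : ℤ → ℂ) {B : ℝ}
    (hB : ∀ t : UnitAddCircle, ‖∑ k ∈ Finset.Icc (-(f : ℤ)) f, c k * fourier k t‖ ≤ B)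
    (t : UnitAddCircle) :
    ‖∑ k ∈ Finset.Icc (-(f : ℤ)) f, (2 * Real.pi * Complex.I * k * c k) * fourier k t‖
      ≤ 4 * Real.pi * (f + 1) * B := by
  have hcont := continuous_derivKernel f
  have e : ∑ k ∈ Finset.Icc (-(f : ℤ)) f, (2 * Real.pi * Complex.I * k * c k) * fourier k t
      = ∫ s, (∑ k ∈ Finset.Icc (-(f : ℤ)) f, c k * fourier k s) * derivKernel f (t - s) := by
    have e1 : ∀ s, (∑ k ∈ Finset.Icc (-(f : ℤ)) f, c k * fourier k s) * derivKernel f (t - s)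
        = ∑ k ∈ Finset.Icc (-(f : ℤ)) f, c k * (fourier k s * derivKernel f (t - s)) := fun s => by
      rw [Finset.sum_mul]
      exact Finset.sum_congr rfl fun k _ => by ring
    simp_rw [e1]
    rw [integral_finsetSum _ fun k _ => integrable_of_continuous (by fun_prop)]
    refine Finset.sum_congr rfl fun k hk => ?_
    rw [integral_const_mul, integral_fourier_mul_derivKernel hk]
    ring
  have hB0 : 0 ≤ B := (norm_nonneg _).trans (hB 0)
  have hF : Integrable fun s => ‖fejerKernel f (t - s)‖ :=
    (integrable_of_continuous (by have := continuous_fejerKernel f; fun_prop)).norm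
  rw [e]
  refine (norm_integral_le_of_norm_le (hF.const_mul (4 * Real.pi * (f + 1) * B))
    (Filter.Eventually.of_forall fun s => ?_)).trans_eq ?_
  · rw [norm_mul]
    calc _ ≤ B * (4 * Real.pi * (f + 1) * ‖fejerKernel f (t - s)‖) :=
          mul_le_mul (hB s) (norm_derivKernel_le f _) (norm_nonneg _) hB0
      _ = _ := by ring
  · rw [integral_const_mul, integral_sub_left_eq_self (fun s => ‖fejerKernel f s‖),
      integral_norm_fejerKernel, mul_one]

lemma hasDerivAt_trigPoly (f : ℕ) (c : ℤ → ℂ) (t : UnitAddCircle) (x : ℝ) :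
    HasDerivAt (fun x : ℝ => ∑ k ∈ Finset.Icc (-(f : ℤ)) f, c k * fourier k (t + (x : UnitAddCircle)))
      (∑ k ∈ Finset.Icc (-(f : ℤ)) f, (2 * Real.pi * Complex.I * k * c k) * fourier k (t + (x : UnitAddCircle))) x := by
  refine HasDerivAt.fun_sum fun k _ => ?_
  have h := ((hasDerivAt_fourier 1 k x).const_mul (c k * fourier k t))
  have e : ∀ y : ℝ, fourier k (t + (y : UnitAddCircle)) = fourier k t * fourier k (y : UnitAddCircle) := fun y => by
    rw [fourier_apply, fourier_apply, fourier_apply, smul_add, AddCircle.toCircle_add,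
      Circle.coe_mul]
  simp_rw [e]
  refine (h.congr_deriv ?_).congr_of_eventuallyEq (Filter.Eventually.of_forall fun y => ?_)
  · simp only [Complex.ofReal_one, div_one]; ring
  · ring

/-- A bounded trigonometric polynomial of degree `f` is close, up to a multiple of the slack of any
dual certificate, to a trigonometric polynomial of low degree. -/
theorem IsTrigPoly.exists_low_degree {M f : ℕ} (hM : 1 ≤ M) (hMf : M ≤ f) {T : Finset UnitAddCircle}
    (hT : ∀ s ∈ T, ∀ t ∈ T, s ≠ t → 1 ≤ M * ‖s - t‖) {g : UnitAddCircle → ℂ}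
    (hg : IsTrigPoly f g) (hg1 : ∀ t, ‖g t‖ ≤ 1) :
    ∃ p, IsTrigPoly (2 * M - 1) p ∧ (∀ t, ‖p t‖ ≤ 10 * (8 * f / M)) ∧
      ∀ (q : UnitAddCircle → ℂ),
        (∀ (j : T) (x : ℝ), |x| ≤ Real.pi / 5 →
          ‖q (j + (x / (Real.pi * M) : ℝ))‖ ≤ 1 - 0.1 * x ^ 2) →
        (∀ t, (∀ j ∈ T, 1 / 5 ≤ M * ‖t - j‖) → ‖q t‖ ≤ 0.95) →
        ∀ t, ‖g t - p t‖ ≤ 220 * (8 * f / M) ^ 2 * (1 - ‖q t‖) := by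
  obtain ⟨c, hc⟩ := hg
  have hpi := Real.pi_pos
  have hM' : (1 : ℝ) ≤ M := by exact_mod_cast hM
  have hMf' : (M : ℝ) ≤ f := by exact_mod_cast hMf
  have hM0 : (0 : ℝ) < M := by linarith
  set L : ℝ := 4 * Real.pi * (f + 1) with hL
  set c1 : ℤ → ℂ := fun k => 2 * Real.pi * Complex.I * k * c k with hc1
  have hb1 : ∀ t : UnitAddCircle, ‖∑ k ∈ Finset.Icc (-(f : ℤ)) f, c1 k * fourier k t‖ ≤ L := by
    intro t
    have := bernstein c (f := f) (B := 1) (fun t => by rw [← hc]; exact hg1 t) t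
    rwa [mul_one] at this
  have hb2 := bernstein c1 (f := f) (B := L) hb1
  set D : UnitAddCircle → ℂ := fun t => ∑ k ∈ Finset.Icc (-(f : ℤ)) f, c1 k * fourier k t with hD
  -- The left side is `4 (f + 1) / M`, and `f + 1 ≤ 2 f`.
  have hLM : L / (Real.pi * M) ≤ 8 * f / M := by
    rw [hL, div_le_div_iff₀ (by positivity) hM0]
    have : (0 : ℝ) ≤ Real.pi * M * (f - 1) := by
      have : (1 : ℝ) ≤ f := by linarith
      have := sub_nonneg.2 this
      positivity
    nlinarith
  have hR1 : 1 ≤ 8 * (f : ℝ) / M := by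
    rw [le_div_iff₀ hM0]; linarith
  -- Local coordinates are rescaled by `πM`, so the derivative to be interpolated is divided by it.
  refine exists_interpolant_close hM hT g (fun j => D j / (Real.pi * M)) hR1 hg1 ?_ ?_
  · refine (pi_norm_le_iff_of_nonneg (by positivity)).2 fun j => ?_
    rw [norm_div]
    have : ‖(Real.pi * M : ℂ)‖ = Real.pi * M := by
      rw [norm_mul, Complex.norm_real, Real.norm_of_nonneg hpi.le, Complex.norm_natCast]
    rw [this]
    exact (div_le_div_of_nonneg_right (hb1 j) (by positivity)).trans hLM
  · intro j x _
    have key := norm_taylor_one_le (x₀ := 0) (h := x / (Real.pi * M)) (C := L * L)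
      (f := fun x : ℝ => ∑ k ∈ Finset.Icc (-(f : ℤ)) f, c k * fourier k ((j : UnitAddCircle) + (x : UnitAddCircle)))
      (fun x _ => hasDerivAt_trigPoly f c j x) (fun x _ => hasDerivAt_trigPoly f c1 j x)
      (fun x _ => hb2 _)
    simp only [zero_add, ← hc, AddCircle.coe_zero, add_zero] at key
    have e : g (j + (x / (Real.pi * M) : ℝ)) - g j - D j / (Real.pi * M) * x
        = g (j + (x / (Real.pi * M) : ℝ)) - g j - (x / (Real.pi * M)) •
          ∑ k ∈ Finset.Icc (-(f : ℤ)) f, (2 * Real.pi * Complex.I * k * c k) * fourier k (j : UnitAddCircle) := by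
      rw [Complex.real_smul]
      simp only [hD, hc1]
      push_cast; ring
    rw [e]
    refine key.trans ?_
    have h2 : (L / (Real.pi * M)) ^ 2 ≤ (8 * f / M) ^ 2 := by gcongr
    have h3 : L * L * (x / (Real.pi * M)) ^ 2 / 2 = (L / (Real.pi * M)) ^ 2 * x ^ 2 / 2 := by
      field_simp
    rw [h3]
    nlinarith [sq_nonneg x, mul_le_mul_of_nonneg_right h2 (sq_nonneg x), sq_nonneg (L / (Real.pi * M)), mul_nonneg (sq_nonneg (L / (Real.pi * M))) (sq_nonneg x)]

/-! ### Integration against complex measures on the circle -/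

lemma continuous_integrable_variation {μ : ComplexMeasure UnitAddCircle}
    [IsFiniteMeasure μ.variation] {f : UnitAddCircle → ℂ} (hf : Continuous f) :
    Integrable f μ.variation := by
  have := hf.continuousOn.integrableOn_compact (μ := μ.variation) isCompact_univ
  rwa [integrableOn_univ] at this

lemma cintegral_const_mul (μ : ComplexMeasure UnitAddCircle) (c : ℂ) (f : UnitAddCircle → ℂ) :
    cintegral μ (fun t => c * f t) = c * cintegral μ f := by
  unfold cintegral
  rw [VectorMeasure.integral_eq_setToFun, VectorMeasure.integral_eq_setToFun]
  -- The pairing is only declared real-bilinear; complex homogeneity has to be checked on the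
  -- underlying set function.
  refine setToFun_smul (𝕜 := ℂ) _ (fun c s x => ?_) c f
  change (c * x) * μ s = c * (x * μ s)
  ring

lemma norm_cintegral_le (μ : ComplexMeasure UnitAddCircle) (f : UnitAddCircle → ℂ) :
    ‖cintegral μ f‖ ≤ ∫ t, ‖f t‖ ∂μ.variation := by
  refine VectorMeasure.norm_integral_le_integral_norm.trans ?_
  rw [ContinuousLinearMap.opNorm_mul, one_mul]

lemma cintegral_add {μ : ComplexMeasure UnitAddCircle} {f g : UnitAddCircle → ℂ}
    (hf : Integrable f μ.variation) (hg : Integrable g μ.variation) :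
    cintegral μ (fun t => f t + g t) = cintegral μ f + cintegral μ g :=
  VectorMeasure.integral_fun_add hf hg

lemma cintegral_finset_sum {ι : Type*} {μ : ComplexMeasure UnitAddCircle} (s : Finset ι)
    {f : ι → UnitAddCircle → ℂ} (hf : ∀ i ∈ s, Integrable (f i) μ.variation) :
    cintegral μ (fun t => ∑ i ∈ s, f i t) = ∑ i ∈ s, cintegral μ (f i) :=
  VectorMeasure.integral_finsetSum s hf

lemma cintegral_fourier (μ : ComplexMeasure UnitAddCircle) (k : ℤ) :
    cintegral μ (fun t => fourier k t) = fourierCoeffMeasure μ (-k) := by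
  rw [fourierCoeffMeasure, neg_neg]

lemma cintegral_trigPoly (μ : ComplexMeasure UnitAddCircle) [IsFiniteMeasure μ.variation]
    (s : Finset ℤ) (c : ℤ → ℂ) :
    cintegral μ (fun t => ∑ k ∈ s, c k * fourier k t)
      = ∑ k ∈ s, c k * fourierCoeffMeasure μ (-k) := by
  rw [cintegral_finset_sum s fun k _ => continuous_integrable_variation (by fun_prop)]
  exact Finset.sum_congr rfl fun k _ => by rw [cintegral_const_mul, cintegral_fourier]

lemma conv_trigPoly (μ : ComplexMeasure UnitAddCircle) [IsFiniteMeasure μ.variation]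
    (s : Finset ℤ) (c : ℤ → ℂ) (t : UnitAddCircle) :
    conv (fun t => ∑ k ∈ s, c k * fourier k t) μ t
      = ∑ k ∈ s, c k * fourierCoeffMeasure μ k * fourier k t := by
  rw [conv, cintegral_finset_sum s fun k _ => continuous_integrable_variation (by fun_prop)]
  refine Finset.sum_congr rfl fun k _ => ?_
  simp_rw [fourier_sub_eq, ← mul_assoc]
  rw [cintegral_const_mul, fourierCoeffMeasure]
  ring

lemma lowPass_eq (μ : ComplexMeasure UnitAddCircle) [IsFiniteMeasure μ.variation] (f : ℕ)
    (t : UnitAddCircle) : lowPass f μ t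
      = ∑ k ∈ Finset.Icc (-(f : ℤ)) f, fourierCoeffMeasure μ k * fourier k t := by
  have := conv_trigPoly μ (Finset.Icc (-(f : ℤ)) f) 1 t
  simp only [Pi.one_apply, one_mul] at this
  exact this

lemma continuous_lowPass (μ : ComplexMeasure UnitAddCircle) [IsFiniteMeasure μ.variation] (f : ℕ) :
    Continuous (lowPass f μ) := by
  rw [funext (lowPass_eq μ f)]; fun_prop

lemma fourierCoeffMeasure_sub (μ ν : ComplexMeasure UnitAddCircle) [IsFiniteMeasure μ.variation]
    [IsFiniteMeasure ν.variation] (k : ℤ) :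
    fourierCoeffMeasure (μ - ν) k = fourierCoeffMeasure μ k - fourierCoeffMeasure ν k :=
  VectorMeasure.integral_sub_vectorMeasure
    (continuous_integrable_variation (map_continuous (fourier (-k))))
    (continuous_integrable_variation (map_continuous (fourier (-k))))

lemma isFiniteMeasure_variation_sub (μ ν : ComplexMeasure UnitAddCircle)
    [IsFiniteMeasure μ.variation] [IsFiniteMeasure ν.variation] :
    IsFiniteMeasure (μ - ν).variation :=
  isFiniteMeasure_of_le _ VectorMeasure.variation_sub_le

lemma lowPass_sub (μ ν : ComplexMeasure UnitAddCircle) [IsFiniteMeasure μ.variation]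
    [IsFiniteMeasure ν.variation] (f : ℕ) (t : UnitAddCircle) :
    lowPass f (μ - ν) t = lowPass f μ t - lowPass f ν t := by
  have := isFiniteMeasure_variation_sub μ ν
  simp_rw [lowPass_eq, fourierCoeffMeasure_sub, sub_mul, Finset.sum_sub_distrib]

/-- Pairing a measure with a trigonometric polynomial of degree `≤ f` only sees its low-pass
part. -/
lemma cintegral_eq_integral_mul_lowPass (μ : ComplexMeasure UnitAddCircle)
    [IsFiniteMeasure μ.variation] {f : ℕ} {p : UnitAddCircle → ℂ} (hp : IsTrigPoly f p) :
    cintegral μ p = ∫ t, p t * lowPass f μ t := by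
  obtain ⟨c, hc⟩ := hp
  rw [funext hc, cintegral_trigPoly]
  simp_rw [Finset.sum_mul]
  have hcont := continuous_lowPass μ f
  rw [integral_finsetSum _ fun k _ => integrable_of_continuous (by fun_prop)]
  refine Finset.sum_congr rfl fun k hk => ?_
  simp_rw [mul_assoc, integral_const_mul, lowPass_eq, Finset.mul_sum]
  rw [integral_finsetSum _ fun j _ => integrable_of_continuous (by fun_prop),
    Finset.sum_eq_single (-k)]
  · have : ∀ t : UnitAddCircle, fourier k t * (fourierCoeffMeasure μ (-k) * fourier (-k) t)
        = fourierCoeffMeasure μ (-k) * fourier 0 t := fun t => by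
      rw [← add_neg_cancel k, fourier_add]; ring
    simp_rw [this, integral_const_mul, integral_fourier]
    simp
  · intro j _ hj
    have : ∀ t : UnitAddCircle, fourier k t * (fourierCoeffMeasure μ j * fourier j t)
        = fourierCoeffMeasure μ j * fourier (k + j) t := fun t => by
      rw [fourier_add]; ring
    simp_rw [this, integral_const_mul, integral_fourier]
    rw [if_neg (by omega), mul_zero]
  · intro h
    rw [Finset.mem_Icc] at hk h
    omega

lemma norm_cintegral_trigPoly_le (μ : ComplexMeasure UnitAddCircle) [IsFiniteMeasure μ.variation]
    {f : ℕ} {p : UnitAddCircle → ℂ} (hp : IsTrigPoly f p) {B : ℝ} (hB : ∀ t, ‖p t‖ ≤ B) :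
    ‖cintegral μ p‖ ≤ B * ∫ t, ‖lowPass f μ t‖ := by
  rw [cintegral_eq_integral_mul_lowPass μ hp, ← integral_const_mul]
  have hcont := continuous_lowPass μ f
  have hp' := hp.continuous
  refine (norm_integral_le_integral_norm _).trans (integral_mono ?_ ?_ fun t => ?_)
  · exact (integrable_of_continuous (by fun_prop)).norm
  · exact (integrable_of_continuous hcont).norm.const_mul B
  · rw [norm_mul]
    exact mul_le_mul_of_nonneg_right (hB t) (norm_nonneg _)

lemma ofReal_integral_norm_eq_eLpNorm_one {f : UnitAddCircle → ℂ} (hf : Continuous f) :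
    ENNReal.ofReal (∫ t, ‖f t‖) = eLpNorm f 1 volume := by
  rw [eLpNorm_one_eq_lintegral_enorm, ofReal_integral_norm_eq_lintegral_enorm
    (integrable_of_continuous hf)]

/-- Triangle inequality through `y`; the circle has mass one, so the L¹ norm is at most the L² norm.
-/
lemma integral_norm_lowPass_sub_le {flo : ℕ} {y : UnitAddCircle → ℂ} (hy : Continuous y) {δ : ℝ}
    (hδ : 0 ≤ δ) {μ ν : ComplexMeasure UnitAddCircle} [IsFiniteMeasure μ.variation]
    [IsFiniteMeasure ν.variation] (hμ : IsFeasible flo y δ μ) (hν : IsFeasible flo y δ ν) :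
    ∫ t, ‖lowPass flo (μ - ν) t‖ ≤ 2 * δ := by
  have := isFiniteMeasure_variation_sub μ ν
  have hcμ := continuous_lowPass μ flo
  have hcν := continuous_lowPass ν flo
  rw [← ENNReal.ofReal_le_ofReal_iff (by positivity), ofReal_integral_norm_eq_eLpNorm_one
    (continuous_lowPass _ _)]
  have h1 : lowPass flo (μ - ν) = (fun t => lowPass flo μ t - y t) - fun t => lowPass flo ν t - y t := by
    ext t
    rw [lowPass_sub, Pi.sub_apply]; ring
  have : IsProbabilityMeasure (volume : Measure UnitAddCircle) := ⟨by simp⟩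
  calc eLpNorm (lowPass flo (μ - ν)) 1 volume
      ≤ eLpNorm (lowPass flo (μ - ν)) 2 volume :=
        eLpNorm_le_eLpNorm_of_exponent_le (by norm_num)
          (continuous_lowPass _ _).aestronglyMeasurable
    _ ≤ eLpNorm (fun t => lowPass flo μ t - y t) 2 volume
        + eLpNorm (fun t => lowPass flo ν t - y t) 2 volume := by
        rw [h1]
        exact eLpNorm_sub_le (hcμ.sub hy).aestronglyMeasurable (hcν.sub hy).aestronglyMeasurable
          (by norm_num)
    _ ≤ ENNReal.ofReal δ + ENNReal.ofReal δ := add_le_add hμ hν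
    _ = ENNReal.ofReal (2 * δ) := by rw [← ENNReal.ofReal_add hδ hδ, two_mul]

/-- Duality: the `L¹` norm of `K_hi * μ` is attained on trigonometric polynomials of degree `f`
bounded by `1`. -/
lemma exists_trigPoly_integral_norm_conv_fejerKernel_le (μ : ComplexMeasure UnitAddCircle)
    [IsFiniteMeasure μ.variation] (f : ℕ) :
    ∃ p, IsTrigPoly f p ∧ (∀ t, ‖p t‖ ≤ 1) ∧
      eLpNorm (conv (fejerKernel f) μ) 1 volume = ENNReal.ofReal ‖cintegral μ p‖ := by
  set s := Finset.Icc (-(f : ℤ)) f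
  set c : ℤ → ℂ := fun k => 1 / ((f : ℂ) + 1) * ((f : ℂ) + 1 - ((|k| : ℤ) : ℂ)) with hc
  have hK : fejerKernel f = fun t => ∑ k ∈ s, c k * fourier k t := by
    ext t
    rw [fejerKernel, Finset.mul_sum]
    exact Finset.sum_congr rfl fun k _ => by rw [hc]; ring
  have hw : ∀ t, conv (fejerKernel f) μ t = ∑ k ∈ s, c k * fourierCoeffMeasure μ k * fourier k t :=
    fun t => by rw [hK, conv_trigPoly]
  set w := conv (fejerKernel f) μ
  have hwc : Continuous w := by rw [funext hw]; fun_prop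
  -- The conjugate phase of `w`; division by zero makes it 0 where `w` vanishes, which is harmless.
  set g : UnitAddCircle → ℂ := fun t => starRingEnd ℂ (w t) / ‖w t‖ with hg
  have hgm : Measurable g := by
    have h1 : Continuous fun t => starRingEnd ℂ (w t) := Complex.continuous_conj.comp hwc
    have h2 : Continuous fun t => ((‖w t‖ : ℝ) : ℂ) := by fun_prop
    exact h1.measurable.div h2.measurable
  have hg1 : ∀ t, ‖g t‖ ≤ 1 := fun t => by
    rw [hg]; beta_reduce
    rw [norm_div, RCLike.norm_conj, Complex.norm_real, norm_norm]
    exact div_self_le_one _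
  have hgw : ∀ t, g t * w t = (‖w t‖ : ℝ) := fun t => by
    rw [hg]; beta_reduce
    rcases eq_or_ne (w t) 0 with h | h
    · simp [h]
    · have : ((‖w t‖ : ℝ) : ℂ) ≠ 0 := by simpa using h
      rw [div_mul_eq_mul_div, div_eq_iff this, mul_comm, Complex.mul_conj, Complex.normSq_eq_norm_sq]
      push_cast; ring
  have : IsProbabilityMeasure (volume : Measure UnitAddCircle) := ⟨by simp⟩
  have hgi : ∀ h : UnitAddCircle → ℂ, Continuous h → Integrable fun t => g t * h t := fun h hh =>
    (integrable_of_continuous hh).bdd_mul hgm.aestronglyMeasurable (Filter.Eventually.of_forall hg1)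
  -- Moving the convolution from the measure onto `g` gives the dual polynomial. The kernel limits
  -- its degree, and its unit L¹ norm gives the bound 1.
  set p : UnitAddCircle → ℂ := fun τ => ∫ t, g t * fejerKernel f (t - τ) with hp
  have hp' : ∀ τ, p τ = ∑ k ∈ s, c k * (∫ t, g t * fourier k t) * fourier (-k) τ := fun τ => by
    rw [hp, hK]; beta_reduce
    simp_rw [Finset.mul_sum]
    rw [integral_finsetSum _ fun k _ => hgi _ (by fun_prop)]
    refine Finset.sum_congr rfl fun k _ => ?_
    rw [show c k * (∫ t, g t * fourier k t) * fourier (-k) τ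
      = c k * fourier (-k) τ * ∫ t, g t * fourier k t by ring, ← integral_const_mul]
    congr 1; ext t
    rw [fourier_sub_eq]; ring
  refine ⟨p, ?_, fun τ => ?_, ?_⟩
  · refine (IsTrigPoly.sum s (f := fun k τ => c k * (∫ t, g t * fourier k t) * fourier (-k) τ)
      fun k hk => IsTrigPoly.monomial ?_ _).congr hp'
    rw [abs_neg, abs_le]
    rw [Finset.mem_Icc] at hk
    exact hk
  · rw [← integral_norm_fejerKernel f, ← integral_sub_right_eq_self _ τ]
    refine (norm_integral_le_integral_norm _).trans (integral_mono ?_ ?_ fun t => ?_)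
    · have := continuous_fejerKernel f
      exact (hgi _ (by fun_prop)).norm
    · have := continuous_fejerKernel f
      exact (integrable_of_continuous (f := fun t => fejerKernel f (t - τ)) (by fun_prop)).norm
    · beta_reduce
      rw [norm_mul]
      exact mul_le_of_le_one_left (norm_nonneg _) (hg1 t)
  · have h1 : cintegral μ p = ((∫ t, ‖w t‖ : ℝ) : ℂ) := by
      rw [← integral_complex_ofReal, funext hp', cintegral_finset_sum s
        fun k _ => continuous_integrable_variation (by fun_prop)]
      simp_rw [← hgw, hw, Finset.mul_sum]
      rw [integral_finsetSum _ fun k _ => hgi _ (by fun_prop)]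
      refine Finset.sum_congr rfl fun k _ => ?_
      rw [cintegral_const_mul, fourierCoeffMeasure, show
        c k * (∫ t, g t * fourier k t) * cintegral μ (fun t => fourier (-k) t)
        = c k * cintegral μ (fun t => fourier (-k) t) * (∫ t, g t * fourier k t) by ring,
        ← integral_const_mul]
      congr 1; ext t; ring
    rw [h1, Complex.norm_real, Real.norm_of_nonneg (integral_nonneg fun _ => norm_nonneg _),
      ofReal_integral_norm_eq_eLpNorm_one hwc]

/-! ### Stability of total-variation minimization -/

lemma variation_pointSources_le (a : UnitAddCircle →₀ ℂ) :
    (pointSources a).variation ≤ ∑ t ∈ a.support, (VectorMeasure.dirac t (a t)).variation :=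
  VectorMeasure.variation_finsetSum_le _ _

lemma tvNorm_pointSources_le (a : UnitAddCircle →₀ ℂ) :
    tvNorm (pointSources a) ≤ ENNReal.ofReal (∑ t ∈ a.support, ‖a t‖) := by
  refine (variation_pointSources_le a _).trans ?_
  rw [ENNReal.ofReal_sum_of_nonneg fun _ _ => norm_nonneg _, Measure.finsetSum_apply]
  refine Finset.sum_le_sum fun t _ => ?_
  simp [VectorMeasure.variation_dirac]

instance isFiniteMeasure_variation_pointSources (a : UnitAddCircle →₀ ℂ) :
    IsFiniteMeasure (pointSources a).variation :=
  ⟨(tvNorm_pointSources_le a).trans_lt ENNReal.ofReal_lt_top⟩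

lemma variation_pointSources_compl (a : UnitAddCircle →₀ ℂ) :
    (pointSources a).variation (a.support : Set UnitAddCircle)ᶜ = 0 := by
  refine le_antisymm ((variation_pointSources_le a _).trans ?_) (zero_le)
  rw [Measure.finsetSum_apply]
  refine (Finset.sum_eq_zero fun t ht => ?_).le
  have hm : MeasurableSet (a.support : Set UnitAddCircle)ᶜ :=
    a.support.measurableSet.compl
  simp [VectorMeasure.variation_dirac, ht, Measure.dirac_apply' _ hm]

lemma pointSources_singleton (a : UnitAddCircle →₀ ℂ) {t : UnitAddCircle} (ht : t ∈ a.support) :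
    pointSources a {t} = a t := by
  rw [pointSources, FunLike.coe_sum, Finset.sum_apply, Finset.sum_eq_single_of_mem t ht]
  · simp [VectorMeasure.dirac_apply_of_mem]
  · intro s _ hs
    simp [VectorMeasure.dirac_apply_of_notMem, hs]

/-- If the total variation does not increase, then the part of the difference off the support is
dominated by the part on the support. -/
lemma variation_sub_pointSources_compl_le (a : UnitAddCircle →₀ ℂ)
    {μ : ComplexMeasure UnitAddCircle} [IsFiniteMeasure μ.variation]
    (hμ : tvNorm μ ≤ tvNorm (pointSources a)) :
    (μ - pointSources a).variation.real (a.support : Set UnitAddCircle)ᶜ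
      ≤ ∑ t ∈ a.support, ‖(μ - pointSources a) {t}‖ := by
  have := isFiniteMeasure_variation_sub μ (pointSources a)
  have hm : MeasurableSet (a.support : Set UnitAddCircle) := a.support.measurableSet
  have h1 : (μ - pointSources a).variation.real (a.support : Set UnitAddCircle)ᶜ
      ≤ μ.variation.real (a.support : Set UnitAddCircle)ᶜ := by
    refine ENNReal.toReal_mono (measure_ne_top _ _) ?_
    refine (VectorMeasure.variation_sub_le (a.support : Set UnitAddCircle)ᶜ).trans ?_
    rw [Measure.add_apply, variation_pointSources_compl, add_zero]
  have h2 : μ.variation.real Set.univ ≤ ∑ t ∈ a.support, ‖a t‖ := by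
    refine ENNReal.toReal_le_of_le_ofReal (Finset.sum_nonneg fun _ _ => norm_nonneg _) ?_
    exact hμ.trans (tvNorm_pointSources_le a)
  have h3 : ∑ t ∈ a.support, ‖μ {t}‖ ≤ μ.variation.real a.support := by
    rw [← sum_measureReal_singleton]
    exact Finset.sum_le_sum fun t _ => VectorMeasure.norm_measure_le_variation
  have h4 := measureReal_add_measureReal_compl (μ := μ.variation) hm
  have h5 : ∑ t ∈ a.support, ‖a t‖ ≤ ∑ t ∈ a.support, ‖μ {t}‖
      + ∑ t ∈ a.support, ‖(μ - pointSources a) {t}‖ := by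
    rw [← Finset.sum_add_distrib]
    refine Finset.sum_le_sum fun t ht => ?_
    rw [sub_apply, pointSources_singleton a ht]
    have := norm_sub_le (μ {t}) (μ {t} - a t)
    rwa [sub_sub_cancel] at this
  -- With h the difference: |h|(Tᶜ) ≤ |μ|(Tᶜ) ≤ ∑ |a t| - |μ|(T) ≤ ∑ (|a t| - |μ{t}|) ≤ ∑ |h{t}|.
  linarith

lemma exists_norm_eq_one_mul_eq_norm (z : ℂ) : ∃ v : ℂ, ‖v‖ = 1 ∧ v * z = (‖z‖ : ℝ) := by
  rcases eq_or_ne z 0 with rfl | h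
  · exact ⟨1, by simp⟩
  · have h0 : ((‖z‖ : ℝ) : ℂ) ≠ 0 := by simpa using h
    refine ⟨starRingEnd ℂ z / ‖z‖, ?_, ?_⟩
    · rw [norm_div, RCLike.norm_conj, Complex.norm_real, norm_norm]
      exact div_self (by simpa using h)
    · rw [div_mul_eq_mul_div, div_eq_iff h0, mul_comm, Complex.mul_conj, Complex.normSq_eq_norm_sq]
      push_cast; ring

/-- If the dual certificate `q` interpolates the phases of the difference on the support, then the
deficit `1 - |q|` integrates to at most the pairing with `q`. -/
lemma integral_one_sub_norm_le (a : UnitAddCircle →₀ ℂ)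
    {μ : ComplexMeasure UnitAddCircle} [IsFiniteMeasure μ.variation]
    (hμ : tvNorm μ ≤ tvNorm (pointSources a)) {q v : UnitAddCircle → ℂ} (hq : Continuous q)
    (hv : ∀ t, ‖v t‖ = 1)
    (hvh : ∀ t, v t * (μ - pointSources a) {t} = (‖(μ - pointSources a) {t}‖ : ℝ))
    (hqv : ∀ t ∈ a.support, q t = v t) :
    ∫ t, (1 - ‖q t‖) ∂(μ - pointSources a).variation ≤ ‖cintegral (μ - pointSources a) q‖ := by
  classical
  have := isFiniteMeasure_variation_sub μ (pointSources a)
  have hle := variation_sub_pointSources_compl_le a hμ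
  have hm : MeasurableSet (a.support : Set UnitAddCircle) := a.support.measurableSet
  set h := μ - pointSources a
  set r : UnitAddCircle → ℂ := (a.support : Set UnitAddCircle)ᶜ.indicator q with hr
  set s : UnitAddCircle → ℂ := fun t => ∑ j ∈ a.support, ({j} : Set UnitAddCircle).indicator
    (fun _ => v j) t with hs
  have hqi := continuous_integrable_variation (μ := h) hq
  have hri : Integrable r h.variation := hqi.indicator hm.compl
  have hsi : ∀ j ∈ a.support, Integrable (({j} : Set UnitAddCircle).indicator
      (fun _ => v j)) h.variation := fun j _ =>
    (integrable_const (v j)).indicator (measurableSet_singleton j)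
  have hsplit : q = fun t => s t + r t := by
    ext t
    rw [hs, hr]; beta_reduce
    by_cases ht : t ∈ a.support
    · rw [Finset.sum_eq_single_of_mem t ht]
      · simp [ht, hqv t ht]
      · intro j _ hj
        simp [hj.symm]
    · rw [Finset.sum_eq_zero fun j hj => ?_]
      · simp [ht]
      · have : t ≠ j := by rintro rfl; exact ht hj
        simp [this]
  -- On the support `q` cancels the phases of the atoms, so that part of the pairing is their total
  -- mass.
  have h1 : cintegral h q = ((∑ j ∈ a.support, ‖h {j}‖ : ℝ) : ℂ) + cintegral h r := by
    rw [hsplit, cintegral_add (integrable_finsetSum _ hsi) hri, cintegral_finset_sum _ hsi]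
    congr 1
    rw [Complex.ofReal_sum]
    refine Finset.sum_congr rfl fun j _ => ?_
    rw [cintegral, VectorMeasure.integral_indicator_const _ (measurableSet_singleton j)]
    exact hvh j
  have h2 : ∑ j ∈ a.support, ‖h {j}‖ ≤ ‖cintegral h q‖ + ‖cintegral h r‖ := by
    have h3 : ((∑ j ∈ a.support, ‖h {j}‖ : ℝ) : ℂ) = cintegral h q - cintegral h r := by
      rw [h1]; ring
    have h4 := norm_sub_le (cintegral h q) (cintegral h r)
    rwa [← h3, Complex.norm_real,
      Real.norm_of_nonneg (Finset.sum_nonneg fun _ _ => norm_nonneg _)] at h4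
  -- On the support `|q| = 1`, so the deficit only sees the complement.
  have h5 : ∫ t, ‖r t‖ ∂h.variation + ∫ t, (1 - ‖q t‖) ∂h.variation
      = h.variation.real (a.support : Set UnitAddCircle)ᶜ := by
    have hi : Integrable (fun t => 1 - ‖q t‖) h.variation := (integrable_const _).sub hqi.norm
    rw [← integral_add hri.norm hi,
      ← integral_indicator_one hm.compl]
    congr 1; ext t
    by_cases ht : t ∈ a.support
    · simp [hr, ht, hqv t ht, hv]
    · simp [hr, ht]
  have h6 := norm_cintegral_le h r
  linarith

/-- The rounded-up half of `flo` is at least `flo / 2`, so separation `2 / flo` is at least the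
reciprocal of that integer. -/
lemma one_le_mul_norm_sub {flo : ℕ} (hflo : 1 ≤ flo) {T : Finset UnitAddCircle}
    (hT : ENNReal.ofReal (2 / (flo : ℝ)) ≤ Set.einfsep (T : Set UnitAddCircle))
    {s t : UnitAddCircle} (hs : s ∈ T) (ht : t ∈ T) (hst : s ≠ t) :
    1 ≤ (((flo + 1) / 2 : ℕ) : ℝ) * ‖s - t‖ := by
  have h := Set.le_einfsep_iff.1 hT s hs t ht hst
  rw [edist_dist, ENNReal.ofReal_le_ofReal_iff dist_nonneg, dist_eq_norm] at h
  have hflo' : (0 : ℝ) < flo := by exact_mod_cast hflo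
  have hM : (flo : ℝ) ≤ 2 * (((flo + 1) / 2 : ℕ) : ℝ) := by
    exact_mod_cast (by omega : flo ≤ 2 * ((flo + 1) / 2))
  rw [div_le_iff₀ hflo'] at h
  nlinarith [norm_nonneg (s - t)]

/-- Stability of total-variation minimization under deterministic noise. -/
theorem eLpNorm_conv_fejerKernel_le {flo : ℕ} (hflo : 1 ≤ flo) (a : UnitAddCircle →₀ ℂ)
    (ha : ENNReal.ofReal (2 / (flo : ℝ)) ≤ Set.einfsep (a.support : Set UnitAddCircle))
    {y : UnitAddCircle → ℂ} (hy : Continuous y) {δ : ℝ} (hδ : 0 ≤ δ)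
    (hx : IsFeasible flo y δ (pointSources a)) {μ : ComplexMeasure UnitAddCircle}
    (hμ : IsTVSolution flo y δ μ) {fhi : ℕ} (hf : flo < fhi) :
    eLpNorm (conv (fejerKernel fhi) (μ - pointSources a)) 1 volume ≤
      ENNReal.ofReal (117760 * ((fhi : ℝ) / flo) ^ 2 * δ) := by
  have hμx : tvNorm μ ≤ tvNorm (pointSources a) := hμ.2 _ hx
  -- Finiteness follows from minimality against the feasible point sources.
  have : IsFiniteMeasure μ.variation :=
    ⟨(hμx.trans (tvNorm_pointSources_le a)).trans_lt ENNReal.ofReal_lt_top⟩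
  have := isFiniteMeasure_variation_sub μ (pointSources a)
  have hlow := integral_norm_lowPass_sub_le hy hδ hμ.1 hx
  have hcert := fun q v => @integral_one_sub_norm_le a μ _ hμx q v
  set h := μ - pointSources a
  set M := (flo + 1) / 2 with hMdef
  have hM : 1 ≤ M := by omega
  have hMf : M ≤ fhi := by omega
  -- Equality for odd `flo`; for even `flo` one degree is left unused.
  have hdeg : 2 * M - 1 ≤ flo := by omega
  have hT : ∀ s ∈ a.support, ∀ t ∈ a.support, s ≠ t → 1 ≤ (M : ℝ) * ‖s - t‖ :=
    fun s hs t ht hst => one_le_mul_norm_sub hflo ha hs ht hst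
  choose v hv hvh using fun t => exists_norm_eq_one_mul_eq_norm (h {t})
  obtain ⟨q, hq, hqv, hnear, hfar⟩ := exists_dual_certificate hM hT (fun j => v j)
    ((pi_norm_le_iff_of_nonneg zero_le_one).2 fun j => (hv j).le)
  have hq1 : ∀ t, ‖q t‖ ≤ 1 := fun t => by
    rcases near_or_far hM a.support t with ⟨j, x, hx, rfl⟩ | h
    · have := hnear j x hx
      nlinarith [sq_nonneg x]
    · have := hfar t h
      linarith
  have hI : ∫ t, (1 - ‖q t‖) ∂h.variation ≤ 2 * δ := by
    refine (hcert q v hq.continuous hv hvh fun t ht => hqv ⟨t, ht⟩).trans ?_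
    refine (norm_cintegral_trigPoly_le h (hq.mono hdeg) hq1).trans ?_
    rwa [one_mul]
  obtain ⟨g, hg, hg1, hgeq⟩ := exists_trigPoly_integral_norm_conv_fejerKernel_le h fhi
  obtain ⟨p, hp, hpB, hgp⟩ := hg.exists_low_degree hM hMf hT hg1
  have hgp := hgp q hnear hfar
  rw [hgeq]
  refine ENNReal.ofReal_le_ofReal ?_
  set B : ℝ := 8 * fhi / M with hB
  have hM0 : (0 : ℝ) < M := by exact_mod_cast hM
  have hflo0 : (0 : ℝ) < flo := by exact_mod_cast hflo
  have hfhi0 : (0 : ℝ) < fhi := by exact_mod_cast (by omega : 0 < fhi)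
  have hB1 : 1 ≤ B := by
    rw [hB, le_div_iff₀ hM0]
    have : (M : ℝ) ≤ fhi := by exact_mod_cast hMf
    linarith
  have hB2 : B ≤ 16 * (fhi / flo) := by
    rw [hB, ← mul_div_assoc, div_le_div_iff₀ hM0 hflo0]
    have : (flo : ℝ) ≤ 2 * M := by exact_mod_cast (by omega : flo ≤ 2 * M)
    nlinarith
  have h1 : ‖cintegral h p‖ ≤ 10 * B * (2 * δ) :=
    (norm_cintegral_trigPoly_le h (hp.mono hdeg) hpB).trans
      (mul_le_mul_of_nonneg_left hlow (by positivity))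
  have hgc := hg.continuous
  have hpc := hp.continuous
  have hqc := hq.continuous
  have hgpi : Integrable (fun t => g t - p t) h.variation :=
    continuous_integrable_variation (by fun_prop)
  have h2 : ‖cintegral h (fun t => g t - p t)‖ ≤ 220 * B ^ 2 * (2 * δ) := by
    refine (norm_cintegral_le h _).trans
      ((integral_mono hgpi.norm (((integrable_const _).sub
        (continuous_integrable_variation hqc).norm).const_mul _) hgp).trans ?_)
    rw [integral_const_mul]
    exact mul_le_mul_of_nonneg_left hI (by positivity)
  have h3 : cintegral h g = cintegral h (fun t => g t - p t) + cintegral h p := by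
    rw [← cintegral_add hgpi (continuous_integrable_variation hpc)]
    simp only [sub_add_cancel]
  have h4 := norm_add_le (cintegral h (fun t => g t - p t)) (cintegral h p)
  rw [← h3] at h4
  have h5 : B ^ 2 ≤ (16 * (fhi / flo)) ^ 2 := by gcongr
  have h6 : B ≤ B ^ 2 := by nlinarith
  -- The total is at most `(220 * 2 + 10 * 2) B² δ` with `B ≤ 16 SRF`, and `460 * 256 = 117760`.
  nlinarith [mul_le_mul_of_nonneg_right h5 hδ, mul_le_mul_of_nonneg_right h6 hδ]

/-! ### Gaussian noise -/

/-- The moment generating function of the square is `(1 - 2 v s) ^ (-1/2)`. Parametrizing `s` by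
this value `r` makes the Chernoff exponent explicit. -/
lemma mgf_sq_gaussianReal {v : ℝ≥0} (hv : v ≠ 0) {r : ℝ} (hr : 0 < r) :
    mgf (fun x => x ^ 2) (gaussianReal 0 v) ((1 - (r ^ 2)⁻¹) / (2 * v)) = r := by
  have hv0 : (0 : ℝ) < v := by exact_mod_cast pos_iff_ne_zero.2 hv
  have hpi := Real.pi_pos
  rw [mgf, integral_gaussianReal_eq_integral_smul hv]
  have : ∀ x : ℝ, gaussianPDFReal 0 v x • Real.exp ((1 - (r ^ 2)⁻¹) / (2 * v) * x ^ 2)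
      = (Real.sqrt (2 * Real.pi * v))⁻¹ * Real.exp (-(r ^ 2 * (2 * v))⁻¹ * x ^ 2) := fun x => by
    rw [gaussianPDFReal, smul_eq_mul, mul_assoc, ← Real.exp_add]
    congr 2
    field_simp
    ring
  simp_rw [this]
  rw [integral_const_mul, integral_gaussian, div_inv_eq_mul,
    show Real.pi * (r ^ 2 * (2 * v)) = r ^ 2 * (2 * Real.pi * v) by ring,
    Real.sqrt_mul (sq_nonneg r), Real.sqrt_sq hr.le]
  have : 0 < Real.sqrt (2 * Real.pi * v) := Real.sqrt_pos.2 (by positivity)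
  field_simp

lemma norm_sq_eq_add {Ω : Type*} (Z : Ω → ℂ) :
    (fun ω => ‖Z ω‖ ^ 2) = (fun ω => (Z ω).re ^ 2) + fun ω => (Z ω).im ^ 2 := by
  ext ω
  rw [Pi.add_apply, Complex.sq_norm, Complex.normSq_apply, sq, sq]

variable {Ω : Type*} [MeasurableSpace Ω] {P : Measure Ω}

lemma IsComplexGaussian.aemeasurable_norm_sq {Z : Ω → ℂ} {σ : ℝ≥0}
    (h : IsComplexGaussian Z σ P) : AEMeasurable (fun ω => ‖Z ω‖ ^ 2) P := by
  rw [norm_sq_eq_add]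
  exact (h.1.aemeasurable.pow_const 2).add (h.2.1.aemeasurable.pow_const 2)

lemma _root_.ProbabilityTheory.HasLaw.mgf_sq_gaussianReal {X : Ω → ℝ} {v : ℝ≥0}
    (hX : HasLaw X (gaussianReal 0 v) P) (hv : v ≠ 0) {r : ℝ} (hr : 0 < r) :
    mgf (fun ω => X ω ^ 2) P ((1 - (r ^ 2)⁻¹) / (2 * v)) = r := by
  have h := SuperRes.mgf_sq_gaussianReal hv hr
  rwa [← hX.map_eq, mgf_map hX.aemeasurable (by fun_prop)] at h

lemma IsComplexGaussian.mgf_norm_sq {Z : Ω → ℂ} {σ : ℝ≥0} (h : IsComplexGaussian Z σ P)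
    (hσ : σ ≠ 0) {r : ℝ} (hr : 0 < r) :
    mgf (fun ω => ‖Z ω‖ ^ 2) P ((1 - (r ^ 2)⁻¹) / (2 * (σ ^ 2 : ℝ≥0))) = r ^ 2 := by
  have hi : IndepFun (fun ω => (Z ω).re ^ 2) (fun ω => (Z ω).im ^ 2) P :=
    h.2.2.comp (φ := fun x : ℝ => x ^ 2) (ψ := fun x : ℝ => x ^ 2) (by fun_prop) (by fun_prop)
  have hσ2 : σ ^ 2 ≠ 0 := pow_ne_zero 2 hσ
  rw [norm_sq_eq_add, hi.mgf_add' (h.1.aemeasurable.pow_const 2).aestronglyMeasurable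
    (h.2.1.aemeasurable.pow_const 2).aestronglyMeasurable, h.1.mgf_sq_gaussianReal hσ2 hr,
    h.2.1.mgf_sq_gaussianReal hσ2 hr, sq]

lemma IsComplexGaussian.ae_eq_zero {Z : Ω → ℂ} (h : IsComplexGaussian Z 0 P) :
    ∀ᵐ ω ∂P, Z ω = 0 := by
  have hz : ∀ {X : Ω → ℝ}, HasLaw X (gaussianReal 0 ((0 : ℝ≥0) ^ 2)) P → ∀ᵐ ω ∂P, X ω = 0 := by
    intro X hX
    refine ae_of_ae_map hX.aemeasurable (p := fun x => x = 0) ?_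
    rw [hX.map_eq, zero_pow two_ne_zero, gaussianReal_zero_var]
    simp [ae_dirac_eq]
  filter_upwards [hz h.1, hz h.2.1] with ω h1 h2
  exact Complex.ext h1 h2

/-- Chernoff bound for the energy of a complex Gaussian vector. -/
lemma measure_sum_norm_sq_le {ι : Type*} [Fintype ι] [IsProbabilityMeasure P] {ε : ι → Ω → ℂ}
    (hε : iIndepFun ε P) {σ : ℝ≥0} (hg : ∀ k, IsComplexGaussian (ε k) σ P) {γ : ℝ} (hγ : 0 < γ) :
    P {ω | (1 + γ) ^ 2 * σ ^ 2 * (2 * Fintype.card ι) < ∑ k, ‖ε k ω‖ ^ 2} ≤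
      ENNReal.ofReal (Real.exp (-Fintype.card ι * γ ^ 2)) := by
  -- The exponential parameter divides by the variance, so the noiseless case is separate.
  rcases eq_or_ne σ 0 with rfl | hσ
  · have h0 : ∀ᵐ ω ∂P, ∀ k, ε k ω = 0 := ae_all_iff.2 fun k => (hg k).ae_eq_zero
    refine le_of_eq_of_le (measure_mono_null (t := {ω | ¬ ∀ k, ε k ω = 0}) ?_ h0) (zero_le)
    intro ω hω h
    simp [h] at hω
  · set r := 1 + γ with hr
    set n := Fintype.card ι with hn
    have hr0 : 0 < r := by positivity
    have hσ0 : (0 : ℝ) < σ := by exact_mod_cast pos_iff_ne_zero.2 hσ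
    set s : ℝ := (1 - (r ^ 2)⁻¹) / (2 * (σ ^ 2 : ℝ≥0)) with hs
    have hs0 : 0 ≤ s := by
      refine div_nonneg (sub_nonneg.2 (inv_le_one_of_one_le₀ ?_)) (by positivity)
      nlinarith
    have hind : iIndepFun (fun k ω => ‖ε k ω‖ ^ 2) P :=
      hε.comp (g := fun _ z => ‖z‖ ^ 2) fun _ => by fun_prop
    have hmgf : mgf (∑ k, fun ω => ‖ε k ω‖ ^ 2) P s = r ^ (2 * n) := by
      rw [hind.mgf_sum₀ (fun k => (hg k).aemeasurable_norm_sq), Finset.prod_congr rfl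
        fun k _ => (hg k).mgf_norm_sq hσ hr0, Finset.prod_const, Finset.card_univ, pow_mul]
    -- Without integrability the moment generating function would take the default value 0, but it
    -- is a positive power of `r`.
    have hint : Integrable (fun ω => Real.exp (s * (∑ k, fun ω => ‖ε k ω‖ ^ 2) ω)) P := by
      by_contra h
      rw [mgf_undef h] at hmgf
      exact (pow_pos hr0 (2 * n)).ne hmgf
    have hch := measure_ge_le_exp_mul_mgf (r ^ 2 * σ ^ 2 * (2 * n)) hs0 hint
    rw [hmgf] at hch
    -- The exponent is `-n (r² - 1) + 2 n log r`, and `log r ≤ r - 1` turns it into `-n (r - 1)² =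
    -- -n γ²`.
    have hexp : Real.exp (-s * (r ^ 2 * σ ^ 2 * (2 * n))) * r ^ (2 * n)
        ≤ Real.exp (-n * γ ^ 2) := by
      have h1 : r ^ (2 * n) = Real.exp (2 * n * Real.log r) := by
        rw [← Real.exp_log (pow_pos hr0 (2 * n)), Real.log_pow]
        push_cast; rfl
      have h2 : s * (r ^ 2 * σ ^ 2 * (2 * n)) = n * (r ^ 2 - 1) := by
        rw [hs]; push_cast
        field_simp
      rw [h1, ← Real.exp_add, Real.exp_le_exp, neg_mul, h2]
      have h3 := Real.log_le_sub_one_of_pos hr0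
      have h4 : (0 : ℝ) ≤ n := Nat.cast_nonneg n
      have h5 : γ = r - 1 := by rw [hr]; ring
      rw [h5]
      nlinarith [mul_le_mul_of_nonneg_left h3 h4]
    refine (measure_mono fun ω hω => ?_).trans
      (ENNReal.le_ofReal_iff_toReal_le (measure_ne_top P _) (Real.exp_pos _).le |>.2
        (hch.trans hexp))
    rw [Set.mem_ofPred_eq] at hω ⊢
    rw [Finset.sum_apply]
    exact hω.le

/-- The noise is only almost everywhere measurable, so the event is the complement of a measurable
hull of the bad set. -/
lemma exists_measurableSet_sum_norm_sq_le {flo : ℕ} [IsProbabilityMeasure P]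
    {ε : LowFreq flo → Ω → ℂ} (hε : iIndepFun ε P) {σ : ℝ≥0}
    (hg : ∀ k, IsComplexGaussian (ε k) σ P) {γ : ℝ} (hγ : 0 < γ) :
    ∃ E : Set Ω, MeasurableSet E ∧
      ENNReal.ofReal (1 - Real.exp (-2 * (flo : ℝ) * γ ^ 2)) ≤ P E ∧
      ∀ ω ∈ E, ∑ k, ‖ε k ω‖ ^ 2 ≤ ((1 + γ) * (σ : ℝ) * Real.sqrt (4 * (flo : ℝ) + 2)) ^ 2 := by
  have hcard : Fintype.card (LowFreq flo) = 2 * flo + 1 := by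
    rw [Fintype.card_coe, Int.card_Icc]; omega
  have h := measure_sum_norm_sq_le hε hg hγ
  rw [hcard] at h
  set S := {ω | (1 + γ) ^ 2 * σ ^ 2 * (2 * ((2 * flo + 1 : ℕ) : ℝ)) < ∑ k, ‖ε k ω‖ ^ 2}
  refine ⟨(toMeasurable P S)ᶜ, (measurableSet_toMeasurable P S).compl, ?_, fun ω hω => ?_⟩
  · rw [prob_compl_eq_one_sub (measurableSet_toMeasurable P S), measure_toMeasurable,
      ENNReal.ofReal_sub _ (Real.exp_pos _).le, ENNReal.ofReal_one]
    -- There are `2 * flo + 1` samples; the extra one in the exponent is dropped.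
    refine tsub_le_tsub_left (h.trans (ENNReal.ofReal_le_ofReal (Real.exp_le_exp.2 ?_))) 1
    push_cast
    nlinarith [sq_nonneg γ]
  · have : ω ∉ S := fun h => hω (subset_toMeasurable P S h)
    rw [Set.mem_ofPred_eq, not_lt] at this
    rw [mul_pow, mul_pow, Real.sq_sqrt (by positivity)]
    refine this.trans_eq ?_
    push_cast; ring

lemma integral_norm_sq_synth {flo : ℕ} (η : LowFreq flo → ℂ) :
    ∫ t, ‖synth η t‖ ^ 2 = ∑ k, ‖η k‖ ^ 2 := by
  have h : ∀ t, ((‖synth η t‖ ^ 2 : ℝ) : ℂ) = ∑ k : LowFreq flo, ∑ j : LowFreq flo,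
      η k * starRingEnd ℂ (η j) * fourier ((k : ℤ) - j) t := fun t => by
    rw [Complex.ofReal_pow, ← Complex.mul_conj', synth, map_sum, Finset.sum_mul_sum]
    refine Finset.sum_congr rfl fun k _ => Finset.sum_congr rfl fun j _ => ?_
    rw [map_mul, ← fourier_neg, sub_eq_add_neg, fourier_add]
    ring
  apply Complex.ofReal_injective
  rw [← integral_complex_ofReal]
  simp_rw [h]
  rw [integral_finsetSum _ fun k _ => integrable_of_continuous (by fun_prop), Complex.ofReal_sum]
  refine Finset.sum_congr rfl fun k _ => ?_
  rw [integral_finsetSum _ fun j _ => integrable_of_continuous (by fun_prop),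
    Finset.sum_eq_single k]
  · rw [integral_const_mul, integral_fourier, sub_self, if_pos rfl, mul_one, Complex.mul_conj',
      Complex.ofReal_pow]
  · intro j _ hj
    rw [integral_const_mul, integral_fourier, if_neg, mul_zero]
    exact fun h => hj (Subtype.ext (sub_eq_zero.1 h).symm)
  · simp

lemma continuous_synth {flo : ℕ} (η : LowFreq flo → ℂ) : Continuous (synth η) := by
  unfold synth; fun_prop

/-- The residual of the true measure is minus the synthesized noise, whose L² norm is given by
Parseval. -/
lemma isFeasible_pointSources {flo : ℕ} (a : UnitAddCircle →₀ ℂ) {e : LowFreq flo → ℂ} {δ : ℝ}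
    (hδ : 0 ≤ δ) (he : ∑ k, ‖e k‖ ^ 2 ≤ δ ^ 2) :
    IsFeasible flo (synth (noisySpectrum (pointSources a) e)) δ (pointSources a) := by
  have h1 : (fun t => lowPass flo (pointSources a) t
      - synth (noisySpectrum (pointSources a) e) t) = -synth e := by
    ext t
    rw [lowPass_eq, ← Finset.sum_coe_sort, Pi.neg_apply, synth, synth, ← Finset.sum_sub_distrib,
      ← Finset.sum_neg_distrib]
    refine Finset.sum_congr rfl fun k _ => ?_
    rw [noisySpectrum]; ring
  rw [IsFeasible, h1, eLpNorm_neg]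
  have : IsProbabilityMeasure (volume : Measure UnitAddCircle) := ⟨by simp⟩
  have hmem : MemLp (synth e) 2 volume := by
    obtain ⟨C, hC⟩ := (isCompact_univ.exists_bound_of_continuousOn (continuous_synth e).continuousOn)
    exact MemLp.of_bound (continuous_synth e).aestronglyMeasurable C
      (Filter.Eventually.of_forall fun t => hC t trivial)
  rw [hmem.eLpNorm_eq_integral_rpow_norm (by norm_num) (by norm_num)]
  refine ENNReal.ofReal_le_ofReal ?_
  simp only [ENNReal.toReal_ofNat, Real.rpow_two]
  rw [integral_norm_sq_synth, ← one_div, ← Real.sqrt_eq_rpow]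
  exact Real.sqrt_le_iff.2 ⟨hδ, he⟩

end SuperRes

end

theorem corollary1 :
    ∃ C₀ : ℝ, 0 < C₀ ∧
      ∀ (flo : ℕ) (_ : 1 ≤ flo)
        (a : UnitAddCircle →₀ ℂ)
        (_ : ENNReal.ofReal (2 / (flo : ℝ)) ≤ Set.einfsep (a.support : Set UnitAddCircle))
        (σ : ℝ≥0) (γ : ℝ) (_ : 0 < γ)
        {Ω : Type*} [MeasurableSpace Ω] (P : Measure Ω) [IsProbabilityMeasure P]
        (ε : SuperRes.LowFreq flo → Ω → ℂ)
        (_ : iIndepFun ε P)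
        (_ : ∀ k, SuperRes.IsComplexGaussian (ε k) σ P),
        ∃ E : Set Ω, MeasurableSet E ∧
          ENNReal.ofReal (1 - Real.exp (-2 * (flo : ℝ) * γ ^ 2)) ≤ P E ∧
          ∀ ω ∈ E, ∀ xest : ComplexMeasure UnitAddCircle,
            SuperRes.IsTVSolution flo
              (SuperRes.synth
                (SuperRes.noisySpectrum (SuperRes.pointSources a) (fun k => ε k ω)))
              ((1 + γ) * (σ : ℝ) * Real.sqrt (4 * (flo : ℝ) + 2)) xest →
            ∀ fhi : ℕ, flo < fhi →
              eLpNorm (SuperRes.conv (SuperRes.fejerKernel fhi)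
                  (xest - SuperRes.pointSources a)) 1 volume ≤
                ENNReal.ofReal
                  (C₀ * (1 + γ) * Real.sqrt (4 * (flo : ℝ) + 2) *
                    ((fhi : ℝ) / (flo : ℝ)) ^ 2 * (σ : ℝ)) := by
  refine ⟨117760, by norm_num, ?_⟩
  intro flo hflo a ha σ γ hγ Ω _ P _ ε hε hg
  obtain ⟨E, hE, hPE, hsum⟩ := SuperRes.exists_measurableSet_sum_norm_sq_le hε hg hγ
  refine ⟨E, hE, hPE, fun ω hω xest hx fhi hf => ?_⟩
  have hδ : 0 ≤ (1 + γ) * (σ : ℝ) * Real.sqrt (4 * (flo : ℝ) + 2) := by positivity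
  refine (SuperRes.eLpNorm_conv_fejerKernel_le hflo a ha (SuperRes.continuous_synth _) hδ
    (SuperRes.isFeasible_pointSources a hδ (hsum ω hω)) hx hf).trans_eq ?_
  congr 1; ring
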